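/- Let $G$ be a compact connected Lie group, $\langle\cdot,\cdot\rangle$ an $\mathrm{Ad}_G$-invariant Euclidean metric on its Lie algebra $\mathfrak g$, $H\subset G$ a closed subgroup with Lie algebra $\mathfrak h$, and $\mathfrak g=\mathfrak h+\mathfrak m$ the $\langle\cdot,\cdot\rangle$-orthogonal decomposition, where $\mathfrak m$ is identified with $T_o(G/H)$, $o=eH$. A homogeneous space $L/S$ of a Lie group $L$ with an $L$-invariant Riemannian metric is called a GO-space, and the metric a GO-metric, if every geodesic is an orbit of a one-parameter subgroup of $L$, i.e. has the form $t\mapsto\varphi(t)x$ (on its interval of definition) with a smooth homomorphism $\varphi:\mathbb R\to L$ and a point $x$. Let $(M=G/H,g^M)$ be a GO-space, let $g=(\cdot,\cdot)$ be the Euclidean metric on $\mathfrak m$ defined by $g^M$, and let $A$ be the metric endomorphism of $\mathfrak m$, defined by $(X,Y)=\langle AX,Y\rangle$. Let $K\subset G$ be a connected (not necessarily closed) Lie subgroup with Lie algebra $\mathfrak k$ which contains $H$. 1. The orbit $P=Ko=K/H$, an injectively immersed submanifold of $M$, is totally geodesic, and with the induced metric it is a GO-space of $K$. 2. Put $\mathfrak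 p=\mathfrak k\cap\mathfrak m$, let $\mathfrak p^\perp$ be its $g$-orthogonal complement in $\mathfrak m$, and assume that $A\mathfrak p\subset\mathfrak p$. Then: (a) $[\mathfrak k,\mathfrak p^\perp]\subset\mathfrak p^\perp$; (b) $\mathfrak p^\perp$ is $\mathrm{Ad}_K$-invariant and the metric $\bar g=g|_{\mathfrak p^\perp}$ is $\mathrm{Ad}_K$-invariant; (c) if $K$ is closed in $G$, there is exactly one $G$-invariant Riemannian metric $g^N$ on $N=G/K$ which induces $\bar g$ on $\mathfrak p^\perp\cong T_{eK}N$; $(N,g^N)$ is a GO-space of $G$; the projection $\pi:G/H\to G/K$, $aH\mapsto aK$, is a Riemannian submersion; and each fibre $\pi^{-1}(aK)=aP$ ($a\in G$) is an embedded totally geodesic submanifold which, with the induced metric, is a GO-space of $K$ (acting through $k\mapsto aka^{-1}$, so that $aP\cong K/H$). -/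

import Mathlib

open scoped Manifold ContDiff Topology
open Bundle

noncomputable section

/-! ### Riemannian metrics, geodesics, totally geodesic maps, Riemannian submersions -/

section Riemannian

variable {F : Type*} [NormedAddCommGroup F] [NormedSpace ℝ F]
  {M : Type*} [TopologicalSpace M] [ChartedSpace F M] [IsManifold 𝓘(ℝ, F) ∞ M]
  {F' : Type*} [NormedAddCommGroup F'] [NormedSpace ℝ F']
  {M' : Type*} [TopologicalSpace M'] [ChartedSpace F' M'] [IsManifold 𝓘(ℝ, F') ∞ M']

variable (F M) in
/-- Smooth Riemannian metrics on the smooth manifold `M` modelled on `F`. -/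
abbrev SmoothMetric : Type _ :=
  ContMDiffRiemannianMetric 𝓘(ℝ, F) ∞ F (fun x : M => TangentSpace 𝓘(ℝ, F) x)

/-- The coefficients `g_y(v, w)` of the metric in the chart of `M` at `x₀`
(`y` a point of the chart domain in `F`; `v`, `w` constant coordinate vector fields). -/
def metricCoeff (g : SmoothMetric F M) (x₀ : M) (y v w : F) : ℝ :=
  g.inner ((extChartAt 𝓘(ℝ, F) x₀).symm y)
    (mfderiv 𝓘(ℝ, F) 𝓘(ℝ, F) (extChartAt 𝓘(ℝ, F) x₀).symm y v)
    (mfderiv 𝓘(ℝ, F) 𝓘(ℝ, F) (extChartAt 𝓘(ℝ, F) x₀).symm y w)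

/-- Christoffel symbols of the first kind in the chart at `x₀`:
`Γ(u, v; w) = 1/2 (∂_u g(v, w) + ∂_v g(u, w) - ∂_w g(u, v))`, so that
`g(∇_u v, w) = Γ(u, v; w)` for the Levi-Civita connection. -/
def christoffelFirst (g : SmoothMetric F M) (x₀ : M) (y u v w : F) : ℝ :=
  (1 / 2 : ℝ) *
    (fderiv ℝ (fun z => metricCoeff g x₀ z v w) y u
      + fderiv ℝ (fun z => metricCoeff g x₀ z u w) y v
      - fderiv ℝ (fun z => metricCoeff g x₀ z u v) y w)

/-- `γ` is a geodesic of `g` on the (open) set `J` of parameters: it is smooth there and in every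
chart it satisfies the geodesic equation `c'' + Γ(c', c') = 0` (with the index lowered by `g`). -/
def IsGeodesicOn (g : SmoothMetric F M) (γ : ℝ → M) (J : Set ℝ) : Prop :=
  ContMDiffOn 𝓘(ℝ, ℝ) 𝓘(ℝ, F) ∞ γ J ∧
    ∀ x₀ : M, ∀ t ∈ J, γ t ∈ (extChartAt 𝓘(ℝ, F) x₀).source →
      ∀ w : F,
        metricCoeff g x₀ (extChartAt 𝓘(ℝ, F) x₀ (γ t))
            (deriv (deriv fun s => extChartAt 𝓘(ℝ, F) x₀ (γ s)) t) w
          + christoffelFirst g x₀ (extChartAt 𝓘(ℝ, F) x₀ (γ t))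
            (deriv (fun s => extChartAt 𝓘(ℝ, F) x₀ (γ s)) t)
            (deriv (fun s => extChartAt 𝓘(ℝ, F) x₀ (γ s)) t) w = 0

/-- `j : (M, g) → (M', g')` is an isometric immersion: a smooth immersion such that `g` is
the metric induced by `g'`. -/
structure IsIsometricImmersion (g : SmoothMetric F M) (g' : SmoothMetric F' M')
    (j : M → M') : Prop where
  contMDiff : ContMDiff 𝓘(ℝ, F) 𝓘(ℝ, F') ∞ j
  injective_mfderiv : ∀ x, Function.Injective (mfderiv 𝓘(ℝ, F) 𝓘(ℝ, F') j x)
  inner_eq : ∀ (x : M) (v w : TangentSpace 𝓘(ℝ, F) x),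
    g.inner x v w =
      g'.inner (j x) (mfderiv 𝓘(ℝ, F) 𝓘(ℝ, F') j x v) (mfderiv 𝓘(ℝ, F) 𝓘(ℝ, F') j x w)

/-- The (immersed) submanifold `j : M → M'`, with the induced metric `g`, is totally geodesic in
`(M', g')`: each of its geodesics is a geodesic of the ambient manifold. -/
structure IsTotallyGeodesic (g : SmoothMetric F M) (g' : SmoothMetric F' M')
    (j : M → M') : Prop extends IsIsometricImmersion g g' j where
  map_geodesic : ∀ (γ : ℝ → M) (J : Set ℝ), IsOpen J → J.OrdConnected →
    IsGeodesicOn g γ J → IsGeodesicOn g' (fun t => j (γ t)) J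

/-- `p : (M, g) → (M', g')` is a Riemannian submersion: a surjective smooth submersion whose
differential is isometric on the horizontal spaces `(ker dp)^⊥`. -/
structure IsRiemannianSubmersion (g : SmoothMetric F M) (g' : SmoothMetric F' M')
    (p : M → M') : Prop where
  contMDiff : ContMDiff 𝓘(ℝ, F) 𝓘(ℝ, F') ∞ p
  surjective : Function.Surjective p
  surjective_mfderiv : ∀ x, Function.Surjective (mfderiv 𝓘(ℝ, F) 𝓘(ℝ, F') p x)
  inner_eq : ∀ (x : M) (v w : TangentSpace 𝓘(ℝ, F) x),
    (∀ u, mfderiv 𝓘(ℝ, F) 𝓘(ℝ, F') p x u = 0 → g.inner x v u = 0) →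
    (∀ u, mfderiv 𝓘(ℝ, F) 𝓘(ℝ, F') p x u = 0 → g.inner x w u = 0) →
    g'.inner (p x) (mfderiv 𝓘(ℝ, F) 𝓘(ℝ, F') p x v) (mfderiv 𝓘(ℝ, F) 𝓘(ℝ, F') p x w)
      = g.inner x v w

end Riemannian

/-! ### Lie groups, their actions, and GO-metrics -/

section LieGroups

variable (E : Type*) [NormedAddCommGroup E] [NormedSpace ℝ E]
  {L : Type*} [TopologicalSpace L] [ChartedSpace E L] [Group L]
  {F : Type*} [NormedAddCommGroup F] [NormedSpace ℝ F]
  {M : Type*} [TopologicalSpace M] [ChartedSpace F M] [IsManifold 𝓘(ℝ, F) ∞ M]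

/-- One-parameter subgroups: smooth homomorphisms `ℝ → L`. -/
def IsOneParameterSubgroup (φ : ℝ → L) : Prop :=
  ContMDiff 𝓘(ℝ, ℝ) 𝓘(ℝ, E) ∞ φ ∧ ∀ s t, φ (s + t) = φ s * φ t

variable (L) in
/-- The metric `g` is invariant under the action of `L`. -/
def IsInvariantMetric [MulAction L M] (g : SmoothMetric F M) : Prop :=
  ∀ (a : L) (x : M) (v w : TangentSpace 𝓘(ℝ, F) x),
    g.inner (a • x) (mfderiv 𝓘(ℝ, F) 𝓘(ℝ, F) (fun y : M => a • y) x v)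
      (mfderiv 𝓘(ℝ, F) 𝓘(ℝ, F) (fun y : M => a • y) x w) = g.inner x v w

variable (L) in
/-- `g` is a GO-metric on the homogeneous space `M` of `L`: it is invariant and every geodesic
(defined on any open interval) is, on its interval of definition, an orbit of a one-parameter
subgroup of `L`. -/
def IsGOMetric [MulAction L M] (g : SmoothMetric F M) : Prop :=
  IsInvariantMetric L g ∧
    ∀ (γ : ℝ → M) (J : Set ℝ), IsOpen J → J.OrdConnected → IsGeodesicOn g γ J →
      ∃ (φ : ℝ → L) (x : M), IsOneParameterSubgroup E φ ∧ ∀ t ∈ J, γ t = φ t • x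

/-- The given smooth structure on the coset space `L ⧸ S` is the standard one of the homogeneous
manifold: the projection `L → L ⧸ S` is a smooth submersion (this determines the smooth structure)
and `L` acts smoothly. -/
structure IsHomogeneousManifold [IsManifold 𝓘(ℝ, E) ∞ L] (F : Type*) [NormedAddCommGroup F]
    [NormedSpace ℝ F] (S : Subgroup L) [ChartedSpace F (L ⧸ S)]
    [IsManifold 𝓘(ℝ, F) ∞ (L ⧸ S)] : Prop where
  contMDiff_mk : ContMDiff 𝓘(ℝ, E) 𝓘(ℝ, F) ∞ (fun a : L => (a : L ⧸ S))
  surjective_mfderiv_mk : ∀ a : L,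
    Function.Surjective (mfderiv 𝓘(ℝ, E) 𝓘(ℝ, F) (fun a : L => (a : L ⧸ S)) a)
  smooth_smul : ContMDiffSMul 𝓘(ℝ, E) 𝓘(ℝ, F) ∞ L (L ⧸ S)

end LieGroups

section Algebra

variable {E : Type*} [NormedAddCommGroup E] [NormedSpace ℝ E]
  {G : Type*} [TopologicalSpace G] [ChartedSpace E G] [Group G]

/-- The adjoint representation: `Ad a` is the differential at `1` of `x ↦ a x a⁻¹`. -/
def adjointRep (a : G) :
    GroupLieAlgebra 𝓘(ℝ, E) G → GroupLieAlgebra 𝓘(ℝ, E) G :=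
  mfderiv 𝓘(ℝ, E) 𝓘(ℝ, E) (fun x : G => a * x * a⁻¹) 1

/-- `b` is an `Ad`-invariant Euclidean metric on the Lie algebra of `G`. -/
structure IsInvariantEuclidean (b : LinearMap.BilinForm ℝ (GroupLieAlgebra 𝓘(ℝ, E) G)) :
    Prop where
  symm : ∀ X Y, b X Y = b Y X
  pos : ∀ X, X ≠ 0 → 0 < b X X
  invariant : ∀ (a : G) (X Y), b (adjointRep a X) (adjointRep a Y) = b X Y

/-- The Lie algebra of a closed subgroup `H`: initial velocities of the one-parameter subgroups of
`G` contained in `H`. -/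
def subgroupLieAlgebra (H : Subgroup G) : Set (GroupLieAlgebra 𝓘(ℝ, E) G) :=
  {X | ∃ φ : ℝ → G, IsOneParameterSubgroup E φ ∧ (∀ t, φ t ∈ H) ∧
    X = mfderiv 𝓘(ℝ, ℝ) 𝓘(ℝ, E) φ 0 (1 : ℝ)}

/-- The `b`-orthogonal complement `𝔪` of `𝔥 = Lie(H)`. -/
def reductiveComplement (b : LinearMap.BilinForm ℝ (GroupLieAlgebra 𝓘(ℝ, E) G))
    (H : Subgroup G) : Submodule ℝ (GroupLieAlgebra 𝓘(ℝ, E) G) where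
  carrier := {Y | ∀ X ∈ subgroupLieAlgebra H, b X Y = 0}
  add_mem' hY hZ X hX := by rw [map_add, hY X hX, hZ X hX, add_zero]
  zero_mem' X _ := by rw [map_zero]
  smul_mem' c Y hY X hX := by rw [map_smul, hY X hX, smul_zero]

/-- The differential at `1` of the projection `G → G/S`; it is the identification
of complements of `𝔰` in `𝔤` with the tangent space of `G/S` at the initial point. -/
def projDiff {F : Type*} [NormedAddCommGroup F] [NormedSpace ℝ F] (S : Subgroup G)
    [ChartedSpace F (G ⧸ S)] :
    GroupLieAlgebra 𝓘(ℝ, E) G →L[ℝ] TangentSpace 𝓘(ℝ, F) ((1 : G) : G ⧸ S) :=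
  mfderiv 𝓘(ℝ, E) 𝓘(ℝ, F) (fun a : G => (a : G ⧸ S)) 1

/-- The symmetric bilinear form `(X, Y) = g_o(X_o, Y_o)` on `𝔤` given by a metric on `G/H`; its
restriction to `𝔪` is the Euclidean metric on `𝔪 = T_o(G/H)`. -/
def originForm {F : Type*} [NormedAddCommGroup F] [NormedSpace ℝ F] (H : Subgroup G)
    [ChartedSpace F (G ⧸ H)] [IsManifold 𝓘(ℝ, F) ∞ (G ⧸ H)] (g : SmoothMetric F (G ⧸ H)) :
    LinearMap.BilinForm ℝ (GroupLieAlgebra 𝓘(ℝ, E) G) :=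
  LinearMap.mk₂ ℝ
    (fun X Y => g.inner ((1 : G) : G ⧸ H) (projDiff H X) (projDiff H Y))
    (fun X X' Y => by simp only [map_add, add_apply])
    (fun c X Y => by simp only [map_smul, smul_apply])
    (fun X Y Y' => by simp only [map_add])
    (fun c X Y => by simp only [map_smul])

theorem IsInvariantEuclidean.restrict_nondegenerate
    {b : LinearMap.BilinForm ℝ (GroupLieAlgebra 𝓘(ℝ, E) G)} (hb : IsInvariantEuclidean b)
    (m : Submodule ℝ (GroupLieAlgebra 𝓘(ℝ, E) G)) : (b.restrict m).Nondegenerate := by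
  have key : ∀ x : m, b x x = 0 → x = 0 := fun x hx => by
    by_contra h
    exact (hb.pos x (fun h0 => h (Subtype.ext h0))).ne' hx
  exact ⟨fun x hx => key x (hx x), fun x hx => key x (hx x)⟩

/-- The metric endomorphism `A = b_𝔪⁻¹ ∘ g` of `𝔪`, i.e. `b(A X, Y) = (X, Y)` on `𝔪`. -/
def metricEndomorphism [FiniteDimensional ℝ E]
    {F : Type*} [NormedAddCommGroup F] [NormedSpace ℝ F]
    {b : LinearMap.BilinForm ℝ (GroupLieAlgebra 𝓘(ℝ, E) G)} (hb : IsInvariantEuclidean b)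
    (H : Subgroup G) [ChartedSpace F (G ⧸ H)] [IsManifold 𝓘(ℝ, F) ∞ (G ⧸ H)]
    (g : SmoothMetric F (G ⧸ H)) :
    reductiveComplement b H →ₗ[ℝ] reductiveComplement b H :=
  haveI : FiniteDimensional ℝ (GroupLieAlgebra 𝓘(ℝ, E) G) := inferInstanceAs
    (FiniteDimensional ℝ E)
  LinearMap.BilinForm.symmCompOfNondegenerate
    ((originForm H g).restrict (reductiveComplement b H))
    (b.restrict (reductiveComplement b H)) (hb.restrict_nondegenerate _)

variable {E' : Type*} [NormedAddCommGroup E'] [NormedSpace ℝ E']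
  {K : Type*} [TopologicalSpace K] [ChartedSpace E' K] [Group K]

/-- `ι : K → G` is a Lie subgroup: a smooth injective homomorphism which is an immersion
(not necessarily closed or embedded). -/
structure IsLieSubgroup (ι : K →* G) : Prop where
  injective : Function.Injective ι
  contMDiff : ContMDiff 𝓘(ℝ, E') 𝓘(ℝ, E) ∞ ι
  injective_mfderiv : ∀ k, Function.Injective (mfderiv 𝓘(ℝ, E') 𝓘(ℝ, E) ι k)

variable (E')

/-- The Lie algebra `𝔨 ⊆ 𝔤` of a Lie subgroup `ι : K → G`: the image of the differential
of `ι` at `1`. -/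
def lieSubgroupAlgebra (ι : K →* G) : Submodule ℝ (GroupLieAlgebra 𝓘(ℝ, E) G) :=
  LinearMap.range
    (mfderiv 𝓘(ℝ, E') 𝓘(ℝ, E) ι 1 : GroupLieAlgebra 𝓘(ℝ, E') K →L[ℝ]
      GroupLieAlgebra 𝓘(ℝ, E) G).toLinearMap

/-- `𝔭 = 𝔨 ∩ 𝔪`. -/
def tangentPart (b : LinearMap.BilinForm ℝ (GroupLieAlgebra 𝓘(ℝ, E) G)) (H : Subgroup G)
    (ι : K →* G) : Submodule ℝ (GroupLieAlgebra 𝓘(ℝ, E) G) :=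
  lieSubgroupAlgebra E' ι ⊓ reductiveComplement b H

/-- `𝔭^⊥`: the orthogonal complement of `𝔭 = 𝔨 ∩ 𝔪` in `𝔪` with respect to the metric `g`. -/
def normalPart {F : Type*} [NormedAddCommGroup F] [NormedSpace ℝ F]
    (b : LinearMap.BilinForm ℝ (GroupLieAlgebra 𝓘(ℝ, E) G)) (H : Subgroup G)
    [ChartedSpace F (G ⧸ H)] [IsManifold 𝓘(ℝ, F) ∞ (G ⧸ H)] (g : SmoothMetric F (G ⧸ H))
    (ι : K →* G) : Submodule ℝ (GroupLieAlgebra 𝓘(ℝ, E) G) where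
  carrier := {Y | Y ∈ reductiveComplement b H ∧
    ∀ X ∈ tangentPart E' b H ι, originForm H g X Y = 0}
  add_mem' hY hZ := ⟨add_mem hY.1 hZ.1, fun X hX => by
    rw [map_add, hY.2 X hX, hZ.2 X hX, add_zero]⟩
  zero_mem' := ⟨zero_mem _, fun X _ => by rw [map_zero]⟩
  smul_mem' c Y hY := ⟨Submodule.smul_mem _ c hY.1, fun X hX => by
    rw [map_smul, hY.2 X hX, smul_zero]⟩

end Algebra

/-- The orbit map `K/(K ∩ H) → G/H`, `k ↦ k o`, of the initial point `o = eH`. -/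
def orbitMap {G K : Type*} [Group G] [Group K] (H : Subgroup G) (ι : K →* G) :
    K ⧸ H.comap ι → G ⧸ H :=
  Quotient.map' ι fun x y h => by
    rw [QuotientGroup.leftRel_apply] at h ⊢
    simpa using h

end

noncomputable section

/-! ### Calculus in normed spaces -/

section Calculus

variable {F : Type*} [NormedAddCommGroup F] [NormedSpace ℝ F]

/-! The proof replaces geodesics by linear algebra in 𝔤. For an invariant metric, Noether's theorem
(`IsInvariantMetric.hasDerivAt_inner_fundVec`) says that the geodesic expression of a curve, paired
with a fundamental vector field, is the derivative of the momentum of the curve along that field. On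
a homogeneous space the fundamental fields span every tangent space, so a smooth curve is a geodesic
if and only if all its momenta are constant. For the orbit of o under exp(tX) this becomes the
condition g_o(X_o, [X,Y]_o) = 0 for all Y in 𝔤, that is, X is a geodesic vector. Local existence and
uniqueness of geodesics then show that an invariant metric is GO exactly when every tangent vector
at o is X_o for some geodesic vector X (`IsGOMetric.exists_isGeodesicVector`,
`isGOMetric_of_isGeodesicVector`).

Orbits. Let Z be in 𝔨 and let V be a geodesic vector of G with V_o = Z_o. Then V - Z lies in 𝔥, and
𝔥 is contained in 𝔨, so V lies in 𝔨. The condition on V for K tests fewer Y than the condition for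
G, so the orbit of V is a geodesic both of P and of M. By uniqueness all geodesics of P arise in
this way, up to translation by K. Hence P is totally geodesic and GO
(`exists_isGeodesicVector_lieHom`, `isTotallyGeodesic_smul_orbitMap`). The inclusion of 𝔥 in 𝔨 needs
an argument, since H lies in K only as a set: one-parameter subgroups of G inside K are lifted to K
by Baire category (`IsLieSubgroup.exists_lift`).

Normal space. A is injective, so A𝔭 ⊆ 𝔭 forces A𝔭 = 𝔭, and 𝔭^⊥ is then the complement of 𝔨 for the
Ad-invariant product (`mem_normalPart_iff`); its invariance under Ad_K and ad 𝔨 follows. For X in 𝔨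
and Y in 𝔭^⊥ a geodesic vector over X + Y has the form V = X + W + Y with W in 𝔥. Testing it against
Y and using [V,Y] = [X + W, Y] ∈ 𝔭^⊥ ⊥ X leaves (Y, [X + W, Y]) = 0; the term with W vanishes
because H acts by isometries. So ad X is skew on 𝔭^⊥ (`modelForm_lieBracketModel_self`), and
connectedness of K integrates this to Ad_K-invariance (`modelForm_adjointMap`).

Base. The invariant product on 𝔭^⊥ = T(G/K) spreads over G/K. For Z in 𝔭^⊥ its pairing with any
element of 𝔤 is the same on G/K and on G/H, so a geodesic vector over Z for G/H is one for G/K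
(`isGOMetric_quotient`). The horizontal space at o is 𝔭^⊥, which gives the Riemannian submersion.
The fibres are translates of P by isometries. -/

instance bilinearNormedAddCommGroup : NormedAddCommGroup (F →L[ℝ] F →L[ℝ] ℝ) :=
  ContinuousLinearMap.toNormedAddCommGroup

instance bilinearAddCommGroup : AddCommGroup (F →L[ℝ] F →L[ℝ] ℝ) :=
  ContinuousLinearMap.addCommGroup

/-- The infinitesimal form of the invariance of a field `B` of bilinear forms under a one-parameter
family `Ψ` of local transformations. -/
theorem killing_of_invariant {B : F → F →L[ℝ] F →L[ℝ] ℝ} {Ψ : ℝ × F → F} {y₀ : F}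
    (hB : DifferentiableAt ℝ B y₀) (hΨ : ContDiffAt ℝ 2 Ψ (0, y₀)) (h0 : Ψ (0, y₀) = y₀)
    (hid : ∀ u, fderiv ℝ Ψ (0, y₀) (0, u) = u)
    (hinv : ∀ u v, ∀ᶠ s in 𝓝 (0 : ℝ),
      B (Ψ (s, y₀)) (fderiv ℝ Ψ (s, y₀) (0, u)) (fderiv ℝ Ψ (s, y₀) (0, v)) = B y₀ u v) (u v : F) :
    fderiv ℝ B y₀ (fderiv ℝ Ψ (0, y₀) (1, 0)) u v
      + B y₀ (fderiv ℝ (fun y => fderiv ℝ Ψ (0, y) (1, 0)) y₀ u) v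
      + B y₀ u (fderiv ℝ (fun y => fderiv ℝ Ψ (0, y) (1, 0)) y₀ v) = 0 := by
  have hD : DifferentiableAt ℝ (fderiv ℝ Ψ) (0, y₀) :=
    (hΨ.fderiv_right (m := 1) (by norm_num)).differentiableAt (by norm_num)
  have hs : HasDerivAt (fun s : ℝ => (s, y₀)) ((1 : ℝ), (0 : F)) 0 :=
    (hasDerivAt_id _).prodMk (hasDerivAt_const _ _)
  have hy : HasFDerivAt (fun y : F => ((0 : ℝ), y)) (ContinuousLinearMap.inr ℝ ℝ F) y₀ :=
    hasFDerivAt_prodMk_right 0 y₀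
  -- Symmetry of the second derivative: the spatial derivative of the generator is the time
  -- derivative of the spatial differential.
  have hsymm : ∀ w, fderiv ℝ (fun y => fderiv ℝ Ψ (0, y) (1, 0)) y₀ w
      = fderiv ℝ (fderiv ℝ Ψ) (0, y₀) (1, 0) (0, w) := by
    intro w
    have h1 : HasFDerivAt (fun y => fderiv ℝ Ψ (0, y))
        ((fderiv ℝ (fderiv ℝ Ψ) (0, y₀)).comp (ContinuousLinearMap.inr ℝ ℝ F)) y₀ :=
      hD.hasFDerivAt.comp y₀ hy
    have h2 := h1.clm_apply (hasFDerivAt_const ((1 : ℝ), (0 : F)) y₀)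
    rw [h2.fderiv]
    have := (hΨ.isSymmSndFDerivAt (by simp)) (1, 0) (0, w)
    simp [this]
  have hu : ∀ w, HasDerivAt (fun s : ℝ => fderiv ℝ Ψ (s, y₀) (0, w))
      (fderiv ℝ (fderiv ℝ Ψ) (0, y₀) (1, 0) (0, w)) 0 := by
    intro w
    have h1 : HasDerivAt (fun s : ℝ => fderiv ℝ Ψ (s, y₀))
        (fderiv ℝ (fderiv ℝ Ψ) (0, y₀) (1, 0)) 0 := hD.hasFDerivAt.comp_hasDerivAt (0 : ℝ) hs
    simpa using h1.clm_apply (hasDerivAt_const (0 : ℝ) ((0 : ℝ), w))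
  have hΨs : HasDerivAt (fun s : ℝ => Ψ (s, y₀)) (fderiv ℝ Ψ (0, y₀) (1, 0)) 0 :=
    (hΨ.differentiableAt (by norm_num)).hasFDerivAt.comp_hasDerivAt (0 : ℝ) hs
  have hB' : HasDerivAt (fun s : ℝ => B (Ψ (s, y₀)))
      (fderiv ℝ B y₀ (fderiv ℝ Ψ (0, y₀) (1, 0))) 0 := by
    have hB2 : HasFDerivAt B (fderiv ℝ B y₀) (Ψ (0, y₀)) := by rw [h0]; exact hB.hasFDerivAt
    exact HasFDerivAt.comp_hasDerivAt (E := F →L[ℝ] F →L[ℝ] ℝ) (0 : ℝ) hB2 hΨs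
  -- The product rule at time 0 is compared with the derivative of a function that is constant near
  -- 0.
  have hall := (hB'.clm_apply (hu u)).clm_apply (hu v)
  have hconst : HasDerivAt (fun s : ℝ =>
      B (Ψ (s, y₀)) (fderiv ℝ Ψ (s, y₀) (0, u)) (fderiv ℝ Ψ (s, y₀) (0, v))) 0 0 :=
    (hasDerivAt_const (0 : ℝ) (B y₀ u v)).congr_of_eventuallyEq (hinv u v)
  have := hall.unique hconst
  simpa [h0, hid, hsymm] using this

/-- Noether's theorem in coordinates. -/
theorem hasDerivAt_momentum {B : F → F →L[ℝ] F →L[ℝ] ℝ} {V : F → F} {c : ℝ → F} {t : ℝ}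
    (hB : DifferentiableAt ℝ B (c t)) (hsymm : ∀ u v, B (c t) u v = B (c t) v u)
    (hV : DifferentiableAt ℝ V (c t)) (hc : ContDiffAt ℝ 2 c t)
    (hK : ∀ u, fderiv ℝ B (c t) (V (c t)) u u + B (c t) (fderiv ℝ V (c t) u) u
      + B (c t) u (fderiv ℝ V (c t) u) = 0) :
    HasDerivAt (fun s => B (c s) (deriv c s) (V (c s)))
      (B (c t) (deriv (deriv c) t) (V (c t)) + (fderiv ℝ B (c t) (deriv c t) (deriv c t) (V (c t))
        - 1 / 2 * fderiv ℝ B (c t) (V (c t)) (deriv c t) (deriv c t))) t := by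
  have hc1 : HasDerivAt c (deriv c t) t := (hc.differentiableAt (by norm_num)).hasDerivAt
  have hc2 : HasDerivAt (deriv c) (deriv (deriv c) t) t :=
    (((hc.fderiv_right (m := 1) (by norm_num)).differentiableAt (by norm_num)).clm_apply
      (differentiableAt_const (1 : ℝ))).hasDerivAt
  have hBc : HasDerivAt (fun s => B (c s)) (fderiv ℝ B (c t) (deriv c t)) t :=
    HasFDerivAt.comp_hasDerivAt (E := F →L[ℝ] F →L[ℝ] ℝ) t hB.hasFDerivAt hc1
  have hVc : HasDerivAt (fun s => V (c s)) (fderiv ℝ V (c t) (deriv c t)) t :=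
    hV.hasFDerivAt.comp_hasDerivAt t hc1
  have h := (hBc.clm_apply hc2).clm_apply hVc
  -- For u = c' the Killing equation reads dB(V)(c',c') + 2B(c', dV c') = 0. This trades the term
  -- containing dV for -1/2 dB(V)(c',c').
  have hk := hK (deriv c t)
  rw [hsymm (fderiv ℝ V (c t) (deriv c t))] at hk
  refine h.congr_deriv ?_
  simp only [add_apply]
  linarith

/-- Bootstrapping: solutions of a smooth autonomous differential equation are smooth. -/
theorem contDiffOn_of_hasDerivAt {f : F → F} {U : Set F} {z : ℝ → F} {J : Set ℝ}
    (hf : ContDiffOn ℝ ∞ f U) (hJ : IsOpen J) (hz : ∀ t ∈ J, HasDerivAt z (f (z t)) t)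
    (hU : ∀ t ∈ J, z t ∈ U) : ContDiffOn ℝ ∞ z J := by
  have : ∀ n : ℕ, ContDiffOn ℝ n z J := by
    intro n
    induction n with
    | zero =>
      exact contDiffOn_zero.2 fun t ht => (hz t ht).continuousAt.continuousWithinAt
    | succ n ih =>
      have := (contDiffOn_succ_iff_deriv_of_isOpen (𝕜 := ℝ) (n := n) (f := z) hJ).2
      refine mod_cast this ⟨fun t ht => (hz t ht).differentiableAt.differentiableWithinAt,
        by simp, ?_⟩
      refine ((hf.of_le (by exact_mod_cast le_top)).comp ih hU).congr fun t ht => (hz t ht).deriv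
  exact contDiffOn_infty.2 this

end Calculus

/-! ### Metrics in charts -/

section ChartMetric

set_option linter.unusedSectionVars false

variable {F : Type*} [NormedAddCommGroup F] [NormedSpace ℝ F]
  {M : Type*} [TopologicalSpace M] [ChartedSpace F M] [IsManifold 𝓘(ℝ, F) ∞ M]

/-- The derivative at `y` of the inverse of the chart at `x₀`. -/
def chartFrame (x₀ : M) (y : F) : F →L[ℝ] F :=
  mfderiv 𝓘(ℝ, F) 𝓘(ℝ, F) (extChartAt 𝓘(ℝ, F) x₀).symm y

/-- The coordinate expression in the chart at `x₀` of a field of bilinear forms. -/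
def chartForm (q : ∀ x : M, TangentSpace 𝓘(ℝ, F) x →L[ℝ] TangentSpace 𝓘(ℝ, F) x →L[ℝ] ℝ)
    (x₀ : M) (y : F) : F →L[ℝ] F →L[ℝ] ℝ :=
  (show F →L[ℝ] F →L[ℝ] ℝ from q ((extChartAt 𝓘(ℝ, F) x₀).symm y)).bilinearComp
    (chartFrame x₀ y) (chartFrame x₀ y)

theorem chartForm_apply (q : ∀ x : M, TangentSpace 𝓘(ℝ, F) x →L[ℝ] TangentSpace 𝓘(ℝ, F) x →L[ℝ] ℝ)
    (x₀ : M) (y v w : F) : chartForm q x₀ y v w =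
      q ((extChartAt 𝓘(ℝ, F) x₀).symm y)
        (mfderiv 𝓘(ℝ, F) 𝓘(ℝ, F) (extChartAt 𝓘(ℝ, F) x₀).symm y v)
        (mfderiv 𝓘(ℝ, F) 𝓘(ℝ, F) (extChartAt 𝓘(ℝ, F) x₀).symm y w) := rfl

theorem chartForm_inner (g : SmoothMetric F M) (x₀ : M) (y v w : F) :
    chartForm g.inner x₀ y v w = metricCoeff g x₀ y v w := rfl

/-- The trivialization of the bundle of forms is conjugation by that of the tangent bundle, whose
inverse is the derivative of the inverse chart. This links the bundle notion of a smooth metric with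
its coefficients in charts. -/
theorem trivializationAt_bilinear_apply
    (q : ∀ x : M, TangentSpace 𝓘(ℝ, F) x →L[ℝ] TangentSpace 𝓘(ℝ, F) x →L[ℝ] ℝ)
    (x₀ x : M) (hx : x ∈ (extChartAt 𝓘(ℝ, F) x₀).source) :
    (trivializationAt (F →L[ℝ] F →L[ℝ] ℝ)
      (fun x : M => TangentSpace 𝓘(ℝ, F) x →L[ℝ] TangentSpace 𝓘(ℝ, F) x →L[ℝ] ℝ) x₀
      ⟨x, q x⟩).2 = chartForm q x₀ (extChartAt 𝓘(ℝ, F) x₀ x) := by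
  have hx' : x ∈ (chartAt F x₀).source := by simpa using hx
  rw [hom_trivializationAt_apply]
  have h1 := TangentBundle.symmL_trivializationAt (I := 𝓘(ℝ, F)) hx'
  have h2 : (extChartAt 𝓘(ℝ, F) x₀).symm (extChartAt 𝓘(ℝ, F) x₀ x) = x :=
    (extChartAt 𝓘(ℝ, F) x₀).left_inv hx
  ext v w
  have h3 : ∀ u : F, (trivializationAt F (TangentSpace 𝓘(ℝ, F)) x₀).symmL ℝ x u
      = mfderiv 𝓘(ℝ, F) 𝓘(ℝ, F) (extChartAt 𝓘(ℝ, F) x₀).symm (extChartAt 𝓘(ℝ, F) x₀ x) u := by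
    intro u
    rw [h1]
    simp only [modelWithCornersSelf_coe, Set.range_id, mfderivWithin_univ]
    rfl
  have hmem : x ∈ (trivializationAt (F →L[ℝ] ℝ)
      (fun x : M => TangentSpace 𝓘(ℝ, F) x →L[ℝ] ℝ) x₀).baseSet := by
    rw [hom_trivializationAt_baseSet]
    exact ⟨hx', trivial⟩
  change Bundle.Trivialization.continuousLinearMapAt ℝ (trivializationAt (F →L[ℝ] ℝ)
    (fun x : M => TangentSpace 𝓘(ℝ, F) x →L[ℝ] ℝ) x₀) x
      (q x ((trivializationAt F (TangentSpace 𝓘(ℝ, F)) x₀).symmL ℝ x v)) w = _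
  rw [Bundle.Trivialization.continuousLinearMapAt_apply_of_mem (R := ℝ) (hb := hmem), hom_trivializationAt_apply]
  change Bundle.Trivialization.continuousLinearMapAt ℝ (trivializationAt ℝ (Bundle.Trivial M ℝ) x₀) x
    (q x ((trivializationAt F (TangentSpace 𝓘(ℝ, F)) x₀).symmL ℝ x v)
    ((trivializationAt F (TangentSpace 𝓘(ℝ, F)) x₀).symmL ℝ x w)) = _
  have hid : Bundle.Trivialization.continuousLinearMapAt ℝ
      (trivializationAt ℝ (Bundle.Trivial M ℝ) x₀) x = ContinuousLinearMap.id ℝ ℝ :=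
    Bundle.Trivial.continuousLinearMapAt_trivialization ℝ M ℝ x
  rw [hid]
  change q x ((trivializationAt F (TangentSpace 𝓘(ℝ, F)) x₀).symmL ℝ x v)
    ((trivializationAt F (TangentSpace 𝓘(ℝ, F)) x₀).symmL ℝ x w) = _
  rw [h3, h3, chartForm_apply, h2]

-- Needed in both directions: to get smooth coefficients from a given metric, and to verify
-- smoothness of the metrics constructed later.
set_option synthInstance.maxHeartbeats 400000 in
theorem contMDiffAt_bilinear_iff
    (q : ∀ x : M, TangentSpace 𝓘(ℝ, F) x →L[ℝ] TangentSpace 𝓘(ℝ, F) x →L[ℝ] ℝ)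
    (x₀ x : M) (hx : x ∈ (extChartAt 𝓘(ℝ, F) x₀).source) :
    ContMDiffAt 𝓘(ℝ, F) (𝓘(ℝ, F).prod 𝓘(ℝ, F →L[ℝ] F →L[ℝ] ℝ)) ∞
      (fun b : M => TotalSpace.mk' (F →L[ℝ] F →L[ℝ] ℝ)
        (E := fun x : M => TangentSpace 𝓘(ℝ, F) x →L[ℝ] TangentSpace 𝓘(ℝ, F) x →L[ℝ] ℝ)
        b (q b)) x ↔
    ContDiffAt ℝ ∞ (chartForm q x₀) (extChartAt 𝓘(ℝ, F) x₀ x) := by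
  have hx' : x ∈ (chartAt F x₀).source := by simpa using hx
  have hmem : TotalSpace.mk' (F →L[ℝ] F →L[ℝ] ℝ)
        (E := fun x : M => TangentSpace 𝓘(ℝ, F) x →L[ℝ] TangentSpace 𝓘(ℝ, F) x →L[ℝ] ℝ)
        x (q x) ∈ (trivializationAt (F →L[ℝ] F →L[ℝ] ℝ)
      (fun x : M => TangentSpace 𝓘(ℝ, F) x →L[ℝ] TangentSpace 𝓘(ℝ, F) x →L[ℝ] ℝ) x₀).source := by
    rw [Bundle.Trivialization.mem_source, hom_trivializationAt_baseSet,
      hom_trivializationAt_baseSet]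
    exact ⟨hx', hx', trivial⟩
  rw [Bundle.Trivialization.contMDiffAt_iff (x₀ := x) (f := fun b : M =>
    TotalSpace.mk' (F →L[ℝ] F →L[ℝ] ℝ) 
      (E := fun x : M => TangentSpace 𝓘(ℝ, F) x →L[ℝ] TangentSpace 𝓘(ℝ, F) x →L[ℝ] ℝ) b (q b))
    (he := hmem)]
  have hev : (fun b : M => (trivializationAt (F →L[ℝ] F →L[ℝ] ℝ)
      (fun x : M => TangentSpace 𝓘(ℝ, F) x →L[ℝ] TangentSpace 𝓘(ℝ, F) x →L[ℝ] ℝ) x₀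
      (TotalSpace.mk' (F →L[ℝ] F →L[ℝ] ℝ) b (q b))).2) =ᶠ[𝓝 x]
      fun b => chartForm q x₀ (extChartAt 𝓘(ℝ, F) x₀ b) := by
    filter_upwards [(isOpen_extChartAt_source (I := 𝓘(ℝ, F)) x₀).mem_nhds hx] with b hb
    exact trivializationAt_bilinear_apply q x₀ b hb
  have ht : extChartAt 𝓘(ℝ, F) x₀ x ∈ (extChartAt 𝓘(ℝ, F) x₀).target :=
    (extChartAt 𝓘(ℝ, F) x₀).map_source hx
  have htn := extChartAt_target_mem_nhds' (I := 𝓘(ℝ, F)) ht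
  constructor
  · rintro ⟨-, h⟩
    have h' := h.congr_of_eventuallyEq hev.symm
    have hs : ContMDiffAt 𝓘(ℝ, F) 𝓘(ℝ, F) ∞ (extChartAt 𝓘(ℝ, F) x₀).symm
        (extChartAt 𝓘(ℝ, F) x₀ x) :=
      (contMDiffOn_extChartAt_symm x₀).contMDiffAt htn
    rw [← contMDiffAt_iff_contDiffAt]
    have h4 := ContMDiffAt.comp_of_eq h' hs ((extChartAt 𝓘(ℝ, F) x₀).left_inv hx)
    refine h4.congr_of_eventuallyEq ?_
    filter_upwards [htn] with y hy
    simp only [Function.comp, (extChartAt 𝓘(ℝ, F) x₀).right_inv hy]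
  · intro h
    refine ⟨contMDiffAt_id, ContMDiffAt.congr_of_eventuallyEq ?_ hev⟩
    exact ContMDiffAt.comp (g := chartForm q x₀) x h.contMDiffAt (contMDiffAt_extChartAt' hx')

theorem SmoothMetric.contDiffOn_chartForm (g : SmoothMetric F M) (x₀ : M) :
    ContDiffOn ℝ ∞ (chartForm g.inner x₀) (extChartAt 𝓘(ℝ, F) x₀).target := by
  intro y hy
  have h := (contMDiffAt_bilinear_iff g.inner x₀ _
    ((extChartAt 𝓘(ℝ, F) x₀).map_target hy)).1 (g.contMDiff _)
  rw [(extChartAt 𝓘(ℝ, F) x₀).right_inv hy] at h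
  exact h.contDiffWithinAt

/-- A linear map on a finite-dimensional space is its tuple of values on a basis, so smoothness may
be tested on vectors. -/
theorem contDiffAt_clm_of_apply {D E G : Type*} [NormedAddCommGroup D] [NormedSpace ℝ D]
    [NormedAddCommGroup E] [NormedSpace ℝ E] [NormedAddCommGroup G] [NormedSpace ℝ G]
    [FiniteDimensional ℝ E] {n : WithTop ℕ∞} {f : D → E →L[ℝ] G} {x : D}
    (h : ∀ v, ContDiffAt ℝ n (fun y => f y v) x) : ContDiffAt ℝ n f x := by
  let d := Module.finrank ℝ E
  have hd : d = Module.finrank ℝ (Fin d → ℝ) := (Module.finrank_fin_fun ℝ).symm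
  let e₁ := ContinuousLinearEquiv.ofFinrankEq hd
  let e₂ := (e₁.arrowCongr (1 : G ≃L[ℝ] G)).trans (ContinuousLinearEquiv.piRing (Fin d))
  rw [← Function.id_comp f, ← e₂.symm_comp_self]
  exact e₂.symm.contDiff.contDiffAt.comp x (contDiffAt_pi.mpr fun i => h _)

/-- On the compact unit sphere the quadratic form has a positive minimum c, so B v v ≥ c‖v‖²
everywhere. -/
theorem isVonNBounded_of_posDef {F : Type*} [NormedAddCommGroup F] [NormedSpace ℝ F]
    [FiniteDimensional ℝ F] (B : F →L[ℝ] F →L[ℝ] ℝ) (pos : ∀ v, v ≠ 0 → 0 < B v v) :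
    Bornology.IsVonNBounded ℝ {v : F | B v v < 1} := by
  rw [NormedSpace.isVonNBounded_iff]
  rcases subsingleton_or_nontrivial F with hF | hF
  · exact (Set.toFinite _).isBounded
  have hne : (Metric.sphere (0 : F) 1).Nonempty := by
    simp [NormedSpace.sphere_nonempty (E := F) (x := 0) (r := 1)]
  obtain ⟨u, hu, hmin⟩ := (isCompact_sphere (0 : F) 1).exists_isMinOn hne
    (f := fun v => B v v) (by fun_prop)
  have hu0 : u ≠ 0 := by
    rintro rfl; simp at hu
  have hc := pos u hu0
  rw [isBounded_iff_forall_norm_le]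
  -- Beyond this radius both ‖v‖ > 1 and c‖v‖ > 1, with c = B u u, so B v v ≥ c‖v‖² > 1.
  refine ⟨1 / B u u + 1, fun v hv => ?_⟩
  by_contra! hlt
  have hv0 : 0 < ‖v‖ := lt_trans (by positivity) hlt
  have h1 : B u u ≤ B (‖v‖⁻¹ • v) (‖v‖⁻¹ • v) := hmin (by
    simp [norm_smul, hv0.ne'])
  simp only [map_smul, smul_apply, smul_eq_mul] at h1
  have h2 : B u u * ‖v‖ ^ 2 ≤ B v v := by
    calc B u u * ‖v‖ ^ 2 ≤ (‖v‖⁻¹ * (‖v‖⁻¹ * B v v)) * ‖v‖ ^ 2 := by gcongr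
      _ = B v v := by field_simp
  have h3 : 1 < B u u * ‖v‖ := by
    have : 1 / B u u < ‖v‖ := by linarith
    rwa [div_lt_iff₀ hc, mul_comm] at this
  have h4 : 1 < ‖v‖ := lt_of_le_of_lt (by have := one_div_pos.2 hc; linarith) hlt
  have hv1 : B v v < 1 := hv
  nlinarith

/-- A field of inner products whose coordinate expressions are smooth is a Riemannian metric. -/
def SmoothMetric.ofChartForm [FiniteDimensional ℝ F]
    (q : ∀ x : M, TangentSpace 𝓘(ℝ, F) x →L[ℝ] TangentSpace 𝓘(ℝ, F) x →L[ℝ] ℝ)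
    (symm : ∀ x v w, q x v w = q x w v) (pos : ∀ x v, v ≠ 0 → 0 < q x v v)
    (smooth : ∀ x₀ : M, ∀ v w : F, ContDiffAt ℝ ∞ (fun y => chartForm q x₀ y v w)
      (extChartAt 𝓘(ℝ, F) x₀ x₀)) : SmoothMetric F M where
  inner := q
  symm := symm
  pos := pos
  isVonNBounded x := isVonNBounded_of_posDef (F := F) (q x) (pos x)
  contMDiff x := by
    refine (contMDiffAt_bilinear_iff q x x (mem_extChartAt_source x)).2 ?_
    exact contDiffAt_clm_of_apply fun v => contDiffAt_clm_of_apply fun w => smooth x v w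

end ChartMetric

/-! ### Noether's theorem for invariant metrics -/

section Charts

set_option linter.unusedSectionVars false

variable {F : Type*} [NormedAddCommGroup F] [NormedSpace ℝ F]
  {M : Type*} [TopologicalSpace M] [ChartedSpace F M] [IsManifold 𝓘(ℝ, F) ∞ M]
  {W : Type*} [NormedAddCommGroup W] [NormedSpace ℝ W]

theorem contMDiffAt_chart {x₀ p : M} (hp : p ∈ (extChartAt 𝓘(ℝ, F) x₀).source) :
    ContMDiffAt 𝓘(ℝ, F) 𝓘(ℝ, F) ∞ (extChartAt 𝓘(ℝ, F) x₀) p :=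
  contMDiffAt_extChartAt' (by simpa using hp)

theorem contMDiffAt_chart_symm {x₀ : M} {y : F} (hy : y ∈ (extChartAt 𝓘(ℝ, F) x₀).target) :
    ContMDiffAt 𝓘(ℝ, F) 𝓘(ℝ, F) ∞ (extChartAt 𝓘(ℝ, F) x₀).symm y :=
  (contMDiffOn_extChartAt_symm x₀).contMDiffAt (extChartAt_target_mem_nhds' hy)

theorem contDiffAt_chart_comp {f : W → M} {z : W} {x₀ : M}
    (hf : ContMDiffAt 𝓘(ℝ, W) 𝓘(ℝ, F) ∞ f z) (hz : f z ∈ (extChartAt 𝓘(ℝ, F) x₀).source) :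
    ContDiffAt ℝ ∞ (fun w => extChartAt 𝓘(ℝ, F) x₀ (f w)) z :=
  contMDiffAt_iff_contDiffAt.1 ((contMDiffAt_chart hz).comp z hf)

/-- The derivative of a map into a manifold, in terms of its coordinate expression. -/
theorem mfderiv_eq_chartFrame {f : W → M} {z : W} {x₀ : M}
    (hf : MDifferentiableAt 𝓘(ℝ, W) 𝓘(ℝ, F) f z) (hz : f z ∈ (extChartAt 𝓘(ℝ, F) x₀).source)
    (u : W) :
    (mfderiv 𝓘(ℝ, W) 𝓘(ℝ, F) f z u : F) = chartFrame x₀ (extChartAt 𝓘(ℝ, F) x₀ (f z))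
      (fderiv ℝ (fun w => extChartAt 𝓘(ℝ, F) x₀ (f w)) z u) := by
  have ht := (extChartAt 𝓘(ℝ, F) x₀).map_source hz
  have h1 : MDifferentiableAt 𝓘(ℝ, W) 𝓘(ℝ, F) (fun w => extChartAt 𝓘(ℝ, F) x₀ (f w)) z :=
    ((contMDiffAt_chart hz).mdifferentiableAt (by simp)).comp z hf
  have h2 : MDifferentiableAt 𝓘(ℝ, F) 𝓘(ℝ, F) (extChartAt 𝓘(ℝ, F) x₀).symm
      (extChartAt 𝓘(ℝ, F) x₀ (f z)) := (contMDiffAt_chart_symm ht).mdifferentiableAt (by simp)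
  have h3 := (h2.hasMFDerivAt.comp z h1.hasMFDerivAt).congr_of_eventuallyEq (f₁ := f) (by
    filter_upwards [hf.continuousAt.preimage_mem_nhds
      ((isOpen_extChartAt_source (I := 𝓘(ℝ, F)) x₀).mem_nhds hz)] with w hw
    exact ((extChartAt 𝓘(ℝ, F) x₀).left_inv hw).symm)
  rw [h3.mfderiv, mfderiv_eq_fderiv]
  rfl

/-- The derivative of the chart is a left inverse. -/
theorem chartFrame_injective {x₀ : M} {y : F} (hy : y ∈ (extChartAt 𝓘(ℝ, F) x₀).target) :
    Function.Injective (chartFrame x₀ y) := by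
  have h1 := (contMDiffAt_chart_symm hy).mdifferentiableAt (by simp)
  have h2 : MDifferentiableAt 𝓘(ℝ, F) 𝓘(ℝ, F) (extChartAt 𝓘(ℝ, F) x₀)
      ((extChartAt 𝓘(ℝ, F) x₀).symm y) :=
    (contMDiffAt_chart ((extChartAt 𝓘(ℝ, F) x₀).map_target hy)).mdifferentiableAt (by simp)
  have h3 := (h2.hasMFDerivAt.comp y h1.hasMFDerivAt).congr_of_eventuallyEq (f₁ := id) (by
    filter_upwards [extChartAt_target_mem_nhds' (I := 𝓘(ℝ, F)) hy] with z hz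
    exact ((extChartAt 𝓘(ℝ, F) x₀).right_inv hz).symm)
  have h4 := h3.mfderiv
  rw [mfderiv_id] at h4
  intro u v huv
  have h5 : ∀ w : F, w = (mfderiv 𝓘(ℝ, F) 𝓘(ℝ, F) (extChartAt 𝓘(ℝ, F) x₀)
      ((extChartAt 𝓘(ℝ, F) x₀).symm y)) (chartFrame x₀ y w) := fun w =>
    DFunLike.congr_fun h4 w
  rw [h5 u, h5 v, huv]

theorem chartForm_chart
    (q : ∀ x : M, TangentSpace 𝓘(ℝ, F) x →L[ℝ] TangentSpace 𝓘(ℝ, F) x →L[ℝ] ℝ)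
    {x₀ p : M} (hp : p ∈ (extChartAt 𝓘(ℝ, F) x₀).source) (a b : F) :
    chartForm q x₀ (extChartAt 𝓘(ℝ, F) x₀ p) a b =
      q p (chartFrame x₀ (extChartAt 𝓘(ℝ, F) x₀ p) a)
        (chartFrame x₀ (extChartAt 𝓘(ℝ, F) x₀ p) b) := by
  -- Tangent spaces at different points are formally different types, so the equality of base points
  -- is eliminated with the vectors kept in the model space. The same device recurs below.
  have key : ∀ p' : M, p' = p → ∀ a b : F, q p' a b = q p a b := by
    rintro _ rfl a b; rfl
  rw [chartForm_apply]
  exact key _ ((extChartAt 𝓘(ℝ, F) x₀).left_inv hp) _ _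

/-- For equal first arguments the two positive terms coincide and absorb the factor 1/2. The right
side is the form in which Noether's theorem produces the geodesic equation. -/
theorem SmoothMetric.christoffelFirst_self (g : SmoothMetric F M) (x₀ : M) {y : F}
    (hy : y ∈ (extChartAt 𝓘(ℝ, F) x₀).target) (u w : F) :
    christoffelFirst g x₀ y u u w = fderiv ℝ (chartForm g.inner x₀) y u u w
      - 1 / 2 * fderiv ℝ (chartForm g.inner x₀) y w u u := by
  have hB : DifferentiableAt ℝ (chartForm g.inner x₀) y :=
    ((g.contDiffOn_chartForm x₀).contDiffAt
      (extChartAt_target_mem_nhds' hy)).differentiableAt (by simp)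
  have hder : ∀ a b d : F, fderiv ℝ (fun z => metricCoeff g x₀ z b d) y a
      = fderiv ℝ (chartForm g.inner x₀) y a b d := by
    intro a b d
    have h7 := (hB.hasFDerivAt.clm_apply (hasFDerivAt_const b y)).clm_apply
      (hasFDerivAt_const d y)
    have h8 : (fun z => metricCoeff g x₀ z b d) = fun z => chartForm g.inner x₀ z b d := rfl
    rw [h8, h7.fderiv]
    simp
  rw [christoffelFirst, hder, hder]
  ring

end Charts

section Noether

set_option linter.unusedSectionVars false

variable {E : Type*} [NormedAddCommGroup E] [NormedSpace ℝ E]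
  {L : Type*} [TopologicalSpace L] [ChartedSpace E L] [Group L]
  {F : Type*} [NormedAddCommGroup F] [NormedSpace ℝ F]
  {M : Type*} [TopologicalSpace M] [ChartedSpace F M] [MulAction L M]

/-- The value at `x` of the fundamental vector field of an element of the Lie algebra. -/
def fundVec (x : M) : GroupLieAlgebra 𝓘(ℝ, E) L →L[ℝ] TangentSpace 𝓘(ℝ, F) x :=
  mfderiv 𝓘(ℝ, E) 𝓘(ℝ, F) (fun a : L => a • x) 1

variable [IsManifold 𝓘(ℝ, F) ∞ M] [ContMDiffSMul 𝓘(ℝ, E) 𝓘(ℝ, F) ∞ L M]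

theorem contMDiff_smul_const (x : M) : ContMDiff 𝓘(ℝ, E) 𝓘(ℝ, F) ∞ (fun a : L => a • x) :=
  contMDiff_id.smul (I := 𝓘(ℝ, E)) contMDiff_const

theorem contMDiff_const_smul' (E : Type*) [NormedAddCommGroup E] [NormedSpace ℝ E]
    {L : Type*} [TopologicalSpace L] [ChartedSpace E L] [Group L] {F : Type*}
    [NormedAddCommGroup F] [NormedSpace ℝ F] {M : Type*} [TopologicalSpace M] [ChartedSpace F M]
    [MulAction L M] [ContMDiffSMul 𝓘(ℝ, E) 𝓘(ℝ, F) ∞ L M] (a : L) : ContMDiff 𝓘(ℝ, F) 𝓘(ℝ, F) ∞ (fun x : M => a • x) :=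
  ContMDiffSMul.contMDiff_const_smul (I := 𝓘(ℝ, E)) a

theorem mfderiv_smul_curve {α : ℝ → L} (hα : MDifferentiableAt 𝓘(ℝ, ℝ) 𝓘(ℝ, E) α 0)
    (h1 : α 0 = 1) {X : GroupLieAlgebra 𝓘(ℝ, E) L}
    (hX : X = mfderiv 𝓘(ℝ, ℝ) 𝓘(ℝ, E) α 0 (1 : ℝ)) (x : M) :
    (fundVec x X : F) = mfderiv 𝓘(ℝ, ℝ) 𝓘(ℝ, F) (fun s => α s • x) 0 (1 : ℝ) := by
  have h2 : MDifferentiableAt 𝓘(ℝ, E) 𝓘(ℝ, F) (fun a : L => a • x) (α 0) :=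
    (contMDiff_smul_const x).mdifferentiableAt (by simp)
  have h3 := h2.hasMFDerivAt.comp (0 : ℝ) hα.hasMFDerivAt
  have h4 : mfderiv 𝓘(ℝ, ℝ) 𝓘(ℝ, F) (fun s => α s • x) 0 = _ := h3.mfderiv
  rw [h4, hX, fundVec]
  have key : ∀ a : L, a = 1 → ∀ v : E, (mfderiv 𝓘(ℝ, E) 𝓘(ℝ, F) (fun a : L => a • x) 1 v : F)
      = mfderiv 𝓘(ℝ, E) 𝓘(ℝ, F) (fun a : L => a • x) a v := by
    rintro _ rfl v; rfl
  exact key _ h1 _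

/-- The action of a curve in the group, in the chart at `x₀`. -/
def chartFlow (α : ℝ → L) (x₀ : M) (z : ℝ × F) : F :=
  extChartAt 𝓘(ℝ, F) x₀ (α z.1 • (extChartAt 𝓘(ℝ, F) x₀).symm z.2)

theorem contDiffAt_chartFlow {α : ℝ → L} {s : ℝ} (hα : ContMDiffAt 𝓘(ℝ, ℝ) 𝓘(ℝ, E) ∞ α s)
    {x₀ : M} {y : F} (hy : y ∈ (extChartAt 𝓘(ℝ, F) x₀).target)
    (hs : α s • (extChartAt 𝓘(ℝ, F) x₀).symm y ∈ (extChartAt 𝓘(ℝ, F) x₀).source) :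
    ContDiffAt ℝ ∞ (chartFlow α x₀) (s, y) := by
  have h1 : ContMDiffAt 𝓘(ℝ, ℝ × F) 𝓘(ℝ, E) ∞ (fun z : ℝ × F => α z.1) (s, y) :=
    ContMDiffAt.comp (g := α) (s, y) hα contDiff_fst.contMDiff.contMDiffAt
  have h2 : ContMDiffAt 𝓘(ℝ, ℝ × F) 𝓘(ℝ, F) ∞
      (fun z : ℝ × F => (extChartAt 𝓘(ℝ, F) x₀).symm z.2) (s, y) :=
    ContMDiffAt.comp (g := (extChartAt 𝓘(ℝ, F) x₀).symm) (s, y)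
      (contMDiffAt_chart_symm hy) contDiff_snd.contMDiff.contMDiffAt
  exact contDiffAt_chart_comp (h1.smul (I := 𝓘(ℝ, E)) h2) hs

theorem chartFlow_zero {α : ℝ → L} (h1 : α 0 = 1) {x₀ : M} {y : F}
    (hy : y ∈ (extChartAt 𝓘(ℝ, F) x₀).target) : chartFlow α x₀ (0, y) = y := by
  rw [chartFlow, h1, one_smul, (extChartAt 𝓘(ℝ, F) x₀).right_inv hy]

/-- Identifies the generator of the coordinate flow, which enters `killing_of_invariant`, with the
fundamental vector field. -/
theorem chartFrame_fderiv_chartFlow {α : ℝ → L} (hα : ContMDiffAt 𝓘(ℝ, ℝ) 𝓘(ℝ, E) ∞ α 0)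
    (h1 : α 0 = 1) {X : GroupLieAlgebra 𝓘(ℝ, E) L}
    (hX : X = mfderiv 𝓘(ℝ, ℝ) 𝓘(ℝ, E) α 0 (1 : ℝ)) {x₀ p : M}
    (hp : p ∈ (extChartAt 𝓘(ℝ, F) x₀).source) :
    (fundVec p X : F) = chartFrame x₀ (extChartAt 𝓘(ℝ, F) x₀ p)
      (fderiv ℝ (chartFlow α x₀) (0, extChartAt 𝓘(ℝ, F) x₀ p) (1, 0)) := by
  have ht := (extChartAt 𝓘(ℝ, F) x₀).map_source hp
  have hl := (extChartAt 𝓘(ℝ, F) x₀).left_inv hp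
  have hm : ContMDiffAt 𝓘(ℝ, ℝ) 𝓘(ℝ, F) ∞ (fun s => α s • p) 0 :=
    (contMDiff_smul_const p).contMDiffAt.comp (0 : ℝ) hα
  rw [mfderiv_smul_curve (hα.mdifferentiableAt (by simp)) h1 hX p,
    mfderiv_eq_chartFrame (x₀ := x₀) (hm.mdifferentiableAt (by simp)) (by simpa [h1] using hp)]
  have hΨ : ContDiffAt ℝ ∞ (chartFlow α x₀) (0, extChartAt 𝓘(ℝ, F) x₀ p) :=
    contDiffAt_chartFlow hα ht (by rw [hl, h1, one_smul]; exact hp)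
  have hs : HasFDerivAt (fun s : ℝ => (s, extChartAt 𝓘(ℝ, F) x₀ p))
      (ContinuousLinearMap.inl ℝ ℝ F) 0 := hasFDerivAt_prodMk_left _ _
  have h2 := (hΨ.differentiableAt (by simp)).hasFDerivAt.comp (0 : ℝ) hs
  have h3 : (chartFlow α x₀) ∘ (fun s : ℝ => (s, extChartAt 𝓘(ℝ, F) x₀ p))
      = fun s => extChartAt 𝓘(ℝ, F) x₀ (α s • p) := by
    funext s; rw [Function.comp_apply, chartFlow, hl]
  rw [h3] at h2
  rw [h2.fderiv, h1, one_smul]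
  rfl

variable {g : SmoothMetric F M}

/-- The invariance hypothesis of `killing_of_invariant`, obtained by the chain rule from the
invariance of the metric on the manifold. -/
theorem IsInvariantMetric.chartForm_chartFlow (hg : IsInvariantMetric L g)
    {α : ℝ → L} {s : ℝ} (hα : ContMDiffAt 𝓘(ℝ, ℝ) 𝓘(ℝ, E) ∞ α s)
    {x₀ : M} {y : F} (hy : y ∈ (extChartAt 𝓘(ℝ, F) x₀).target)
    (hs : α s • (extChartAt 𝓘(ℝ, F) x₀).symm y ∈ (extChartAt 𝓘(ℝ, F) x₀).source) (u v : F) :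
    chartForm g.inner x₀ (chartFlow α x₀ (s, y)) (fderiv ℝ (chartFlow α x₀) (s, y) (0, u))
      (fderiv ℝ (chartFlow α x₀) (s, y) (0, v)) = chartForm g.inner x₀ y u v := by
  have hΨ := contDiffAt_chartFlow hα hy hs
  have hsy : HasFDerivAt (fun y : F => (s, y)) (ContinuousLinearMap.inr ℝ ℝ F) y :=
    hasFDerivAt_prodMk_right _ _
  have h2 := ((hΨ.differentiableAt (by simp)).hasFDerivAt.comp y hsy).fderiv
  have h3 : ∀ u, fderiv ℝ (chartFlow α x₀) (s, y) (0, u) = fderiv ℝ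
      (fun y => extChartAt 𝓘(ℝ, F) x₀ (α s • (extChartAt 𝓘(ℝ, F) x₀).symm y)) y u := by
    intro u
    have := DFunLike.congr_fun h2 u
    simpa [Function.comp_def, chartFlow] using this.symm
  have hd := (contMDiffAt_chart_symm hy).mdifferentiableAt (by simp)
  have hd' : MDifferentiableAt 𝓘(ℝ, F) 𝓘(ℝ, F) (fun x : M => α s • x)
      ((extChartAt 𝓘(ℝ, F) x₀).symm y) :=
    (contMDiff_const_smul' E (α s)).mdifferentiableAt (by simp)
  have hcomp := hd'.hasMFDerivAt.comp y hd.hasMFDerivAt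
  have h4 : ∀ u : F, chartFrame x₀ (extChartAt 𝓘(ℝ, F) x₀ (α s • (extChartAt 𝓘(ℝ, F) x₀).symm y))
      (fderiv ℝ (fun y => extChartAt 𝓘(ℝ, F) x₀ (α s • (extChartAt 𝓘(ℝ, F) x₀).symm y)) y u)
      = mfderiv 𝓘(ℝ, F) 𝓘(ℝ, F) (fun x : M => α s • x) ((extChartAt 𝓘(ℝ, F) x₀).symm y)
        (mfderiv 𝓘(ℝ, F) 𝓘(ℝ, F) (extChartAt 𝓘(ℝ, F) x₀).symm y u) := by
    intro u
    have h5 := mfderiv_eq_chartFrame (f := fun y => α s • (extChartAt 𝓘(ℝ, F) x₀).symm y)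
      hcomp.mdifferentiableAt hs u
    rw [← h5]
    exact DFunLike.congr_fun hcomp.mfderiv u
  rw [h3, h3, chartFlow, chartForm_chart _ hs, h4, h4, chartForm_apply]
  exact hg (α s) _ _ _

set_option maxHeartbeats 1000000 in
/-- Noether's theorem: the derivative of the momentum of a curve along a fundamental vector field is
the geodesic expression of the curve, paired with the vector field. -/
theorem IsInvariantMetric.hasDerivAt_inner_fundVec (hg : IsInvariantMetric L g)
    {γ : ℝ → M} {t : ℝ} (hγ : ∀ᶠ s in 𝓝 t, ContMDiffAt 𝓘(ℝ, ℝ) 𝓘(ℝ, F) ∞ γ s)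
    {x₀ : M} (hx : γ t ∈ (extChartAt 𝓘(ℝ, F) x₀).source)
    {α : ℝ → L} (hα : ContMDiff 𝓘(ℝ, ℝ) 𝓘(ℝ, E) ∞ α) (h1 : α 0 = 1)
    {X : GroupLieAlgebra 𝓘(ℝ, E) L} (hX : X = mfderiv 𝓘(ℝ, ℝ) 𝓘(ℝ, E) α 0 (1 : ℝ)) {w : F}
    (hw : chartFrame x₀ (extChartAt 𝓘(ℝ, F) x₀ (γ t)) w = (fundVec (γ t) X : F)) :
    HasDerivAt (fun s => g.inner (γ s) (mfderiv 𝓘(ℝ, ℝ) 𝓘(ℝ, F) γ s (1 : ℝ)) (fundVec (γ s) X))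
      (metricCoeff g x₀ (extChartAt 𝓘(ℝ, F) x₀ (γ t))
            (deriv (deriv fun s => extChartAt 𝓘(ℝ, F) x₀ (γ s)) t) w
          + christoffelFirst g x₀ (extChartAt 𝓘(ℝ, F) x₀ (γ t))
            (deriv (fun s => extChartAt 𝓘(ℝ, F) x₀ (γ s)) t)
            (deriv (fun s => extChartAt 𝓘(ℝ, F) x₀ (γ s)) t) w) t := by
  set c : ℝ → F := fun s => extChartAt 𝓘(ℝ, F) x₀ (γ s) with hc
  set V : F → F := fun y => fderiv ℝ (chartFlow α x₀) (0, y) (1, 0) with hVdef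
  set B := chartForm g.inner x₀ with hBdef
  have ht : c t ∈ (extChartAt 𝓘(ℝ, F) x₀).target := (extChartAt 𝓘(ℝ, F) x₀).map_source hx
  have hl : (extChartAt 𝓘(ℝ, F) x₀).symm (c t) = γ t := (extChartAt 𝓘(ℝ, F) x₀).left_inv hx
  have hγt := hγ.self_of_nhds
  have hcd : ContDiffAt ℝ ∞ c t := contDiffAt_chart_comp hγt hx
  have htn := extChartAt_target_mem_nhds' (I := 𝓘(ℝ, F)) ht
  have hB : DifferentiableAt ℝ B (c t) :=
    ((g.contDiffOn_chartForm x₀).contDiffAt htn).differentiableAt (by simp)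
  have hs0 : α 0 • (extChartAt 𝓘(ℝ, F) x₀).symm (c t) ∈ (extChartAt 𝓘(ℝ, F) x₀).source := by
    rw [h1, one_smul, hl]; exact hx
  have hΨ : ContDiffAt ℝ ∞ (chartFlow α x₀) (0, c t) := contDiffAt_chartFlow hα.contMDiffAt ht hs0
  have hΨ2 : ContDiffAt ℝ 2 (chartFlow α x₀) (0, c t) := hΨ.of_le ENat.LEInfty.out
  -- The prescribed w is the coordinate vector of the fundamental field at this point, by
  -- injectivity of the frame.
  have hw' : w = V (c t) := chartFrame_injective ht
    (hw.trans (chartFrame_fderiv_chartFlow hα.contMDiffAt h1 hX hx))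
  have hV : DifferentiableAt ℝ V (c t) := by
    have h2 : DifferentiableAt ℝ (fderiv ℝ (chartFlow α x₀)) (0, c t) :=
      (hΨ2.fderiv_right (m := 1) (by norm_num)).differentiableAt (by norm_num)
    have h3 : HasFDerivAt (fun y : F => ((0 : ℝ), y)) (ContinuousLinearMap.inr ℝ ℝ F) (c t) :=
      hasFDerivAt_prodMk_right _ _
    exact (h2.hasFDerivAt.comp (c t) h3).differentiableAt.clm_apply (differentiableAt_const _)
  -- At time 0 the flow is the identity on a neighbourhood, so its spatial differential is too.
  have hid : ∀ u, fderiv ℝ (chartFlow α x₀) (0, c t) (0, u) = u := by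
    intro u
    have h3 : HasFDerivAt (fun y : F => ((0 : ℝ), y)) (ContinuousLinearMap.inr ℝ ℝ F) (c t) :=
      hasFDerivAt_prodMk_right _ _
    have h4 := ((hΨ.differentiableAt (by simp)).hasFDerivAt.comp (c t) h3).congr_of_eventuallyEq
      (f₁ := id) (by
        filter_upwards [htn] with y hy
        exact (chartFlow_zero h1 hy).symm)
    have := DFunLike.congr_fun (h4.unique (hasFDerivAt_id _)) u
    simpa using this
  have hinv : ∀ u v, ∀ᶠ s in 𝓝 (0 : ℝ), B (chartFlow α x₀ (s, c t))
      (fderiv ℝ (chartFlow α x₀) (s, c t) (0, u)) (fderiv ℝ (chartFlow α x₀) (s, c t) (0, v))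
      = B (c t) u v := by
    intro u v
    have hcont : ContinuousAt (fun s => α s • (extChartAt 𝓘(ℝ, F) x₀).symm (c t)) 0 :=
      ((contMDiff_smul_const (F := F) ((extChartAt 𝓘(ℝ, F) x₀).symm (c t))).contMDiffAt.comp (0 : ℝ) hα.contMDiffAt).continuousAt
    filter_upwards [hcont.preimage_mem_nhds
      ((isOpen_extChartAt_source (I := 𝓘(ℝ, F)) x₀).mem_nhds hs0)] with s hs'
    exact hg.chartForm_chartFlow hα.contMDiffAt ht hs' u v
  have hK := killing_of_invariant hB hΨ2
    (chartFlow_zero h1 ht) hid hinv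
  have hN := hasDerivAt_momentum (V := V) hB (fun u v => g.symm _ _ _) hV
    (hcd.of_le ENat.LEInfty.out) (fun u => hK u u)
  have hev : (fun s => g.inner (γ s) (mfderiv 𝓘(ℝ, ℝ) 𝓘(ℝ, F) γ s (1 : ℝ)) (fundVec (γ s) X))
      =ᶠ[𝓝 t] fun s => B (c s) (deriv c s) (V (c s)) := by
    filter_upwards [hγ, hγt.continuousAt.preimage_mem_nhds
      ((isOpen_extChartAt_source (I := 𝓘(ℝ, F)) x₀).mem_nhds hx)] with s hs hs'
    rw [hBdef, chartForm_chart _ hs']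
    have h5 := mfderiv_eq_chartFrame (hs.mdifferentiableAt (by simp)) hs' (1 : ℝ)
    have h6 := chartFrame_fderiv_chartFlow hα.contMDiffAt h1 hX hs'
    have key : ∀ a b a' b' : F, a = a' → b = b' → g.inner (γ s) a b = g.inner (γ s) a' b' := by
      rintro a b _ _ rfl rfl; rfl
    exact key _ _ _ _ h5 h6
  refine (hN.congr_of_eventuallyEq hev).congr_deriv ?_
  rw [hw', g.christoffelFirst_self x₀ ht]
  exact rfl

end Noether

/-! ### One-parameter subgroups -/

section OneParameter

set_option linter.unusedSectionVars false

variable {E : Type*} [NormedAddCommGroup E] [NormedSpace ℝ E]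
  {L : Type*} [TopologicalSpace L] [ChartedSpace E L] [Group L] [LieGroup 𝓘(ℝ, E) ∞ L]

instance lieGroup_minSmoothness : LieGroup 𝓘(ℝ, E) (minSmoothness ℝ 3) L :=
  LieGroup.of_le (n := ∞) (by
    rw [minSmoothness_of_isRCLikeNormedField]; exact ENat.LEInfty.out)

theorem map_zero_of_add {φ : ℝ → L} (h : ∀ s t, φ (s + t) = φ s * φ t) : φ 0 = 1 := by
  have := h 0 0
  rw [add_zero] at this
  exact left_eq_mul.1 this

theorem map_neg_of_add {φ : ℝ → L} (h : ∀ s t, φ (s + t) = φ s * φ t) (t : ℝ) :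
    φ (-t) = (φ t)⁻¹ := by
  rw [eq_inv_iff_mul_eq_one, ← h, neg_add_cancel, map_zero_of_add h]

/-- Multiplication read in the chart at `1`. -/
def chartMul (z : E × E) : E :=
  extChartAt 𝓘(ℝ, E) (1 : L)
    ((extChartAt 𝓘(ℝ, E) (1 : L)).symm z.1 * (extChartAt 𝓘(ℝ, E) (1 : L)).symm z.2)

theorem contDiffAt_chartMul {y z : E} (hy : y ∈ (extChartAt 𝓘(ℝ, E) (1 : L)).target)
    (hz : z ∈ (extChartAt 𝓘(ℝ, E) (1 : L)).target)
    (hyz : (extChartAt 𝓘(ℝ, E) (1 : L)).symm y * (extChartAt 𝓘(ℝ, E) (1 : L)).symm z ∈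
      (extChartAt 𝓘(ℝ, E) (1 : L)).source) :
    ContDiffAt ℝ ∞ (chartMul (L := L)) (y, z) := by
  have h1 : ContMDiffAt 𝓘(ℝ, E × E) 𝓘(ℝ, E) ∞
      (fun z : E × E => (extChartAt 𝓘(ℝ, E) (1 : L)).symm z.1) (y, z) :=
    ContMDiffAt.comp (g := (extChartAt 𝓘(ℝ, E) (1 : L)).symm) (y, z)
      (contMDiffAt_chart_symm hy) contDiff_fst.contMDiff.contMDiffAt
  have h2 : ContMDiffAt 𝓘(ℝ, E × E) 𝓘(ℝ, E) ∞
      (fun z : E × E => (extChartAt 𝓘(ℝ, E) (1 : L)).symm z.2) (y, z) :=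
    ContMDiffAt.comp (g := (extChartAt 𝓘(ℝ, E) (1 : L)).symm) (y, z)
      (contMDiffAt_chart_symm hz) contDiff_snd.contMDiff.contMDiffAt
  exact contDiffAt_chart_comp (h1.mul h2) hyz

/-- A homomorphism `ℝ → L` which is differentiable at `0` is a one-parameter subgroup. -/
theorem isOneParameterSubgroup_of_mdifferentiableAt {φ : ℝ → L}
    (h : ∀ s t, φ (s + t) = φ s * φ t) (hd : MDifferentiableAt 𝓘(ℝ, ℝ) 𝓘(ℝ, E) φ 0) :
    IsOneParameterSubgroup E φ := by
  refine ⟨?_, h⟩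
  have h0 := map_zero_of_add h
  set e := extChartAt 𝓘(ℝ, E) (1 : L) with he
  set c : ℝ → E := fun s => e (φ s) with hc
  have hs0 : φ 0 ∈ e.source := by rw [h0]; exact mem_extChartAt_source _
  have hy0 : c 0 ∈ e.target := e.map_source hs0
  have hl0 : e.symm (c 0) = 1 := by rw [hc]; simp only; rw [e.left_inv hs0, h0]
  have hcd : DifferentiableAt ℝ c 0 := by
    rw [← mdifferentiableAt_iff_differentiableAt]
    exact ((contMDiffAt_chart hs0).mdifferentiableAt (by simp)).comp (0 : ℝ) hd
  obtain ⟨J, hJn, hJo, hJ0⟩ := mem_nhds_iff.1 (hd.continuousAt.preimage_mem_nhds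
    ((isOpen_extChartAt_source (I := 𝓘(ℝ, E)) (1 : L)).mem_nhds hs0))
  -- Differentiating c(t + s) = m(c(t), c(s)) at s = 0, where m is the multiplication in the chart,
  -- gives the autonomous equation c' = f(c) with smooth f, to which bootstrapping applies.
  let f : E → E := fun y => fderiv ℝ (chartMul (L := L)) (y, c 0) (0, deriv c 0)
  have hm : ∀ y ∈ e.target, ContDiffAt ℝ ∞ (chartMul (L := L)) (y, c 0) := fun y hy =>
    contDiffAt_chartMul hy hy0 (by rw [hl0, mul_one]; exact e.map_target hy)
  have hf : ContDiffOn ℝ ∞ f e.target := by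
    intro y hy
    have h1 : ContDiffAt ℝ ∞ (fderiv ℝ (chartMul (L := L))) (y, c 0) :=
      (hm y hy).fderiv_right (by simp)
    have h2 : ContDiffAt ℝ ∞ (fun y : E => (y, c 0)) y := contDiffAt_id.prodMk contDiffAt_const
    exact ((h1.comp y h2).clm_apply contDiffAt_const).contDiffWithinAt
  have hder : ∀ t ∈ J, HasDerivAt c (f (c t)) t := by
    intro t ht
    have hts : φ t ∈ e.source := hJn ht
    have h1 : HasDerivAt (fun s => (c t, c s)) ((0 : E), deriv c 0) 0 :=
      (hasDerivAt_const _ _).prodMk hcd.hasDerivAt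
    have h2 : HasDerivAt (fun s => chartMul (L := L) (c t, c s)) (f (c t)) 0 :=
      HasFDerivAt.comp_hasDerivAt_of_eq (0 : ℝ)
        ((hm _ (e.map_source hts)).differentiableAt (by simp)).hasFDerivAt h1 rfl
    have h3 : HasDerivAt (fun s => c (t + s)) (f (c t)) 0 := by
      refine h2.congr_of_eventuallyEq ?_
      filter_upwards [hJo.mem_nhds hJ0] with s hs
      have : chartMul (L := L) (c t, c s) = e (e.symm (e (φ t)) * e.symm (e (φ s))) := rfl
      rw [this, e.left_inv hts, e.left_inv (hJn hs), ← h]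
    have h4 := HasDerivAt.comp_sub_const (f := fun s => c (t + s)) t t (by simpa using h3)
    simpa using h4
  have hsm : ContDiffOn ℝ ∞ c J :=
    contDiffOn_of_hasDerivAt hf hJo hder fun t ht => e.map_source (hJn ht)
  have h0s : ContMDiffAt 𝓘(ℝ, ℝ) 𝓘(ℝ, E) ∞ φ 0 := by
    have h1 : ContMDiffAt 𝓘(ℝ, ℝ) 𝓘(ℝ, E) ∞ (fun t => e.symm (c t)) 0 :=
      ContMDiffAt.comp (g := e.symm) (0 : ℝ) (contMDiffAt_chart_symm hy0)
        (hsm.contDiffAt (hJo.mem_nhds hJ0)).contMDiffAt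
    refine h1.congr_of_eventuallyEq ?_
    filter_upwards [hJo.mem_nhds hJ0] with s hs
    exact (e.left_inv (hJn hs)).symm
  intro t
  -- Left translation carries smoothness at 0 to any time t.
  have h1 : φ = fun s => φ t * φ (s - t) := by
    funext s; rw [← h]; congr 1; ring
  rw [h1]
  have h2 : ContMDiffAt 𝓘(ℝ, ℝ) 𝓘(ℝ, ℝ) ∞ (fun s : ℝ => s - t) t :=
    (contDiff_id.sub contDiff_const).contMDiff.contMDiffAt
  exact contMDiffAt_const.mul (h0s.comp_of_eq h2 (by simp))

theorem mulInvariantVectorField_one (X : GroupLieAlgebra 𝓘(ℝ, E) L) :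
    mulInvariantVectorField X (1 : L) = X := by
  have h1 : (fun x : L => (1 : L) * x) = id := by funext x; simp
  rw [mulInvariantVectorField, h1, mfderiv_id]
  rfl

theorem mfderiv_mul_left_mulInvariantVectorField (X : GroupLieAlgebra 𝓘(ℝ, E) L) (a b : L) :
    (mfderiv 𝓘(ℝ, E) 𝓘(ℝ, E) (fun x => a * x) b (mulInvariantVectorField X b) : E)
      = mulInvariantVectorField X (a * b) := by
  have hab : ∀ a b : L, MDifferentiableAt 𝓘(ℝ, E) 𝓘(ℝ, E) (fun x : L => a * x) b := fun a b =>
    (contMDiff_mul_left (I := 𝓘(ℝ, E)) (n := ∞)).mdifferentiableAt (by simp)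
  have h0 : MDifferentiableAt 𝓘(ℝ, E) 𝓘(ℝ, E) (fun x : L => a * x) (b * 1) := hab _ _
  have h1 := (h0.hasMFDerivAt.comp (1 : L) (hab b 1).hasMFDerivAt).mfderiv
  have h2 : (fun x : L => a * x) ∘ (fun x => b * x) = fun x => a * b * x := by
    funext x; simp [mul_assoc]
  rw [h2] at h1
  have h3 : (mulInvariantVectorField X (a * b) : E) = _ := DFunLike.congr_fun h1 X
  rw [h3]
  have key : ∀ b' : L, b' = b → ∀ v : E, (mfderiv 𝓘(ℝ, E) 𝓘(ℝ, E) (fun x => a * x) b v : E)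
    = mfderiv 𝓘(ℝ, E) 𝓘(ℝ, E) (fun x => a * x) b' v := by rintro _ rfl v; rfl
  exact key _ (mul_one b) _

/-- Left translations preserve left-invariant fields. This makes the local existence time
independent of the starting point. -/
theorem IsMIntegralCurveOn.mul_left {X : GroupLieAlgebra 𝓘(ℝ, E) L} {γ : ℝ → L} {s : Set ℝ}
    (h : IsMIntegralCurveOn (I := 𝓘(ℝ, E)) γ (mulInvariantVectorField X) s) (a : L) :
    IsMIntegralCurveOn (I := 𝓘(ℝ, E)) (fun t => a * γ t) (mulInvariantVectorField X) s := by
  intro t ht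
  have h1 : MDifferentiableAt 𝓘(ℝ, E) 𝓘(ℝ, E) (fun x : L => a * x) (γ t) :=
    (contMDiff_mul_left (I := 𝓘(ℝ, E)) (n := ∞)).mdifferentiableAt (by simp)
  have h2 := h1.hasMFDerivAt.comp_hasMFDerivWithinAt t (h t ht)
  refine h2.congr_mfderiv ?_
  refine ContinuousLinearMap.ext_ring ?_
  change mfderiv 𝓘(ℝ, E) 𝓘(ℝ, E) (fun x : L => a * x) (γ t)
    ((1 : ℝ) • mulInvariantVectorField X (γ t) : E)
    = ((1 : ℝ) • (mulInvariantVectorField X (a * γ t)) : E)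
  rw [one_smul, one_smul]
  exact mfderiv_mul_left_mulInvariantVectorField X a (γ t)

/-- Existence of one-parameter subgroups with given initial velocity. -/
theorem exists_isOneParameterSubgroup [CompleteSpace E] [T2Space L]
    (X : GroupLieAlgebra 𝓘(ℝ, E) L) :
    ∃ φ : ℝ → L, IsOneParameterSubgroup E φ ∧ X = mfderiv 𝓘(ℝ, ℝ) 𝓘(ℝ, E) φ 0 (1 : ℝ) := by
  have hV : ContMDiff 𝓘(ℝ, E) 𝓘(ℝ, E).tangent 1
      (fun a : L => (⟨a, mulInvariantVectorField X a⟩ : TangentBundle 𝓘(ℝ, E) L)) :=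
    (contMDiff_mulInvariantVectorField X).of_le (by
      rw [minSmoothness_of_isRCLikeNormedField]; exact one_le_two)
  obtain ⟨γ₀, hγ₀, hloc⟩ := exists_isMIntegralCurveAt_of_contMDiffAt_boundaryless (t₀ := 0)
    (hV.contMDiffAt (x := (1 : L)))
  obtain ⟨ε, hε, hloc⟩ := isMIntegralCurveAt_iff'.1 hloc
  rw [Real.ball_eq_Ioo, zero_sub, zero_add] at hloc
  -- Translating a single local integral curve gives the same ε at every point, so the invariant
  -- field is complete.
  obtain ⟨φ, hφ0, hφ⟩ := exists_isMIntegralCurve_of_isMIntegralCurveOn hV hε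
    (fun a => ⟨fun t => a * γ₀ t, by simp [hγ₀], hloc.mul_left a⟩) (1 : L)
  -- Both sides, as functions of t, are integral curves of the invariant field with the same value
  -- at t = 0.
  have hadd : ∀ s t, φ (s + t) = φ s * φ t := by
    intro s t
    have h1 := hφ.comp_add s
    have h2 : IsMIntegralCurve (I := 𝓘(ℝ, E)) (fun t => φ s * φ t) (mulInvariantVectorField X) :=
      isMIntegralCurve_iff_isMIntegralCurveOn.2 ((hφ.isMIntegralCurveOn _).mul_left (φ s))
    have h3 := isMIntegralCurve_Ioo_eq_of_contMDiff_boundaryless (t₀ := 0) hV h1 h2 (by simp [hφ0])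
    have h4 := congrFun h3 t
    simpa [add_comm] using h4
  refine ⟨φ, isOneParameterSubgroup_of_mdifferentiableAt hadd (hφ 0).mdifferentiableAt, ?_⟩
  rw [(hφ 0).mfderiv]
  change X = (1 : ℝ) • (mulInvariantVectorField X (φ 0) : E)
  rw [one_smul, hφ0]
  exact (mulInvariantVectorField_one X).symm

end OneParameter

/-! ### The geodesic equation as a differential equation -/

section GeodesicEquation

set_option linter.unusedSectionVars false

variable {F : Type*} [NormedAddCommGroup F] [NormedSpace ℝ F] [FiniteDimensional ℝ F]
  {M : Type*} [TopologicalSpace M] [ChartedSpace F M] [IsManifold 𝓘(ℝ, F) ∞ M]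

theorem contDiffAt_fderiv_fst {F D : Type*} [NormedAddCommGroup F] [NormedSpace ℝ F]
    [NormedAddCommGroup D] [NormedSpace ℝ D] {B : F → D} {u : F × F → F} {z : F × F}
    (hB : ContDiffAt ℝ ∞ B z.1) (hu : ContDiffAt ℝ ∞ u z) :
    ContDiffAt ℝ ∞ (fun z => fderiv ℝ B z.1 (u z)) z :=
  ((hB.fderiv_right (m := ∞) (by simp)).comp z contDiffAt_fst).clm_apply hu

theorem chartFrame_surjective {x₀ : M} {y : F} (hy : y ∈ (extChartAt 𝓘(ℝ, F) x₀).target) :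
    Function.Surjective (chartFrame x₀ y) :=
  (LinearMap.injective_iff_surjective (f := (chartFrame x₀ y).toLinearMap)).1
    (chartFrame_injective hy)

/-- The linear form `w ↦ Γ(u, u; w)` in the chart at `x₀`. -/
def christoffelForm (g : SmoothMetric F M) (x₀ : M) (z : F × F) : F →L[ℝ] ℝ :=
  fderiv ℝ (chartForm g.inner x₀) z.1 z.2 z.2 - (1 / 2 : ℝ) •
    ((ContinuousLinearMap.apply ℝ ℝ z.2).comp
      ((ContinuousLinearMap.apply ℝ (F →L[ℝ] ℝ) z.2).comp (fderiv ℝ (chartForm g.inner x₀) z.1)))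

theorem christoffelForm_apply (g : SmoothMetric F M) (x₀ : M) {z : F × F}
    (hy : z.1 ∈ (extChartAt 𝓘(ℝ, F) x₀).target) (w : F) :
    christoffelForm g x₀ z w = christoffelFirst g x₀ z.1 z.2 z.2 w := by
  rw [g.christoffelFirst_self x₀ hy]
  simp [christoffelForm]

/-- The acceleration of the geodesic with position and velocity `z` in the chart at `x₀`. -/
def geodesicAccel (g : SmoothMetric F M) (x₀ : M) (z : F × F) : F :=
  -(chartForm g.inner x₀ z.1).inverse (christoffelForm g x₀ z)

/-- Positivity of the metric makes lowering the index injective; by dimension it is invertible, so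
the geodesic equation can be solved for the acceleration. -/
theorem chartForm_injective (g : SmoothMetric F M) {x₀ : M} {y : F}
    (hy : y ∈ (extChartAt 𝓘(ℝ, F) x₀).target) :
    Function.Injective (chartForm g.inner x₀ y) := by
  refine (injective_iff_map_eq_zero _).2 fun v hv => ?_
  by_contra h
  have h1 : chartFrame x₀ y v ≠ 0 := fun h2 =>
    h (chartFrame_injective hy (h2.trans (map_zero _).symm))
  have h2 : chartForm g.inner x₀ y v v = 0 := by rw [hv]; rfl
  exact (g.pos _ _ h1).ne' h2

theorem exists_equiv_chartForm (g : SmoothMetric F M) {x₀ : M} {y : F}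
    (hy : y ∈ (extChartAt 𝓘(ℝ, F) x₀).target) :
    ∃ e : F ≃L[ℝ] (F →L[ℝ] ℝ), (e : F →L[ℝ] F →L[ℝ] ℝ) = chartForm g.inner x₀ y := by
  have hfr : Module.finrank ℝ F = Module.finrank ℝ (F →L[ℝ] ℝ) := by
    rw [← (LinearMap.toContinuousLinearMap (𝕜 := ℝ) (E := F) (F' := ℝ)).finrank_eq]
    exact (Subspace.dual_finrank_eq (K := ℝ) (V := F)).symm
  let l := LinearEquiv.ofInjectiveOfFinrankEq (chartForm g.inner x₀ y).toLinearMap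
    (chartForm_injective g hy) hfr
  refine ⟨l.toContinuousLinearEquiv, ?_⟩
  ext v w
  rfl

theorem chartForm_geodesicAccel (g : SmoothMetric F M) {x₀ : M} {z : F × F}
    (hy : z.1 ∈ (extChartAt 𝓘(ℝ, F) x₀).target) (w : F) :
    metricCoeff g x₀ z.1 (geodesicAccel g x₀ z) w
      + christoffelFirst g x₀ z.1 z.2 z.2 w = 0 := by
  obtain ⟨e, he⟩ := exists_equiv_chartForm g hy
  rw [← chartForm_inner, geodesicAccel, ← he, ContinuousLinearMap.inverse_equiv, map_neg]
  simp [christoffelForm_apply g x₀ hy]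

theorem eq_geodesicAccel (g : SmoothMetric F M) {x₀ : M} {z : F × F}
    (hy : z.1 ∈ (extChartAt 𝓘(ℝ, F) x₀).target) {a : F}
    (h : ∀ w, metricCoeff g x₀ z.1 a w + christoffelFirst g x₀ z.1 z.2 z.2 w = 0) :
    a = geodesicAccel g x₀ z := by
  refine chartForm_injective g hy ?_
  ext w
  have h1 := h w
  have h2 := chartForm_geodesicAccel g hy w
  rw [← chartForm_inner] at h1 h2
  linarith

/-- The coefficients are smooth and inversion of invertible linear maps is smooth. The Christoffel
form is tested on vectors. -/
theorem contDiffAt_geodesicAccel (g : SmoothMetric F M) {x₀ : M} {z : F × F}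
    (hy : z.1 ∈ (extChartAt 𝓘(ℝ, F) x₀).target) :
    ContDiffAt ℝ ∞ (geodesicAccel g x₀) z := by
  have hB : ContDiffAt ℝ ∞ (chartForm g.inner x₀) z.1 :=
    (g.contDiffOn_chartForm x₀).contDiffAt (extChartAt_target_mem_nhds' hy)
  have hB1 : ContDiffAt ℝ ∞ (fun z : F × F => chartForm g.inner x₀ z.1) z :=
    hB.comp z contDiffAt_fst
  have hΦ : ContDiffAt ℝ ∞ (christoffelForm g x₀) z := by
    refine contDiffAt_clm_of_apply fun w => ?_
    have h1 : (fun z : F × F => christoffelForm g x₀ z w) = fun z : F × F =>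
        fderiv ℝ (chartForm g.inner x₀) z.1 z.2 z.2 w
          - (1 / 2 : ℝ) * fderiv ℝ (chartForm g.inner x₀) z.1 w z.2 z.2 := by
      funext z; simp [christoffelForm]
    rw [h1]
    have h2 := contDiffAt_fderiv_fst (D := F →L[ℝ] F →L[ℝ] ℝ) (u := fun z => z.2) hB contDiffAt_snd
    have h3 := contDiffAt_fderiv_fst (D := F →L[ℝ] F →L[ℝ] ℝ) (u := fun _ => w) hB contDiffAt_const
    exact ((h2.clm_apply contDiffAt_snd).clm_apply contDiffAt_const).sub (contDiffAt_const.mul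
      ((h3.clm_apply contDiffAt_snd).clm_apply contDiffAt_snd))
  obtain ⟨e, he⟩ := exists_equiv_chartForm g hy
  have hinv : ContDiffAt ℝ ∞ ContinuousLinearMap.inverse (chartForm g.inner x₀ z.1) := by
    rw [← he]; exact contDiffAt_map_inverse e
  exact ((ContDiffAt.comp (g := ContinuousLinearMap.inverse) z hinv hB1).clm_apply hΦ).neg

/-- The geodesic equation in a chart, as a first order differential equation. -/
def geodesicField (g : SmoothMetric F M) (x₀ : M) (z : F × F) : F × F :=
  (z.2, geodesicAccel g x₀ z)

theorem contDiffAt_geodesicField (g : SmoothMetric F M) {x₀ : M} {z : F × F}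
    (hy : z.1 ∈ (extChartAt 𝓘(ℝ, F) x₀).target) :
    ContDiffAt ℝ ∞ (geodesicField g x₀) z :=
  contDiffAt_snd.prodMk (contDiffAt_geodesicAccel g hy)

theorem IsGeodesicOn.hasDerivAt_chart {g : SmoothMetric F M} {γ : ℝ → M} {J : Set ℝ}
    (hγ : IsGeodesicOn g γ J) (hJ : IsOpen J) {x₀ : M} {t : ℝ} (ht : t ∈ J)
    (hx : γ t ∈ (extChartAt 𝓘(ℝ, F) x₀).source) :
    HasDerivAt (fun s => (extChartAt 𝓘(ℝ, F) x₀ (γ s),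
        deriv (fun s => extChartAt 𝓘(ℝ, F) x₀ (γ s)) s))
      (geodesicField g x₀ (extChartAt 𝓘(ℝ, F) x₀ (γ t),
        deriv (fun s => extChartAt 𝓘(ℝ, F) x₀ (γ s)) t)) t := by
  have hc : ContDiffAt ℝ 2 (fun s => extChartAt 𝓘(ℝ, F) x₀ (γ s)) t :=
    (contDiffAt_chart_comp (hγ.1.contMDiffAt (hJ.mem_nhds ht)) hx).of_le ENat.LEInfty.out
  have hc1 := (hc.differentiableAt (by norm_num)).hasDerivAt
  have hc2 : HasDerivAt (deriv fun s => extChartAt 𝓘(ℝ, F) x₀ (γ s))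
      (deriv (deriv fun s => extChartAt 𝓘(ℝ, F) x₀ (γ s)) t) t :=
    (((hc.fderiv_right (m := 1) (by norm_num)).differentiableAt (by norm_num)).clm_apply
      (differentiableAt_const (1 : ℝ))).hasDerivAt
  have h := eq_geodesicAccel g (x₀ := x₀) (z := (extChartAt 𝓘(ℝ, F) x₀ (γ t),
        deriv (fun s => extChartAt 𝓘(ℝ, F) x₀ (γ s)) t))
    ((extChartAt 𝓘(ℝ, F) x₀).map_source hx) (hγ.2 x₀ t ht hx)
  rw [h] at hc2
  exact hc1.prodMk hc2

theorem IsGeodesicOn.mono {g : SmoothMetric F M} {γ : ℝ → M} {J J' : Set ℝ}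
    (hγ : IsGeodesicOn g γ J) (h : J' ⊆ J) : IsGeodesicOn g γ J' :=
  ⟨hγ.1.mono h, fun x₀ t ht => hγ.2 x₀ t (h ht)⟩

/-- Passes between intrinsic and coordinate velocities. The coincidence set in the uniqueness proof
must be intrinsic, since the chart varies along the curve. -/
theorem mfderiv_curve_eq_iff {γ₁ γ₂ : ℝ → M} {t : ℝ} {x₀ : M}
    (h1 : MDifferentiableAt 𝓘(ℝ, ℝ) 𝓘(ℝ, F) γ₁ t) (h2 : MDifferentiableAt 𝓘(ℝ, ℝ) 𝓘(ℝ, F) γ₂ t)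
    (hx : γ₁ t ∈ (extChartAt 𝓘(ℝ, F) x₀).source) (heq : γ₁ t = γ₂ t) :
    (mfderiv 𝓘(ℝ, ℝ) 𝓘(ℝ, F) γ₁ t (1 : ℝ) : F) = mfderiv 𝓘(ℝ, ℝ) 𝓘(ℝ, F) γ₂ t (1 : ℝ) ↔
    deriv (fun s => extChartAt 𝓘(ℝ, F) x₀ (γ₁ s)) t
      = deriv (fun s => extChartAt 𝓘(ℝ, F) x₀ (γ₂ s)) t := by
  have e1 := mfderiv_eq_chartFrame h1 hx (1 : ℝ)
  have e2 := mfderiv_eq_chartFrame (x₀ := x₀) h2 (heq ▸ hx) (1 : ℝ)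
  rw [← heq] at e2
  have hinj := chartFrame_injective ((extChartAt 𝓘(ℝ, F) x₀).map_source hx)
  exact ⟨fun h => hinj (e1.symm.trans (h.trans e2)), fun h =>
    e1.trans ((congrArg (chartFrame x₀ (extChartAt 𝓘(ℝ, F) x₀ (γ₁ t))) h).trans e2.symm)⟩

theorem eventually_ne_of_continuousAt {X Y : Type*} [TopologicalSpace X] [TopologicalSpace Y]
    [T2Space Y] {f h : X → Y} {x : X} (hf : ContinuousAt f x) (hh : ContinuousAt h x)
    (hne : f x ≠ h x) : ∀ᶠ y in 𝓝 x, f y ≠ h y :=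
  (hf.prodMk hh).eventually (isClosed_diagonal.isOpen_compl.mem_nhds hne)

/-- Uniqueness of geodesics. -/
theorem IsGeodesicOn.eqOn [T2Space M] {g : SmoothMetric F M} {γ₁ γ₂ : ℝ → M} {J : Set ℝ}
    (h1 : IsGeodesicOn g γ₁ J) (h2 : IsGeodesicOn g γ₂ J) (hJ : IsOpen J) (hJc : J.OrdConnected)
    {t₀ : ℝ} (ht₀ : t₀ ∈ J) (heq : γ₁ t₀ = γ₂ t₀)
    (hvel : (mfderiv 𝓘(ℝ, ℝ) 𝓘(ℝ, F) γ₁ t₀ (1 : ℝ) : F) = mfderiv 𝓘(ℝ, ℝ) 𝓘(ℝ, F) γ₂ t₀ (1 : ℝ)) :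
    Set.EqOn γ₁ γ₂ J := by
  -- Coincidence of position and velocity is open by uniqueness for the first-order equation in a
  -- chart, and closed in J because the manifold and the model space are Hausdorff. The interval J
  -- is connected.
  set A : Set ℝ := {t | t ∈ J ∧ γ₁ t = γ₂ t ∧
    (mfderiv 𝓘(ℝ, ℝ) 𝓘(ℝ, F) γ₁ t (1 : ℝ) : F) = mfderiv 𝓘(ℝ, ℝ) 𝓘(ℝ, F) γ₂ t (1 : ℝ)} with hA
  have hd1 : ∀ t ∈ J, ContMDiffAt 𝓘(ℝ, ℝ) 𝓘(ℝ, F) ∞ γ₁ t := fun t ht =>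
    h1.1.contMDiffAt (hJ.mem_nhds ht)
  have hd2 : ∀ t ∈ J, ContMDiffAt 𝓘(ℝ, ℝ) 𝓘(ℝ, F) ∞ γ₂ t := fun t ht =>
    h2.1.contMDiffAt (hJ.mem_nhds ht)
  have hopen : IsOpen A := by
    rw [isOpen_iff_mem_nhds]
    rintro t ⟨ht, hp, hv⟩
    set e := extChartAt 𝓘(ℝ, F) (γ₁ t) with he
    have hx1 : γ₁ t ∈ e.source := mem_extChartAt_source _
    have hx2 : γ₂ t ∈ e.source := hp ▸ hx1
    have hs1 : ∀ᶠ s in 𝓝 t, γ₁ s ∈ e.source := (hd1 t ht).continuousAt.preimage_mem_nhds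
      ((isOpen_extChartAt_source (I := 𝓘(ℝ, F)) (γ₁ t)).mem_nhds hx1)
    have hs2 : ∀ᶠ s in 𝓝 t, γ₂ s ∈ e.source := (hd2 t ht).continuousAt.preimage_mem_nhds
      ((isOpen_extChartAt_source (I := 𝓘(ℝ, F)) (γ₁ t)).mem_nhds hx2)
    have hv' := (mfderiv_curve_eq_iff ((hd1 t ht).mdifferentiableAt (by simp))
      ((hd2 t ht).mdifferentiableAt (by simp)) hx1 hp).1 hv
    obtain ⟨C, s, hs, hlip⟩ := ((contDiffAt_geodesicField g (x₀ := γ₁ t)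
      (z := (e (γ₁ t), deriv (fun s => e (γ₁ s)) t)) (e.map_source hx1)).of_le
        (m := 1) ENat.LEInfty.out).exists_lipschitzOnWith
    have hD1 := h1.hasDerivAt_chart hJ ht hx1
    have hD2 := h2.hasDerivAt_chart hJ ht hx2
    have hz : (e (γ₂ t), deriv (fun s => e (γ₂ s)) t)
      = (e (γ₁ t), deriv (fun s => e (γ₁ s)) t) := by
      rw [he, ← hv', ← hp]
    have hm1 : ∀ᶠ r in 𝓝 t, (e (γ₁ r), deriv (fun s => e (γ₁ s)) r) ∈ s :=
      hD1.continuousAt.preimage_mem_nhds hs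
    have hm2 : ∀ᶠ r in 𝓝 t, (e (γ₂ r), deriv (fun s => e (γ₂ s)) r) ∈ s :=
      hD2.continuousAt.preimage_mem_nhds (by rw [hz]; exact hs)
    have hJe := hJ.mem_nhds ht
    have key := ODE_solution_unique_of_eventually
      (v := fun _ => geodesicField g (γ₁ t)) (s := fun _ => s) (t₀ := t)
      (f := fun r => (e (γ₁ r), deriv (fun s => e (γ₁ s)) r))
      (g := fun r => (e (γ₂ r), deriv (fun s => e (γ₂ s)) r))
      (Filter.Eventually.of_forall fun _ => hlip)
      (by filter_upwards [hJe, hs1, hm1] with r hr hr1 hr2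
          exact ⟨h1.hasDerivAt_chart hJ hr hr1, hr2⟩)
      (by filter_upwards [hJe, hs2, hm2] with r hr hr1 hr2
          exact ⟨h2.hasDerivAt_chart hJ hr hr1, hr2⟩) hz.symm
    filter_upwards [hJe, hs1, hs2, key] with r hr hr1 hr2 hr3
    obtain ⟨hr4, hr5⟩ := Prod.ext_iff.1 hr3
    have hr6 : γ₁ r = γ₂ r := e.injOn hr1 hr2 hr4
    exact ⟨hr, hr6, (mfderiv_curve_eq_iff ((hd1 r hr).mdifferentiableAt (by simp))
      ((hd2 r hr).mdifferentiableAt (by simp)) hr1 hr6).2 hr5⟩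
  have hcl : closure A ∩ J ⊆ A := by
    rintro t ⟨htc, ht⟩
    set e := extChartAt 𝓘(ℝ, F) (γ₁ t) with he
    have hx1 : γ₁ t ∈ e.source := mem_extChartAt_source _
    have hfr : ∃ᶠ s in 𝓝 t, s ∈ A := mem_closure_iff_frequently.1 htc
    have hp : γ₁ t = γ₂ t := by
      by_contra hne
      have h3 : ∀ᶠ s in 𝓝 t, γ₁ s ≠ γ₂ s := 
        eventually_ne_of_continuousAt (hd1 t ht).continuousAt (hd2 t ht).continuousAt hne
      obtain ⟨s, hs, hs'⟩ := (hfr.and_eventually h3).exists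
      exact hs' hs.2.1
    have hx2 : γ₂ t ∈ e.source := hp ▸ hx1
    have hs1 : ∀ᶠ s in 𝓝 t, γ₁ s ∈ e.source := (hd1 t ht).continuousAt.preimage_mem_nhds
      ((isOpen_extChartAt_source (I := 𝓘(ℝ, F)) (γ₁ t)).mem_nhds hx1)
    refine ⟨ht, hp, (mfderiv_curve_eq_iff ((hd1 t ht).mdifferentiableAt (by simp))
      ((hd2 t ht).mdifferentiableAt (by simp)) hx1 hp).2 ?_⟩
    by_contra hne
    have hD1 := (h1.hasDerivAt_chart hJ ht hx1).continuousAt.snd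
    have hD2 := (h2.hasDerivAt_chart hJ ht hx2).continuousAt.snd
    have h3 := eventually_ne_of_continuousAt hD1 hD2 hne
    obtain ⟨s, hs, hs', hs3⟩ := (hfr.and_eventually (h3.and hs1)).exists
    exact hs' ((mfderiv_curve_eq_iff ((hd1 s hs.1).mdifferentiableAt (by simp))
      ((hd2 s hs.1).mdifferentiableAt (by simp)) hs3 hs.2.1).1 hs.2.2)
  have hsub : J ⊆ A := hJc.isPreconnected.subset_of_closure_inter_subset hopen
    ⟨t₀, ht₀, ht₀, heq, hvel⟩ hcl
  exact fun t ht => (hsub ht).2.1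

/-- Local solutions of the geodesic equation in one chart. -/
theorem exists_local_geodesic_chart (g : SmoothMetric F M) (p : M) (v : F) :
    ∃ ε > 0, ∃ γ : ℝ → M, γ 0 = p ∧ (mfderiv 𝓘(ℝ, ℝ) 𝓘(ℝ, F) γ 0 (1 : ℝ) : F) = v ∧
      ContMDiffOn 𝓘(ℝ, ℝ) 𝓘(ℝ, F) ∞ γ (Set.Ioo (-ε) ε) ∧ ∀ t ∈ Set.Ioo (-ε) ε,
      γ t ∈ (extChartAt 𝓘(ℝ, F) p).source ∧ ∀ w : F,
        metricCoeff g p (extChartAt 𝓘(ℝ, F) p (γ t))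
            (deriv (deriv fun s => extChartAt 𝓘(ℝ, F) p (γ s)) t) w
          + christoffelFirst g p (extChartAt 𝓘(ℝ, F) p (γ t))
            (deriv (fun s => extChartAt 𝓘(ℝ, F) p (γ s)) t)
            (deriv (fun s => extChartAt 𝓘(ℝ, F) p (γ s)) t) w = 0 := by
  set e := extChartAt 𝓘(ℝ, F) p with he
  have hp : p ∈ e.source := mem_extChartAt_source p
  have hy : e p ∈ e.target := e.map_source hp
  obtain ⟨u, hu⟩ := chartFrame_surjective (x₀ := p) hy v
  obtain ⟨z, hz0, ε₁, hε₁, hz⟩ := (((contDiffAt_geodesicField g (x₀ := p) (z := (e p, u)) hy).of_le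
    (m := 1) ENat.LEInfty.out).exists_forall_mem_closedBall_exists_eq_forall_mem_Ioo_hasDerivAt₀ 0)
  rw [zero_sub, zero_add] at hz
  have hzc : ContinuousAt (fun t => (z t).1) 0 :=
    (hz 0 ⟨by linarith, hε₁⟩).continuousAt.fst
  have htn : e.target ∈ 𝓝 ((z 0).1) := by
    rw [hz0]; exact extChartAt_target_mem_nhds' hy
  obtain ⟨δ, hδ, hδs⟩ := Metric.mem_nhds_iff.1 (hzc.preimage_mem_nhds htn)
  -- The time is cut down so that the position stays inside the chart target.
  set ε := min δ ε₁ with hε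
  have hεpos : 0 < ε := lt_min hδ hε₁
  have hzt : ∀ t ∈ Set.Ioo (-ε) ε, (z t).1 ∈ e.target := by
    intro t ht
    refine hδs ?_
    rw [Metric.mem_ball, Real.dist_eq, sub_zero, abs_lt]
    have := min_le_left δ ε₁
    exact ⟨by linarith [ht.1], by linarith [ht.2]⟩
  have hzd : ∀ t ∈ Set.Ioo (-ε) ε, HasDerivAt z (geodesicField g p (z t)) t := fun t ht => by
    have := min_le_right δ ε₁
    exact hz t ⟨by linarith [ht.1], by linarith [ht.2]⟩
  have hsm : ContDiffOn ℝ ∞ z (Set.Ioo (-ε) ε) :=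
    contDiffOn_of_hasDerivAt (f := geodesicField g p) (U := {z | z.1 ∈ e.target})
      (fun z hz => (contDiffAt_geodesicField g (x₀ := p) (z := z) hz).contDiffWithinAt) isOpen_Ioo hzd hzt
  have h1 : ∀ t ∈ Set.Ioo (-ε) ε, HasDerivAt (fun s => (z s).1) (z t).2 t := fun t ht =>
    (hzd t ht).fst
  have h2 : ∀ t ∈ Set.Ioo (-ε) ε, HasDerivAt (fun s => (z s).2) (geodesicAccel g p (z t)) t :=
    fun t ht => (hzd t ht).snd
  have hnb : ∀ t ∈ Set.Ioo (-ε) ε, Set.Ioo (-ε) ε ∈ 𝓝 t := fun t ht => isOpen_Ioo.mem_nhds ht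
  have hd1 : ∀ t ∈ Set.Ioo (-ε) ε,
      deriv (fun s => e (e.symm (z s).1)) =ᶠ[𝓝 t] fun s => (z s).2 := by
    intro t ht
    filter_upwards [hnb t ht] with s hs
    have : (fun s => e (e.symm (z s).1)) =ᶠ[𝓝 s] fun s => (z s).1 := by
      filter_upwards [hnb s hs] with r hr
      exact e.right_inv (hzt r hr)
    rw [this.deriv_eq, (h1 s hs).deriv]
  have h0 : (0 : ℝ) ∈ Set.Ioo (-ε) ε := ⟨by linarith, hεpos⟩
  have hγs : ContMDiffOn 𝓘(ℝ, ℝ) 𝓘(ℝ, F) ∞ (fun t => e.symm (z t).1) (Set.Ioo (-ε) ε) := by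
    intro t ht
    have h3 : ContDiffAt ℝ ∞ (fun s => (z s).1) t :=
      contDiffAt_fst.comp t (hsm.contDiffAt (hnb t ht))
    exact (ContMDiffAt.comp (g := e.symm) t (contMDiffAt_chart_symm (hzt t ht))
      h3.contMDiffAt).contMDiffWithinAt
  refine ⟨ε, hεpos, fun t => e.symm (z t).1, ?_, ?_, hγs, ?_⟩
  · simp only [hz0]; exact e.left_inv hp
  · have h3 := mfderiv_eq_chartFrame (x₀ := p) ((hγs.contMDiffAt (hnb 0 h0)).mdifferentiableAt
      (by simp)) (e.map_target (hzt 0 h0)) (1 : ℝ)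
    rw [h3, ← hu]
    have h4 : fderiv ℝ (fun s => e (e.symm (z s).1)) 0 (1 : ℝ) = (z 0).2 :=
      (hd1 0 h0).self_of_nhds
    rw [← he, h4, e.right_inv (hzt 0 h0), hz0]
  · intro t ht
    refine ⟨e.map_target (hzt t ht), fun w => ?_⟩
    rw [(hd1 t ht).deriv_eq, (h2 t ht).deriv, (hd1 t ht).self_of_nhds, e.right_inv (hzt t ht)]
    exact chartForm_geodesicAccel g (hzt t ht) w

end GeodesicEquation

/-! ### The adjoint representation -/

section Adjoint

set_option linter.unusedSectionVars false

variable {E : Type*} [NormedAddCommGroup E] [NormedSpace ℝ E]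
  {L : Type*} [TopologicalSpace L] [ChartedSpace E L] [Group L] [LieGroup 𝓘(ℝ, E) ∞ L]

/-- The tangent space at x is identified with the model space by the chart at x itself, so there the
frame is trivial. For this reason Lie algebra computations use the chart at 1. -/
theorem chartFrame_self {F : Type*} [NormedAddCommGroup F] [NormedSpace ℝ F]
    {M : Type*} [TopologicalSpace M] [ChartedSpace F M] [IsManifold 𝓘(ℝ, F) ∞ M] (x : M) :
    chartFrame x (extChartAt 𝓘(ℝ, F) x x) = ContinuousLinearMap.id ℝ F := by
  have h := mfderivWithin_range_extChartAt_symm (I := 𝓘(ℝ, F)) (x := x)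
  simp only [modelWithCornersSelf_coe, Set.range_id, mfderivWithin_univ] at h
  exact h

/-- The adjoint representation, as a continuous linear map. -/
def adjointMap (E : Type*) [NormedAddCommGroup E] [NormedSpace ℝ E] {L : Type*}
    [TopologicalSpace L] [ChartedSpace E L] [Group L] (a : L) : E →L[ℝ] E :=
  mfderiv 𝓘(ℝ, E) 𝓘(ℝ, E) (fun x : L => a * x * a⁻¹) 1

variable (L) in
/-- The Lie bracket on the model space. -/
def lieBracketModel (X Y : E) : E :=
  Bracket.bracket (L := GroupLieAlgebra 𝓘(ℝ, E) L) (M := GroupLieAlgebra 𝓘(ℝ, E) L) X Y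

theorem contMDiff_conj (a : L) : ContMDiff 𝓘(ℝ, E) 𝓘(ℝ, E) ∞ (fun x : L => a * x * a⁻¹) :=
  (contMDiff_const.mul contMDiff_id).mul contMDiff_const

theorem adjointMap_one (X : E) : adjointMap E (1 : L) X = X := by
  have h1 : (fun x : L => (1 : L) * x * (1 : L)⁻¹) = id := by funext x; simp
  rw [adjointMap, h1, mfderiv_id]
  rfl

theorem adjointMap_mul (a c : L) (X : E) :
    adjointMap E (a * c) X = adjointMap E a (adjointMap E c X) := by
  have h1 : (fun x : L => a * c * x * (a * c)⁻¹)
      = (fun x => a * x * a⁻¹) ∘ fun x => c * x * c⁻¹ := by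
    funext x; simp [mul_assoc]
  have h2 := ((contMDiff_conj (E := E) a).mdifferentiableAt (x := c * 1 * c⁻¹) (by simp)).hasMFDerivAt.comp
    (1 : L) ((contMDiff_conj (E := E) c).mdifferentiableAt (by simp)).hasMFDerivAt
  rw [← h1] at h2
  have h3 : (mfderiv 𝓘(ℝ, E) 𝓘(ℝ, E) (fun x : L => a * c * x * (a * c)⁻¹) 1 X : E) = _ :=
    DFunLike.congr_fun h2.mfderiv X
  have key : ∀ d : L, d = 1 → ∀ v : E,
      (mfderiv 𝓘(ℝ, E) 𝓘(ℝ, E) (fun x : L => a * x * a⁻¹) d v : E)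
        = mfderiv 𝓘(ℝ, E) 𝓘(ℝ, E) (fun x : L => a * x * a⁻¹) 1 v := by rintro _ rfl v; rfl
  exact h3.trans (key _ (by simp) _)

theorem adjointMap_apply_inv (a : L) (X : E) :
    adjointMap E a (adjointMap E a⁻¹ X) = X := by
  rw [← adjointMap_mul, mul_inv_cancel, adjointMap_one]

/-- Reading the source in the chart at 1 costs nothing, as the inverse chart has identity derivative
there. -/
theorem mfderiv_one_eq_chartFrame {h : L → L} (hh : MDifferentiableAt 𝓘(ℝ, E) 𝓘(ℝ, E) h 1)
    (h1 : h 1 ∈ (extChartAt 𝓘(ℝ, E) (1 : L)).source) (X : E) :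
    (mfderiv 𝓘(ℝ, E) 𝓘(ℝ, E) h 1 X : E) = chartFrame (1 : L) (extChartAt 𝓘(ℝ, E) (1 : L) (h 1))
      (fderiv ℝ (fun z => extChartAt 𝓘(ℝ, E) (1 : L) (h ((extChartAt 𝓘(ℝ, E) (1 : L)).symm z)))
        (extChartAt 𝓘(ℝ, E) (1 : L) 1) X) := by
  set e := extChartAt 𝓘(ℝ, E) (1 : L) with he
  have hs1 : (1 : L) ∈ e.source := mem_extChartAt_source _
  have hl : e.symm (e 1) = 1 := e.left_inv hs1
  have hd : MDifferentiableAt 𝓘(ℝ, E) 𝓘(ℝ, E) e.symm (e 1) :=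
    (contMDiffAt_chart_symm (e.map_source hs1)).mdifferentiableAt (by simp)
  have hh' : MDifferentiableAt 𝓘(ℝ, E) 𝓘(ℝ, E) h (e.symm (e 1)) := by rw [hl]; exact hh
  have hc := hh'.hasMFDerivAt.comp (e 1) hd.hasMFDerivAt
  have h2 := mfderiv_eq_chartFrame (x₀ := (1 : L)) hc.mdifferentiableAt
    (by rw [Function.comp_apply, hl]; exact h1) X
  have h3 : (mfderiv 𝓘(ℝ, E) 𝓘(ℝ, E) (h ∘ e.symm) (e 1) X : E) = _ :=
    DFunLike.congr_fun hc.mfderiv X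
  have key : ∀ d : L, d = 1 → ∀ v : E, (mfderiv 𝓘(ℝ, E) 𝓘(ℝ, E) h 1 v : E)
      = mfderiv 𝓘(ℝ, E) 𝓘(ℝ, E) h d v := by rintro _ rfl v; rfl
  have h4 : (mfderiv 𝓘(ℝ, E) 𝓘(ℝ, E) e.symm (e 1) X : E) = X :=
    DFunLike.congr_fun (chartFrame_self (1 : L)) X
  have h5 : (mfderiv 𝓘(ℝ, E) 𝓘(ℝ, E) h 1 X : E) =
      mfderiv 𝓘(ℝ, E) 𝓘(ℝ, E) h (e.symm (e 1)) (mfderiv 𝓘(ℝ, E) 𝓘(ℝ, E) e.symm (e 1) X) := by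
    refine (key _ hl X).trans ?_
    exact congrArg (fun v : E => (mfderiv 𝓘(ℝ, E) 𝓘(ℝ, E) h (e.symm (e 1)) v : E)) h4.symm
  refine h5.trans (h3.symm.trans (h2.trans ?_))
  simp only [Function.comp_apply, hl]
  rfl

theorem fderiv_snd_apply {A B C : Type*} [NormedAddCommGroup A] [NormedSpace ℝ A]
    [NormedAddCommGroup B] [NormedSpace ℝ B] [NormedAddCommGroup C] [NormedSpace ℝ C]
    {f : A × B → C} {a : A} {b : B} (hf : DifferentiableAt ℝ f (a, b)) (v : B) :
    fderiv ℝ (fun z => f (a, z)) b v = fderiv ℝ f (a, b) (0, v) := by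
  have h := hf.hasFDerivAt.comp b (hasFDerivAt_prodMk_right a b)
  exact DFunLike.congr_fun h.fderiv v

theorem mulInvariantVectorField_chart {y : E} (hy : y ∈ (extChartAt 𝓘(ℝ, E) (1 : L)).target)
    (X : E) :
    (mulInvariantVectorField (I := 𝓘(ℝ, E)) (G := L) X ((extChartAt 𝓘(ℝ, E) (1 : L)).symm y) : E)
      = chartFrame (1 : L) y
        (fderiv ℝ (chartMul (L := L)) (y, extChartAt 𝓘(ℝ, E) (1 : L) 1) (0, X)) := by
  set e := extChartAt 𝓘(ℝ, E) (1 : L) with he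
  have hs1 : (1 : L) ∈ e.source := mem_extChartAt_source _
  have hl : e.symm (e 1) = 1 := e.left_inv hs1
  have h1 := mfderiv_one_eq_chartFrame (h := fun x : L => e.symm y * x)
    ((contMDiff_mul_left (I := 𝓘(ℝ, E)) (n := ∞)).mdifferentiableAt (by simp))
    (by rw [mul_one]; exact e.map_target hy) X
  rw [← fderiv_snd_apply ((contDiffAt_chartMul hy (e.map_source hs1)
    (by rw [hl, mul_one]; exact e.map_target hy)).differentiableAt (by simp))]
  refine h1.trans ?_
  rw [mul_one, ← he, e.right_inv hy]
  rfl

/-- Conjugation read in the chart at `1`. -/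
def chartConj (z : E × E) : E :=
  extChartAt 𝓘(ℝ, E) (1 : L)
    ((extChartAt 𝓘(ℝ, E) (1 : L)).symm z.1 * (extChartAt 𝓘(ℝ, E) (1 : L)).symm z.2 *
      ((extChartAt 𝓘(ℝ, E) (1 : L)).symm z.1)⁻¹)

theorem contDiffAt_chartConj {y : E} (hy : y ∈ (extChartAt 𝓘(ℝ, E) (1 : L)).target) :
    ContDiffAt ℝ ∞ (chartConj (L := L)) (y, extChartAt 𝓘(ℝ, E) (1 : L) 1) := by
  have hs1 : (1 : L) ∈ (extChartAt 𝓘(ℝ, E) (1 : L)).source := mem_extChartAt_source _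
  have h1 : ContMDiffAt 𝓘(ℝ, E × E) 𝓘(ℝ, E) ∞
      (fun z : E × E => (extChartAt 𝓘(ℝ, E) (1 : L)).symm z.1)
      (y, extChartAt 𝓘(ℝ, E) (1 : L) 1) :=
    ContMDiffAt.comp (g := (extChartAt 𝓘(ℝ, E) (1 : L)).symm) (y, extChartAt 𝓘(ℝ, E) (1 : L) 1)
      (contMDiffAt_chart_symm hy) contDiff_fst.contMDiff.contMDiffAt
  have h2 : ContMDiffAt 𝓘(ℝ, E × E) 𝓘(ℝ, E) ∞
      (fun z : E × E => (extChartAt 𝓘(ℝ, E) (1 : L)).symm z.2)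
      (y, extChartAt 𝓘(ℝ, E) (1 : L) 1) :=
    ContMDiffAt.comp (g := (extChartAt 𝓘(ℝ, E) (1 : L)).symm) (y, extChartAt 𝓘(ℝ, E) (1 : L) 1)
      (contMDiffAt_chart_symm ((extChartAt 𝓘(ℝ, E) (1 : L)).map_source hs1))
      contDiff_snd.contMDiff.contMDiffAt
  refine contDiffAt_chart_comp ((h1.mul h2).mul h1.inv) ?_
  simp only [(extChartAt 𝓘(ℝ, E) (1 : L)).left_inv hs1, mul_one, mul_inv_cancel]
  exact hs1

theorem adjointMap_chart {y : E} (hy : y ∈ (extChartAt 𝓘(ℝ, E) (1 : L)).target)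
    (X : E) :
    (adjointMap E ((extChartAt 𝓘(ℝ, E) (1 : L)).symm y) X : E)
      = fderiv ℝ (chartConj (L := L)) (y, extChartAt 𝓘(ℝ, E) (1 : L) 1) (0, X) := by
  set e := extChartAt 𝓘(ℝ, E) (1 : L) with he
  have hs1 : (1 : L) ∈ e.source := mem_extChartAt_source _
  have h1 := mfderiv_one_eq_chartFrame (h := fun x : L => e.symm y * x * (e.symm y)⁻¹)
    ((contMDiff_conj _).mdifferentiableAt (by simp))
    (by rw [mul_one, mul_inv_cancel]; exact hs1) X
  rw [← fderiv_snd_apply ((contDiffAt_chartConj hy).differentiableAt (by simp))]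
  refine h1.trans ?_
  rw [mul_one, mul_inv_cancel, ← he, he, chartFrame_self]
  rfl

/-- The derivative at z = 1 of the identity yz = (yzy⁻¹)y. It controls conjugation without
differentiating the inversion. -/
theorem fderiv_chartMul_adjointMap {y : E} (hy : y ∈ (extChartAt 𝓘(ℝ, E) (1 : L)).target)
    (X : E) :
    fderiv ℝ (chartMul (L := L)) (extChartAt 𝓘(ℝ, E) (1 : L) 1, y)
        (fderiv ℝ (chartConj (L := L)) (y, extChartAt 𝓘(ℝ, E) (1 : L) 1) (0, X), 0)
      = fderiv ℝ (chartMul (L := L)) (y, extChartAt 𝓘(ℝ, E) (1 : L) 1) (0, X) := by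
  set e := extChartAt 𝓘(ℝ, E) (1 : L) with he
  have hs1 : (1 : L) ∈ e.source := mem_extChartAt_source _
  have hl : e.symm (e 1) = 1 := e.left_inv hs1
  have ht1 := e.map_source hs1
  have hC0 : chartConj (L := L) (y, e 1) = e 1 := by
    rw [chartConj, ← he]; simp only [hl, mul_one, mul_inv_cancel]
  have hC := (contDiffAt_chartConj hy).differentiableAt (by simp)
  have hC2 := hC.hasFDerivAt.comp (e 1) (hasFDerivAt_prodMk_right y (e 1))
  have hm : DifferentiableAt ℝ (chartMul (L := L)) (e 1, y) :=
    (contDiffAt_chartMul ht1 hy (by rw [hl, one_mul]; exact e.map_target hy)).differentiableAt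
      (by simp)
  have hm' : HasFDerivAt (chartMul (L := L)) (fderiv ℝ (chartMul (L := L)) (e 1, y))
      (chartConj (L := L) (y, e 1), y) := by rw [hC0]; exact hm.hasFDerivAt
  have h1 := hm'.comp (e 1) (hC2.prodMk (hasFDerivAt_const y (e 1)))
  have h2 : (fun z => chartMul (L := L) (y, z)) =ᶠ[𝓝 (e 1)]
      fun z => chartMul (L := L) (chartConj (L := L) (y, z), y) := by
    have hcont : ContinuousAt (fun z => e.symm y * e.symm z * (e.symm y)⁻¹) (e 1) := by
      have h3 : ContMDiffAt 𝓘(ℝ, E) 𝓘(ℝ, E) ∞ e.symm (e 1) := contMDiffAt_chart_symm ht1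
      exact ((contMDiff_conj (e.symm y)).contMDiffAt.comp (e 1) h3).continuousAt
    filter_upwards [hcont.preimage_mem_nhds
      ((isOpen_extChartAt_source (I := 𝓘(ℝ, E)) (1 : L)).mem_nhds
        (by rw [hl, mul_one, mul_inv_cancel]; exact hs1))] with z hz
    rw [chartMul, chartMul, chartConj, ← he]
    simp only
    rw [e.left_inv hz, inv_mul_cancel_right]
  rw [← fderiv_snd_apply ((contDiffAt_chartMul hy ht1
    (by rw [hl, mul_one]; exact e.map_target hy)).differentiableAt (by simp)), h2.fderiv_eq]
  exact (DFunLike.congr_fun h1.fderiv X).symm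

/-- Multiplication is the identity in each variable when the other is 1. -/
theorem fderiv_chartMul_self (v w : E) :
    fderiv ℝ (chartMul (L := L)) (extChartAt 𝓘(ℝ, E) (1 : L) 1, extChartAt 𝓘(ℝ, E) (1 : L) 1) (v, w)
      = v + w := by
  set e := extChartAt 𝓘(ℝ, E) (1 : L) with he
  have hs1 : (1 : L) ∈ e.source := mem_extChartAt_source _
  have hl : e.symm (e 1) = 1 := e.left_inv hs1
  have ht1 := e.map_source hs1
  have hm : DifferentiableAt ℝ (chartMul (L := L)) (e 1, e 1) :=
    (contDiffAt_chartMul ht1 ht1 (by rw [hl, one_mul]; exact hs1)).differentiableAt (by simp)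
  have htn := extChartAt_target_mem_nhds' (I := 𝓘(ℝ, E)) ht1
  have h1 := (hm.hasFDerivAt.comp (e 1) (hasFDerivAt_prodMk_right (e 1) (e 1))).congr_of_eventuallyEq
    (f₁ := id) (by
      filter_upwards [htn] with z hz
      rw [Function.comp_apply, chartMul, ← he]
      change z = e (e.symm (e 1) * e.symm z)
      rw [hl, one_mul, e.right_inv hz])
  have h2 := (HasFDerivAt.comp (f := fun y => (y, e 1)) (e 1) hm.hasFDerivAt (hasFDerivAt_prodMk_left (e 1) (e 1))).congr_of_eventuallyEq
    (f₁ := id) (by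
      filter_upwards [htn] with z hz
      rw [Function.comp_apply, chartMul, ← he]
      change z = e (e.symm z * e.symm (e 1))
      rw [hl, mul_one, e.right_inv hz])
  have h3 := DFunLike.congr_fun (h1.unique (hasFDerivAt_id _)) w
  have h4 := DFunLike.congr_fun (h2.unique (hasFDerivAt_id _)) v
  have h5 : ((v, w) : E × E) = (v, 0) + (0, w) := by simp
  rw [h5, map_add]
  simp only [ContinuousLinearMap.comp_apply, ContinuousLinearMap.inr_apply,
    ContinuousLinearMap.inl_apply, ContinuousLinearMap.id_apply] at h3 h4
  rw [h3, h4]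

theorem contDiffAt_fderiv_chartConj {y : E} (hy : y ∈ (extChartAt 𝓘(ℝ, E) (1 : L)).target)
    (X : E) : ContDiffAt ℝ ∞ (fun y =>
      fderiv ℝ (chartConj (L := L)) (y, extChartAt 𝓘(ℝ, E) (1 : L) 1) (0, X)) y := by
  have h1 := (contDiffAt_chartConj (L := L) hy).fderiv_right (m := ∞) (by simp)
  have h2 : ContDiffAt ℝ ∞ (fun y : E => (y, extChartAt 𝓘(ℝ, E) (1 : L) 1)) y :=
    contDiffAt_id.prodMk contDiffAt_const
  exact (h1.comp y h2).clm_apply contDiffAt_const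

/-- Differentiate the identity of `fderiv_chartMul_adjointMap` in y at 1. The left side contributes
the mixed second derivative in (X, Z) plus the derivative sought; symmetry of the second derivative
reorders the arguments. -/
theorem fderiv_fderiv_chartConj (X Z : E) :
    fderiv ℝ (fun y => fderiv ℝ (chartConj (L := L)) (y, extChartAt 𝓘(ℝ, E) (1 : L) 1) (0, X))
        (extChartAt 𝓘(ℝ, E) (1 : L) 1) Z
      = fderiv ℝ (fderiv ℝ (chartMul (L := L)))
          (extChartAt 𝓘(ℝ, E) (1 : L) 1, extChartAt 𝓘(ℝ, E) (1 : L) 1) (Z, 0) (0, X)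
        - fderiv ℝ (fderiv ℝ (chartMul (L := L)))
          (extChartAt 𝓘(ℝ, E) (1 : L) 1, extChartAt 𝓘(ℝ, E) (1 : L) 1) (X, 0) (0, Z) := by
  set e := extChartAt 𝓘(ℝ, E) (1 : L) with he
  have hs1 : (1 : L) ∈ e.source := mem_extChartAt_source _
  have hl : e.symm (e 1) = 1 := e.left_inv hs1
  have ht1 := e.map_source hs1
  have hm : ContDiffAt ℝ ∞ (chartMul (L := L)) (e 1, e 1) :=
    contDiffAt_chartMul ht1 ht1 (by rw [hl, one_mul]; exact hs1)
  have hD : HasFDerivAt (fderiv ℝ (chartMul (L := L)))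
      (fderiv ℝ (fderiv ℝ (chartMul (L := L))) (e 1, e 1)) (e 1, e 1) :=
    ((hm.fderiv_right (m := 1) (by norm_num; exact ENat.LEInfty.out)).differentiableAt
      (by norm_num)).hasFDerivAt
  have hA := ((contDiffAt_fderiv_chartConj (L := L) ht1 X).differentiableAt (by simp)).hasFDerivAt
  rw [← he] at hA
  have hA0 : fderiv ℝ (chartConj (L := L)) (e 1, e 1) (0, X) = (X : E) := by
    have h2 := fderiv_chartMul_adjointMap ht1 X
    rw [← he] at h2
    have h3 := fderiv_chartMul_self (L := L)
      (fderiv ℝ (chartConj (L := L)) (e 1, e 1) (0, X)) 0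
    have h4 := fderiv_chartMul_self (L := L) 0 X
    rw [← he] at h3 h4
    rw [h3, h4] at h2
    simpa using h2
  have h1 := (hD.comp (e 1) (hasFDerivAt_prodMk_right (e 1) (e 1))).clm_apply
    (hA.prodMk (hasFDerivAt_const (0 : E) (e 1)))
  have h2 := (HasFDerivAt.comp (f := fun y => (y, e 1)) (e 1) hD (hasFDerivAt_prodMk_left (e 1) (e 1))).clm_apply
    (hasFDerivAt_const ((0 : E), (X : E)) (e 1))
  have h3 := h1.congr_of_eventuallyEq (f₁ := fun y => fderiv ℝ (chartMul (L := L)) (y, e 1) (0, X))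
    (by
      filter_upwards [extChartAt_target_mem_nhds' (I := 𝓘(ℝ, E)) ht1] with y hy
      exact (fderiv_chartMul_adjointMap hy X).symm)
  have h4 := DFunLike.congr_fun (h3.unique h2) Z
  have hsymm := (hm.isSymmSndFDerivAt (by simp; exact ENat.LEInfty.out)) (0, Z) (X, 0)
  have h5 := fderiv_chartMul_self (L := L) (fderiv ℝ (fun y =>
    fderiv ℝ (chartConj (L := L)) (y, e 1) (0, X)) (e 1) Z) 0
  rw [← he] at h5
  simp [hA0, hsymm, h5] at h4
  rw [eq_sub_iff_add_eq]
  exact h4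

theorem mdifferentiableAt_adjointMap (X : E) :
    MDifferentiableAt 𝓘(ℝ, E) 𝓘(ℝ, E) (fun a : L => (adjointMap E a X : E)) 1 ∧
    ∀ Z : E,
      (mfderiv 𝓘(ℝ, E) 𝓘(ℝ, E) (fun a : L => (adjointMap E a X : E)) 1 Z : E)
      = fderiv ℝ (fun y => fderiv ℝ (chartConj (L := L)) (y, extChartAt 𝓘(ℝ, E) (1 : L) 1) (0, X))
        (extChartAt 𝓘(ℝ, E) (1 : L) 1) Z := by
  set e := extChartAt 𝓘(ℝ, E) (1 : L) with he
  have hs1 : (1 : L) ∈ e.source := mem_extChartAt_source _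
  have hA := ((contDiffAt_fderiv_chartConj (L := L) (e.map_source hs1) X).differentiableAt
    (by simp)).mdifferentiableAt.hasMFDerivAt
  have he1 : HasMFDerivAt 𝓘(ℝ, E) 𝓘(ℝ, E) e (1 : L) (ContinuousLinearMap.id ℝ E) := by
    have := ((contMDiffAt_chart hs1).mdifferentiableAt (by simp)).hasMFDerivAt
    rwa [mfderiv_extChartAt_self] at this
  have h1 := (HasMFDerivAt.comp (1 : L) hA he1).congr_of_eventuallyEq
    (f₁ := fun a : L => (adjointMap E a X : E)) (by
      filter_upwards [(isOpen_extChartAt_source (I := 𝓘(ℝ, E)) (1 : L)).mem_nhds hs1] with a ha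
      rw [Function.comp_apply]
      have := adjointMap_chart (e.map_source ha) X
      rwa [← he, e.left_inv ha] at this)
  refine ⟨h1.mdifferentiableAt, fun Z => ?_⟩
  rw [h1.mfderiv, mfderiv_eq_fderiv]
  rfl

/-- An invariant vector field, in the chart at `1`. -/
def chartInvariantField (X : GroupLieAlgebra 𝓘(ℝ, E) L) : E → E :=
  VectorField.mpullbackWithin 𝓘(ℝ, E) 𝓘(ℝ, E) (extChartAt 𝓘(ℝ, E) (1 : L)).symm
    (mulInvariantVectorField X) (Set.range 𝓘(ℝ, E))

theorem lie_eq_lieBracket (Z X : GroupLieAlgebra 𝓘(ℝ, E) L) :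
    (⁅Z, X⁆ : GroupLieAlgebra 𝓘(ℝ, E) L) = VectorField.lieBracket ℝ
      (chartInvariantField Z) (chartInvariantField X) (extChartAt 𝓘(ℝ, E) (1 : L) 1) := by
  rw [GroupLieAlgebra.bracket_def, VectorField.mlieBracket, VectorField.mlieBracketWithin_apply,
    mfderiv_extChartAt_self, Set.preimage_univ, Set.univ_inter, ModelWithCorners.range_eq_univ]
  refine (DFunLike.congr_fun (ContinuousLinearMap.inverse_id (R := ℝ) (M := E)) _).trans ?_
  refine (congrFun (VectorField.lieBracketWithin_univ (𝕜 := ℝ) (E := E)) _).trans ?_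
  rw [chartInvariantField, chartInvariantField, ModelWithCorners.range_eq_univ]

theorem chartInvariantField_eq {y : E} (hy : y ∈ (extChartAt 𝓘(ℝ, E) (1 : L)).target)
    (X : GroupLieAlgebra 𝓘(ℝ, E) L) : chartInvariantField X y =
      fderiv ℝ (chartMul (L := L)) (y, extChartAt 𝓘(ℝ, E) (1 : L) 1) ((0 : E), (X : E)) := by
  have hi := isInvertible_mfderivWithin_extChartAt_symm (I := 𝓘(ℝ, E)) hy
  refine (hi.inverse_apply_eq).2 ?_
  rw [ModelWithCorners.range_eq_univ, mfderivWithin_univ]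
  exact mulInvariantVectorField_chart hy X

/-- In the chart the left-invariant field of X is y ↦ ∂₂m(y,1)X, with value X at 1. Its coordinate
bracket is therefore the antisymmetrized mixed second derivative of m, the same expression as the
derivative of Ad in `fderiv_fderiv_chartConj`. -/
theorem lie_eq_fderiv_fderiv_chartMul [CompleteSpace E] (Z X : E) :
    lieBracketModel L Z X = fderiv ℝ (fderiv ℝ (chartMul (L := L)))
          (extChartAt 𝓘(ℝ, E) (1 : L) 1, extChartAt 𝓘(ℝ, E) (1 : L) 1) (Z, 0) (0, X)
        - fderiv ℝ (fderiv ℝ (chartMul (L := L)))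
          (extChartAt 𝓘(ℝ, E) (1 : L) 1, extChartAt 𝓘(ℝ, E) (1 : L) 1) (X, 0) (0, Z) := by
  set e := extChartAt 𝓘(ℝ, E) (1 : L) with he
  have hs1 : (1 : L) ∈ e.source := mem_extChartAt_source _
  have hl : e.symm (e 1) = 1 := e.left_inv hs1
  have ht1 := e.map_source hs1
  have hm : ContDiffAt ℝ ∞ (chartMul (L := L)) (e 1, e 1) :=
    contDiffAt_chartMul ht1 ht1 (by rw [hl, one_mul]; exact hs1)
  have hD : HasFDerivAt (fderiv ℝ (chartMul (L := L)))
      (fderiv ℝ (fderiv ℝ (chartMul (L := L))) (e 1, e 1)) (e 1, e 1) :=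
    ((hm.fderiv_right (m := 1) (by norm_num; exact ENat.LEInfty.out)).differentiableAt
      (by norm_num)).hasFDerivAt
  have hV : ∀ X : E, chartInvariantField (L := L) X =ᶠ[𝓝 (e 1)]
      fun y => fderiv ℝ (chartMul (L := L)) (y, e 1) (0, X) := by
    intro X
    filter_upwards [extChartAt_target_mem_nhds' (I := 𝓘(ℝ, E)) ht1] with y hy
    exact chartInvariantField_eq hy X
  have hd : ∀ X : E, HasFDerivAt (fun y => fderiv ℝ (chartMul (L := L)) (y, e 1) (0, X)) _ (e 1) :=
    fun X => (HasFDerivAt.comp (f := fun y => (y, e 1)) (e 1) hD (hasFDerivAt_prodMk_left (e 1) (e 1))).clm_apply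
      (hasFDerivAt_const ((0 : E), (X : E)) (e 1))
  have h1 : lieBracketModel L Z X = fderiv ℝ (chartInvariantField (L := L) X) (e 1)
      (chartInvariantField (L := L) Z (e 1)) - fderiv ℝ (chartInvariantField (L := L) Z) (e 1)
      (chartInvariantField (L := L) X (e 1)) := lie_eq_lieBracket (L := L) Z X
  rw [h1, (hV X).fderiv_eq, (hV Z).fderiv_eq, (hV X).self_of_nhds,
    (hV Z).self_of_nhds, (hd X).fderiv, (hd Z).fderiv]
  have h2 := fun w : E => fderiv_chartMul_self (L := L) 0 w
  rw [← he] at h2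
  simp [h2]

/-- The derivative of the adjoint representation is the Lie bracket. -/
theorem mfderiv_adjointMap [CompleteSpace E] (X Z : E) :
    (mfderiv 𝓘(ℝ, E) 𝓘(ℝ, E) (fun a : L => (adjointMap E a X : E)) 1 Z : E) = lieBracketModel L Z X := by
  rw [(mdifferentiableAt_adjointMap X).2, fderiv_fderiv_chartConj, lie_eq_fderiv_fderiv_chartMul]

end Adjoint

/-! ### Geodesics of invariant metrics -/

section Velocity

set_option linter.unusedSectionVars false

variable {F : Type*} [NormedAddCommGroup F] [NormedSpace ℝ F]
  {M : Type*} [TopologicalSpace M] [ChartedSpace F M]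

variable (F) in
/-- The velocity of a curve, as a vector of the model space. -/
def velocity (γ : ℝ → M) (t : ℝ) : F := mfderiv 𝓘(ℝ, ℝ) 𝓘(ℝ, F) γ t (1 : ℝ)

/-- The inner product at a point, on the model space. -/
def innerAt [IsManifold 𝓘(ℝ, F) ∞ M] (g : SmoothMetric F M) (x : M) : F →L[ℝ] F →L[ℝ] ℝ :=
  g.inner x

theorem innerAt_symm [IsManifold 𝓘(ℝ, F) ∞ M] (g : SmoothMetric F M) (x : M) (v w : F) :
    innerAt g x v w = innerAt g x w v := g.symm x v w

theorem innerAt_pos [IsManifold 𝓘(ℝ, F) ∞ M] (g : SmoothMetric F M) (x : M) {v : F}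
    (hv : v ≠ 0) : 0 < innerAt g x v v := g.pos x v hv

theorem velocity_congr {γ₁ γ₂ : ℝ → M} {t : ℝ} (h : γ₁ =ᶠ[𝓝 t] γ₂) :
    velocity F γ₁ t = velocity F γ₂ t := by
  have h1 : (mfderiv 𝓘(ℝ, ℝ) 𝓘(ℝ, F) γ₁ t : ℝ →L[ℝ] F) = mfderiv 𝓘(ℝ, ℝ) 𝓘(ℝ, F) γ₂ t :=
    h.mfderiv_eq
  exact DFunLike.congr_fun h1 1

theorem velocity_comp_add {γ : ℝ → M} {t c : ℝ}
    (h : MDifferentiableAt 𝓘(ℝ, ℝ) 𝓘(ℝ, F) γ (t + c)) :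
    MDifferentiableAt 𝓘(ℝ, ℝ) 𝓘(ℝ, F) (fun s => γ (s + c)) t ∧
    velocity F (fun s => γ (s + c)) t = velocity F γ (t + c) := by
  have h1 : HasMFDerivAt 𝓘(ℝ, ℝ) 𝓘(ℝ, ℝ) (fun s : ℝ => s + c) t (ContinuousLinearMap.id ℝ ℝ) :=
    ((hasFDerivAt_id t).add_const c).hasMFDerivAt
  have h2 := HasMFDerivAt.comp t h.hasMFDerivAt h1
  refine ⟨h2.mdifferentiableAt, ?_⟩
  have h3 : (mfderiv 𝓘(ℝ, ℝ) 𝓘(ℝ, F) (fun s => γ (s + c)) t : ℝ →L[ℝ] F) = _ := h2.mfderiv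
  rw [velocity, h3]
  rfl

end Velocity

/-! ### Equivariance of fundamental vector fields -/

section Equivariance

set_option linter.unusedSectionVars false

variable {E : Type*} [NormedAddCommGroup E] [NormedSpace ℝ E]
  {L : Type*} [TopologicalSpace L] [ChartedSpace E L] [Group L]
  {F : Type*} [NormedAddCommGroup F] [NormedSpace ℝ F]
  {M : Type*} [TopologicalSpace M] [ChartedSpace F M] [MulAction L M]

variable (E L F) in
/-- The value at `x` of the fundamental vector fields, on the model spaces. -/
def actVec (x : M) : E →L[ℝ] F := fundVec (E := E) (L := L) (F := F) x

variable (F) in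
/-- The differential at `x` of the action of `a`, on the model space. -/
def actDiff (a : L) (x : M) : F →L[ℝ] F :=
  mfderiv 𝓘(ℝ, F) 𝓘(ℝ, F) (fun y : M => a • y) x

variable [IsManifold 𝓘(ℝ, F) ∞ M]

theorem isInvariantMetric_iff {g : SmoothMetric F M} : IsInvariantMetric L g ↔
    ∀ (a : L) (x : M) (v w : F), innerAt g (a • x) (actDiff F a x v) (actDiff F a x w)
      = innerAt g x v w := Iff.rfl

variable [ContMDiffSMul 𝓘(ℝ, E) 𝓘(ℝ, F) ∞ L M]

theorem actDiff_comp {W : Type*} [NormedAddCommGroup W] [NormedSpace ℝ W] {N : Type*}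
    [TopologicalSpace N] [ChartedSpace W N] (E : Type*) [NormedAddCommGroup E] [NormedSpace ℝ E]
    [ChartedSpace E L] [ContMDiffSMul 𝓘(ℝ, E) 𝓘(ℝ, F) ∞ L M] {f : N → M} {z : N}
    (hf : MDifferentiableAt 𝓘(ℝ, W) 𝓘(ℝ, F) f z) (a : L) (w : W) :
    (mfderiv 𝓘(ℝ, W) 𝓘(ℝ, F) (fun y => a • f y) z w : F)
      = actDiff F a (f z) (mfderiv 𝓘(ℝ, W) 𝓘(ℝ, F) f z w) := by
  have h1 : MDifferentiableAt 𝓘(ℝ, F) 𝓘(ℝ, F) (fun y : M => a • y) (f z) :=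
    (contMDiff_const_smul' E a).mdifferentiableAt (by simp)
  have h2 := (h1.hasMFDerivAt.comp z hf.hasMFDerivAt).mfderiv
  exact DFunLike.congr_fun h2 w

theorem velocity_smul (E : Type*) [NormedAddCommGroup E] [NormedSpace ℝ E]
    [ChartedSpace E L] [ContMDiffSMul 𝓘(ℝ, E) 𝓘(ℝ, F) ∞ L M] {γ : ℝ → M} {t : ℝ}
    (h : MDifferentiableAt 𝓘(ℝ, ℝ) 𝓘(ℝ, F) γ t) (a : L) :
    velocity F (fun s => a • γ s) t = actDiff F a (γ t) (velocity F γ t) :=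
  actDiff_comp E h a (1 : ℝ)

theorem actDiff_mul (E : Type*) [NormedAddCommGroup E] [NormedSpace ℝ E]
    [ChartedSpace E L] [ContMDiffSMul 𝓘(ℝ, E) 𝓘(ℝ, F) ∞ L M] (a c : L) (x : M) (v : F) :
    actDiff F (a * c) x v = actDiff F a (c • x) (actDiff F c x v) := by
  have h1 : MDifferentiableAt 𝓘(ℝ, F) 𝓘(ℝ, F) (fun y : M => c • y) x :=
    (contMDiff_const_smul' E c).mdifferentiableAt (by simp)
  have h2 := actDiff_comp E h1 a v
  have h3 : (fun y : M => (a * c) • y) = fun y => a • c • y := by funext y; rw [mul_smul]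
  rw [actDiff, h3]
  exact h2

theorem actDiff_one (x : M) (v : F) : actDiff F (1 : L) x v = v := by
  have h3 : (fun y : M => (1 : L) • y) = id := by funext y; simp
  have h4 : (mfderiv 𝓘(ℝ, F) 𝓘(ℝ, F) (fun y : M => (1 : L) • y) x : F →L[ℝ] F)
      = ContinuousLinearMap.id ℝ F := by rw [h3]; exact mfderiv_id
  exact DFunLike.congr_fun h4 v

theorem actDiff_inv_apply (E : Type*) [NormedAddCommGroup E] [NormedSpace ℝ E]
    [ChartedSpace E L] [ContMDiffSMul 𝓘(ℝ, E) 𝓘(ℝ, F) ∞ L M] (a : L) (x : M) (v : F) :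
    actDiff F a⁻¹ (a • x) (actDiff F a x v) = v := by
  rw [← actDiff_mul E, inv_mul_cancel, actDiff_one]

theorem actDiff_apply_inv (E : Type*) [NormedAddCommGroup E] [NormedSpace ℝ E]
    [ChartedSpace E L] [ContMDiffSMul 𝓘(ℝ, E) 𝓘(ℝ, F) ∞ L M] (a : L) (x : M) (v : F) :
    actDiff F a x (actDiff F a⁻¹ (a • x) v) = v := by
  have h := actDiff_mul (F := F) E a a⁻¹ (a • x) v
  rw [mul_inv_cancel, actDiff_one, inv_smul_smul] at h
  exact h.symm

variable [LieGroup 𝓘(ℝ, E) ∞ L]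

/-- Differentiate a(cx) = (aca⁻¹)(ax) in c at 1. -/
theorem actDiff_actVec (a : L) (x : M) (Y : E) :
    actDiff F a x (actVec E L F x Y) = actVec E L F (a • x) (adjointMap E a Y) := by
  have h1 : MDifferentiableAt 𝓘(ℝ, E) 𝓘(ℝ, F) (fun c : L => c • x) 1 :=
    (contMDiff_smul_const x).mdifferentiableAt (by simp)
  have h2 := actDiff_comp E h1 a Y
  have h3 : (fun c : L => a • c • x) = (fun c : L => c • (a • x)) ∘ fun c => a * c * a⁻¹ := by
    funext c; simp [mul_smul]
  have h4 : MDifferentiableAt 𝓘(ℝ, E) 𝓘(ℝ, F) (fun c : L => c • a • x) (a * 1 * a⁻¹) :=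
    (contMDiff_smul_const (a • x)).mdifferentiableAt (by simp)
  have h5 := (h4.hasMFDerivAt.comp (1 : L)
    ((contMDiff_conj (E := E) a).mdifferentiableAt (by simp)).hasMFDerivAt).mfderiv
  rw [← h3] at h5
  have h6 : (mfderiv 𝓘(ℝ, E) 𝓘(ℝ, F) (fun c : L => a • c • x) 1 Y : F) = _ :=
    DFunLike.congr_fun h5 Y
  have key : ∀ d : L, d = 1 → ∀ v : E,
      (mfderiv 𝓘(ℝ, E) 𝓘(ℝ, F) (fun c : L => c • a • x) d v : F)
        = actVec E L F (a • x) v := by rintro _ rfl v; rfl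
  have key2 : ∀ x' : M, x' = x → ∀ v : F, actDiff F a x' v = actDiff F a x v := by
    rintro _ rfl v; rfl
  refine (key2 _ (one_smul L x) _).symm.trans (h2.symm.trans (h6.trans ?_))
  exact key _ (by simp) _

end Equivariance

/-! ### Momentum along orbits of one-parameter subgroups -/

section OneParameterAction

set_option linter.unusedSectionVars false

variable {E : Type*} [NormedAddCommGroup E] [NormedSpace ℝ E]
  {L : Type*} [TopologicalSpace L] [ChartedSpace E L] [Group L] [LieGroup 𝓘(ℝ, E) ∞ L]
  {F : Type*} [NormedAddCommGroup F] [NormedSpace ℝ F]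
  {M : Type*} [TopologicalSpace M] [ChartedSpace F M] [MulAction L M]
  [IsManifold 𝓘(ℝ, F) ∞ M] [ContMDiffSMul 𝓘(ℝ, E) 𝓘(ℝ, F) ∞ L M]

/-- At time 0 this is `mfderiv_adjointMap`; other times follow from Ad(φ(s)) = Ad(φ(s - t))Ad(φ(t)).
-/
theorem hasDerivAt_adjointMap [CompleteSpace E] {φ : ℝ → L} (hφ : IsOneParameterSubgroup E φ)
    (Y : E) (t : ℝ) : HasDerivAt (fun s => adjointMap E (φ s) Y)
      (lieBracketModel L (velocity E φ 0) (adjointMap E (φ t) Y)) t := by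
  have h0 : ∀ Z : E, HasDerivAt (fun s => adjointMap E (φ s) Z)
      (lieBracketModel L (velocity E φ 0) Z) 0 := by
    intro Z
    have h1 := (mdifferentiableAt_adjointMap (L := L) Z).1
    rw [← map_zero_of_add hφ.2] at h1
    have h2 := HasMFDerivAt.comp (0 : ℝ) h1.hasMFDerivAt
      (hφ.1.mdifferentiableAt (by simp)).hasMFDerivAt
    have h3 := (show HasFDerivAt (𝕜 := ℝ) (E := ℝ) (F := E)
      (fun s => adjointMap E (φ s) Z) _ 0 from hasMFDerivAt_iff_hasFDerivAt.1 h2).hasDerivAt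
    refine h3.congr_deriv ?_
    have key : ∀ d : L, d = 1 → ∀ v : E,
      (mfderiv 𝓘(ℝ, E) 𝓘(ℝ, E) (fun a : L => (adjointMap E a Z : E)) d v : E)
        = lieBracketModel L v Z := by rintro _ rfl v; exact mfderiv_adjointMap Z v
    exact key _ (map_zero_of_add hφ.2) _
  have h4 := HasDerivAt.comp_sub_const t t
    (f := fun s => adjointMap E (φ s) (adjointMap E (φ t) Y)) (by simpa using h0 (adjointMap E (φ t) Y))
  refine h4.congr_of_eventuallyEq (Filter.Eventually.of_forall fun s => ?_)
  simp only
  rw [← adjointMap_mul, ← hφ.2, sub_add_cancel]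

theorem velocity_smul_zero {φ : ℝ → L} (hφ : IsOneParameterSubgroup E φ) (x : M) :
    velocity F (fun s => φ s • x) 0 = actVec E L F x (velocity E φ 0) :=
  (mfderiv_smul_curve (hφ.1.mdifferentiableAt (by simp)) (map_zero_of_add hφ.2) rfl x).symm

theorem contMDiff_orbit {φ : ℝ → L} (hφ : IsOneParameterSubgroup E φ) (x : M) :
    ContMDiff 𝓘(ℝ, ℝ) 𝓘(ℝ, F) ∞ (fun s => φ s • x) :=
  (contMDiff_smul_const x).comp hφ.1

theorem velocity_orbit {φ : ℝ → L} (hφ : IsOneParameterSubgroup E φ) (x : M) (t : ℝ) :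
    velocity F (fun s => φ s • x) t = actDiff F (φ t) x (actVec E L F x (velocity E φ 0)) := by
  have h1 := velocity_comp_add (F := F) (γ := fun s => φ s • x) (t := 0) (c := t)
    ((contMDiff_orbit hφ x).mdifferentiableAt (by simp))
  rw [zero_add] at h1
  rw [← h1.2]
  have h2 : (fun s => φ (s + t) • x) = fun s => φ t • φ s • x := by
    funext s; rw [add_comm, hφ.2, mul_smul]
  rw [h2, velocity_smul (F := F) E ((contMDiff_orbit hφ x).mdifferentiableAt (by simp)),
    velocity_smul_zero hφ, map_zero_of_add hφ.2, one_smul]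

/-- The momentum of a curve. -/
def momentum (g : SmoothMetric F M) (γ : ℝ → M) (X : E) (s : ℝ) : ℝ :=
  innerAt g (γ s) (velocity F γ s) (actVec E L F (γ s) X)

variable {g : SmoothMetric F M}

/-- Transporting the inner product from φ(t)x back to x by the isometry φ(-t) fixes the velocity and
turns Y into Ad(φ(-t))Y. Conservation of momentum becomes a statement at the single point x. -/
theorem momentum_orbit (hg : IsInvariantMetric L g) {φ : ℝ → L} (hφ : IsOneParameterSubgroup E φ)
    (x : M) (Y : E) (t : ℝ) : momentum (L := L) g (fun s => φ s • x) Y t =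
      innerAt g x (actVec E L F x (velocity E φ 0))
        (actVec E L F x (adjointMap E (φ (-t)) Y)) := by
  rw [momentum, velocity_orbit hφ, ← adjointMap_apply_inv (φ t) Y, ← actDiff_actVec,
    isInvariantMetric_iff.1 hg, map_neg_of_add hφ.2, adjointMap_apply_inv]

theorem hasDerivAt_momentum_orbit [CompleteSpace E] (hg : IsInvariantMetric L g) {φ : ℝ → L}
    (hφ : IsOneParameterSubgroup E φ) (x : M) (Y : E) (t : ℝ) :
    HasDerivAt (momentum (L := L) g (fun s => φ s • x) Y)
      (-innerAt g x (actVec E L F x (velocity E φ 0)) (actVec E L F x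
        (lieBracketModel L (velocity E φ 0) (adjointMap E (φ (-t)) Y)))) t := by
  have h1 := (hasDerivAt_adjointMap hφ Y (-t)).scomp t (hasDerivAt_neg t)
  have h2 := ((innerAt g x (actVec E L F x (velocity E φ 0))).comp
    (actVec E L F x)).hasFDerivAt.comp_hasDerivAt t h1
  have h3 : momentum (L := L) g (fun s => φ s • x) Y = fun t =>
      innerAt g x (actVec E L F x (velocity E φ 0))
        (actVec E L F x (adjointMap E (φ (-t)) Y)) := funext (momentum_orbit hg hφ x Y)
  rw [h3]
  refine h2.congr_deriv ?_
  simp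

end OneParameterAction

/-! ### Conserved momenta, geodesic vectors and the GO property -/

section GeodesicVectors

set_option linter.unusedSectionVars false

variable {E : Type*} [NormedAddCommGroup E] [NormedSpace ℝ E] [CompleteSpace E]
  {L : Type*} [TopologicalSpace L] [ChartedSpace E L] [Group L] [LieGroup 𝓘(ℝ, E) ∞ L] [T2Space L]
  {F : Type*} [NormedAddCommGroup F] [NormedSpace ℝ F] [FiniteDimensional ℝ F]
  {M : Type*} [TopologicalSpace M] [ChartedSpace F M] [MulAction L M]
  [IsManifold 𝓘(ℝ, F) ∞ M] [ContMDiffSMul 𝓘(ℝ, E) 𝓘(ℝ, F) ∞ L M]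
  {g : SmoothMetric F M}

/-- Noether's theorem for an arbitrary X, since each X generates a one-parameter subgroup. -/
theorem hasDerivAt_momentum_chart (hg : IsInvariantMetric L g) {γ : ℝ → M} {J : Set ℝ}
    (hJ : IsOpen J) (hγ : ContMDiffOn 𝓘(ℝ, ℝ) 𝓘(ℝ, F) ∞ γ J) {t : ℝ} (ht : t ∈ J) {x₀ : M}
    (hx : γ t ∈ (extChartAt 𝓘(ℝ, F) x₀).source) {X : E} {w : F}
    (hw : chartFrame x₀ (extChartAt 𝓘(ℝ, F) x₀ (γ t)) w = actVec E L F (γ t) X) :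
    HasDerivAt (momentum (L := L) g γ X)
      (metricCoeff g x₀ (extChartAt 𝓘(ℝ, F) x₀ (γ t))
            (deriv (deriv fun s => extChartAt 𝓘(ℝ, F) x₀ (γ s)) t) w
          + christoffelFirst g x₀ (extChartAt 𝓘(ℝ, F) x₀ (γ t))
            (deriv (fun s => extChartAt 𝓘(ℝ, F) x₀ (γ s)) t)
            (deriv (fun s => extChartAt 𝓘(ℝ, F) x₀ (γ s)) t) w) t := by
  obtain ⟨α, hα, hX⟩ := exists_isOneParameterSubgroup (L := L) X
  refine hg.hasDerivAt_inner_fundVec ?_ hx hα.1 (map_zero_of_add hα.2) hX hw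
  filter_upwards [hJ.mem_nhds ht] with s hs
  exact hγ.contMDiffAt (hJ.mem_nhds hs)

theorem IsGeodesicOn.hasDerivAt_momentum (hg : IsInvariantMetric L g) {γ : ℝ → M} {J : Set ℝ}
    (hJ : IsOpen J) (hγ : IsGeodesicOn g γ J) (X : E) {t : ℝ} (ht : t ∈ J) :
    HasDerivAt (momentum (L := L) g γ X) 0 t := by
  have hx : γ t ∈ (extChartAt 𝓘(ℝ, F) (γ t)).source := mem_extChartAt_source _
  obtain ⟨w, hw⟩ := chartFrame_surjective ((extChartAt 𝓘(ℝ, F) (γ t)).map_source hx)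
    (actVec E L F (γ t) X)
  have h := hasDerivAt_momentum_chart hg hJ hγ.1 ht hx hw
  rwa [hγ.2 _ t ht hx w] at h

/-- A curve is a geodesic of an invariant metric on a homogeneous space if and only if its momentum
is conserved. -/
theorem isGeodesicOn_of_momentum (hg : IsInvariantMetric L g)
    (hsurj : ∀ x : M, Function.Surjective (actVec E L F x)) {γ : ℝ → M} {J : Set ℝ}
    (hJ : IsOpen J) (hγ : ContMDiffOn 𝓘(ℝ, ℝ) 𝓘(ℝ, F) ∞ γ J)
    (h : ∀ X : E, ∀ t ∈ J, HasDerivAt (momentum (L := L) g γ X) 0 t) : IsGeodesicOn g γ J := by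
  refine ⟨hγ, fun x₀ t ht hx w => ?_⟩
  obtain ⟨X, hX⟩ := hsurj (γ t) (chartFrame x₀ (extChartAt 𝓘(ℝ, F) x₀ (γ t)) w)
  exact (hasDerivAt_momentum_chart hg hJ hγ ht hx hX.symm).unique (h X t ht)

/-- The chart solution satisfies the equation in one chart only. There it yields conserved momenta,
and these, being independent of charts, give the equation in every chart. -/
theorem exists_local_geodesic (hg : IsInvariantMetric L g)
    (hsurj : ∀ x : M, Function.Surjective (actVec E L F x)) (p : M) (v : F) :
    ∃ ε > 0, ∃ γ : ℝ → M, γ 0 = p ∧ velocity F γ 0 = v ∧ IsGeodesicOn g γ (Set.Ioo (-ε) ε) := by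
  obtain ⟨ε, hε, γ, h0, hv, hs, h⟩ := exists_local_geodesic_chart g p v
  refine ⟨ε, hε, γ, h0, hv, isGeodesicOn_of_momentum hg hsurj isOpen_Ioo hs fun X t ht => ?_⟩
  obtain ⟨hx, heq⟩ := h t ht
  obtain ⟨w, hw⟩ := chartFrame_surjective ((extChartAt 𝓘(ℝ, F) p).map_source hx)
    (actVec E L F (γ t) X)
  have h := hasDerivAt_momentum_chart hg isOpen_Ioo hs ht hx hw
  rwa [heq w] at h

/-- The momentum of aγ along X is that of γ along Ad(a⁻¹)X. -/
theorem IsGeodesicOn.smul (hg : IsInvariantMetric L g)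
    (hsurj : ∀ x : M, Function.Surjective (actVec E L F x)) {γ : ℝ → M} {J : Set ℝ}
    (hJ : IsOpen J) (hγ : IsGeodesicOn g γ J) (a : L) : IsGeodesicOn g (fun s => a • γ s) J := by
  refine isGeodesicOn_of_momentum hg hsurj hJ
    ((contMDiff_const_smul' E a).comp_contMDiffOn hγ.1) fun X t ht => ?_
  refine (hγ.hasDerivAt_momentum hg hJ (adjointMap E a⁻¹ X) ht).congr_of_eventuallyEq ?_
  filter_upwards [hJ.mem_nhds ht] with s hs
  rw [momentum, momentum, velocity_smul E ((hγ.1.contMDiffAt (hJ.mem_nhds hs)).mdifferentiableAt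
    (by simp)), ← isInvariantMetric_iff.1 hg a (γ s), actDiff_actVec, adjointMap_apply_inv]

theorem IsGeodesicOn.comp_add (hg : IsInvariantMetric L g)
    (hsurj : ∀ x : M, Function.Surjective (actVec E L F x)) {γ : ℝ → M} {J : Set ℝ}
    (hJ : IsOpen J) (hγ : IsGeodesicOn g γ J) (c : ℝ) :
    IsGeodesicOn g (fun s => γ (s + c)) ((fun s => s + c) ⁻¹' J) := by
  have hJ' : IsOpen ((fun s : ℝ => s + c) ⁻¹' J) := hJ.preimage (by fun_prop)
  have hsm : ContMDiff 𝓘(ℝ, ℝ) 𝓘(ℝ, ℝ) ∞ (fun s : ℝ => s + c) :=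
    (contDiff_id.add contDiff_const).contMDiff
  refine isGeodesicOn_of_momentum hg hsurj hJ' (hγ.1.comp hsm.contMDiffOn subset_rfl)
    fun X t ht => ?_
  have h1 := HasDerivAt.comp_add_const t c (hγ.hasDerivAt_momentum hg hJ X ht)
  refine h1.congr_of_eventuallyEq ?_
  filter_upwards [hJ'.mem_nhds ht] with s hs
  rw [momentum, momentum, (velocity_comp_add ((hγ.1.contMDiffAt
    (hJ.mem_nhds hs)).mdifferentiableAt (by simp))).2]

variable (L) in
/-- Geodesic vectors at `o`: the initial velocities of the one-parameter subgroups whose orbit of `o`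
is a geodesic. -/
def IsGeodesicVector (g : SmoothMetric F M) (o : M) (X : E) : Prop :=
  ∀ Y : E, innerAt g o (actVec E L F o X) (actVec E L F o (lieBracketModel L X Y)) = 0

/-- The derivative of the momentum along X is the defining expression of a geodesic vector, up to
sign, evaluated at Ad(φ(-t))X. The condition at o thus suffices for all times. -/
theorem IsGeodesicVector.isGeodesicOn (hg : IsInvariantMetric L g)
    (hsurj : ∀ x : M, Function.Surjective (actVec E L F x)) {o : M} {φ : ℝ → L}
    (hφ : IsOneParameterSubgroup E φ) (h : IsGeodesicVector L g o (velocity E φ 0)) :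
    IsGeodesicOn g (fun s => φ s • o) Set.univ := by
  refine isGeodesicOn_of_momentum hg hsurj isOpen_univ (contMDiff_orbit hφ o).contMDiffOn
    fun X t _ => ?_
  have h1 := hasDerivAt_momentum_orbit hg hφ o X t
  rwa [h, neg_zero] at h1

/-- Take a local geodesic with velocity v. The GO property makes it an orbit, and its generator is a
geodesic vector because the derivative of the momentum at time 0 vanishes. -/
theorem IsGOMetric.exists_isGeodesicVector (hg : IsGOMetric E L g)
    (hsurj : ∀ x : M, Function.Surjective (actVec E L F x)) (o : M) (v : F) :
    ∃ X : E, IsGeodesicVector L g o X ∧ actVec E L F o X = v := by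
  obtain ⟨ε, hε, γ, h0, hv, hγ⟩ := exists_local_geodesic hg.1 hsurj o v
  obtain ⟨φ, x, hφ, hx⟩ := hg.2 γ _ isOpen_Ioo Set.ordConnected_Ioo hγ
  have h0m : (0 : ℝ) ∈ Set.Ioo (-ε) ε := ⟨by linarith, hε⟩
  have hxo : x = o := by
    have := hx 0 h0m
    rw [map_zero_of_add hφ.2, one_smul, h0] at this
    exact this.symm
  subst hxo
  have hev : γ =ᶠ[𝓝 0] fun s => φ s • x := by
    filter_upwards [isOpen_Ioo.mem_nhds h0m] with s hs
    exact hx s hs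
  refine ⟨velocity E φ 0, fun Y => ?_, ?_⟩
  · have h1 := hγ.hasDerivAt_momentum hg.1 isOpen_Ioo Y h0m
    have h2 := hasDerivAt_momentum_orbit hg.1 hφ x Y 0
    have h3 := h1.congr_of_eventuallyEq (f₁ := momentum (L := L) g (fun s => φ s • x) Y) (by
      filter_upwards [hev.eventuallyEq_nhds] with s hs
      rw [momentum, momentum, velocity_congr hs, hs.self_of_nhds])
    have h4 := h3.unique h2
    rw [neg_zero, map_zero_of_add hφ.2, adjointMap_one] at h4
    linarith
  · rw [← velocity_smul_zero hφ, ← velocity_congr hev, hv]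

/-- Move the initial point to o, take a geodesic vector in S over the initial velocity, and apply
uniqueness. The set S lets the generator be chosen with an extra property: for orbits of K it will
also be a geodesic vector of G. -/
theorem exists_orbit_of_isGeodesicOn [T2Space M] (hg : IsInvariantMetric L g)
    (hsurj : ∀ x : M, Function.Surjective (actVec E L F x)) {o : M}
    (htrans : ∀ x : M, ∃ a : L, a • o = x) {S : Set E} (hS : ∀ X ∈ S, IsGeodesicVector L g o X)
    (hSs : ∀ v : F, ∃ X ∈ S, actVec E L F o X = v) {γ : ℝ → M} {J : Set ℝ} (hJ : IsOpen J)
    (hJc : J.OrdConnected) (hγ : IsGeodesicOn g γ J) {t₀ : ℝ} (ht₀ : t₀ ∈ J) :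
    ∃ (a : L) (φ : ℝ → L), IsOneParameterSubgroup E φ ∧ velocity E φ 0 ∈ S ∧
      ∀ t ∈ J, γ t = a • φ (t - t₀) • o := by
  obtain ⟨a, ha⟩ := htrans (γ t₀)
  obtain ⟨X, hXS, hX⟩ := hSs (actDiff F a⁻¹ (a • o) (velocity F γ t₀))
  obtain ⟨φ, hφ, hXφ⟩ := exists_isOneParameterSubgroup (L := L) X
  have hXφ' : X = velocity E φ 0 := hXφ
  refine ⟨a, φ, hφ, hXφ' ▸ hXS, ?_⟩
  have h1 : IsGeodesicOn g (fun s => φ s • o) Set.univ :=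
    IsGeodesicVector.isGeodesicOn hg hsurj hφ (hXφ' ▸ hS X hXS)
  have h2 := h1.comp_add hg hsurj isOpen_univ (-t₀)
  have h3 := h2.smul hg hsurj isOpen_univ a
  have hd : MDifferentiableAt 𝓘(ℝ, ℝ) 𝓘(ℝ, F) (fun s => φ s • o) (t₀ + -t₀) :=
    (contMDiff_orbit hφ o).mdifferentiableAt (by simp)
  have hzero : φ (t₀ + -t₀) = 1 := by rw [add_neg_cancel, map_zero_of_add hφ.2]
  have h4 := hγ.eqOn (h3.mono (Set.subset_univ J)) hJ hJc ht₀
    (by rw [hzero, one_smul, ha]) (by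
      change velocity F γ t₀ = velocity F (fun s => a • φ (s + -t₀) • o) t₀
      rw [velocity_smul E (velocity_comp_add hd).1, (velocity_comp_add hd).2, hzero, one_smul,
        add_neg_cancel, velocity_smul_zero hφ, ← hXφ', hX, actDiff_apply_inv E])
  intro t ht
  rw [h4 ht, sub_eq_add_neg]

theorem isGOMetric_of_isGeodesicVector [T2Space M] (hg : IsInvariantMetric L g)
    (hsurj : ∀ x : M, Function.Surjective (actVec E L F x)) {o : M}
    (htrans : ∀ x : M, ∃ a : L, a • o = x)
    (hS : ∀ v : F, ∃ X : E, IsGeodesicVector L g o X ∧ actVec E L F o X = v) :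
    IsGOMetric E L g := by
  refine ⟨hg, fun γ J hJ hJc hγ => ?_⟩
  rcases J.eq_empty_or_nonempty with rfl | ⟨t₀, ht₀⟩
  · exact ⟨fun _ => 1, o, ⟨contMDiff_const, by simp⟩, by simp⟩
  obtain ⟨a, φ, hφ, -, h⟩ := exists_orbit_of_isGeodesicOn hg hsurj htrans
    (S := {X | IsGeodesicVector L g o X}) (fun X hX => hX) hS hJ hJc hγ ht₀
  -- From aφ(t - t₀)o = (aφ(t)a⁻¹)(aφ(-t₀)o).
  refine ⟨fun s => a * φ s * a⁻¹, a • φ (-t₀) • o, ⟨?_, fun s t => ?_⟩, fun t ht => ?_⟩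
  · exact (contMDiff_conj a).comp hφ.1
  · simp only [hφ.2]; group
  · rw [h t ht, sub_eq_add_neg, hφ.2]
    simp only [mul_smul, inv_smul_smul]

theorem actVec_surjective_of_transitive {o : M} (htrans : ∀ x : M, ∃ a : L, a • o = x)
    (ho : Function.Surjective (actVec E L F o)) (x : M) :
    Function.Surjective (actVec E L F x) := by
  obtain ⟨a, rfl⟩ := htrans x
  intro v
  obtain ⟨Y, hY⟩ := ho (actDiff F a⁻¹ (a • o) v)
  exact ⟨adjointMap E a Y, by rw [← actDiff_actVec, hY, actDiff_apply_inv E]⟩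

end GeodesicVectors

/-! ### Submersions, immersions and locally constant maps -/

section LocalInverses

set_option linter.unusedSectionVars false

variable {E : Type*} [NormedAddCommGroup E] [NormedSpace ℝ E] [FiniteDimensional ℝ E]
  {F : Type*} [NormedAddCommGroup F] [NormedSpace ℝ F] [FiniteDimensional ℝ F]

theorem ContDiffAt.exists_local_inverse {f : E → E} {x : E} (hf : ContDiffAt ℝ ∞ f x)
    (hd : HasFDerivAt f (ContinuousLinearMap.id ℝ E) x) :
    ∃ h : E → E, ContDiffAt ℝ ∞ h (f x) ∧ h (f x) = x ∧ (∀ᶠ y in 𝓝 (f x), f (h y) = y) ∧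
      ∀ᶠ y in 𝓝 x, h (f y) = y := by
  have hd' : HasFDerivAt f ((ContinuousLinearEquiv.refl ℝ E : E ≃L[ℝ] E) : E →L[ℝ] E) x := hd
  have hs := hf.hasStrictFDerivAt' hd' (by simp)
  exact ⟨hf.localInverse hd' (by simp), hf.to_localInverse hd' (by simp),
    hf.localInverse_apply_image hd' (by simp), hs.eventually_right_inverse,
    hs.eventually_left_inverse⟩

/-- Precomposing f with a linear right inverse of its derivative gives a self-map with identity
derivative, which is locally invertible. -/
theorem ContDiffAt.exists_local_section {f : E → F} {x : E} (hf : ContDiffAt ℝ ∞ f x)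
    (hd : Function.Surjective (fderiv ℝ f x)) :
    ∃ s : F → E, ContDiffAt ℝ ∞ s (f x) ∧ s (f x) = x ∧ ∀ᶠ y in 𝓝 (f x), f (s y) = y := by
  obtain ⟨R, hR⟩ := (fderiv ℝ f x).toLinearMap.exists_rightInverse_of_surjective
    (LinearMap.range_eq_top.2 hd)
  let R' : F →L[ℝ] E := LinearMap.toContinuousLinearMap R
  have hR' : ∀ v, fderiv ℝ f x (R' v) = v := fun v => DFunLike.congr_fun hR v
  have hl : ContDiffAt ℝ ∞ (fun y => x + R' (y - f x)) (f x) :=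
    contDiffAt_const.add (R'.contDiff.contDiffAt.comp _ (contDiffAt_id.sub contDiffAt_const))
  have hx : x + R' (f x - f x) = x := by simp
  have hfx : ContDiffAt ℝ ∞ f (x + R' (f x - f x)) := by rw [hx]; exact hf
  have hk : ContDiffAt ℝ ∞ (fun y => f (x + R' (y - f x))) (f x) :=
    ContDiffAt.comp (g := f) (f x) hfx hl
  have hld : HasFDerivAt (fun y => x + R' (y - f x)) R' (f x) := by
    have := (R'.hasFDerivAt.comp (f x) ((hasFDerivAt_id (f x)).sub_const (f x))).const_add x
    simpa [Function.comp_def] using this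
  have hkd : HasFDerivAt (fun y => f (x + R' (y - f x))) (ContinuousLinearMap.id ℝ F) (f x) := by
    have h1 : HasFDerivAt f (fderiv ℝ f x) (x + R' (f x - f x)) := by
      rw [hx]; exact (hf.differentiableAt (by simp)).hasFDerivAt
    have h2 := HasFDerivAt.comp (g := f) (f x) h1 hld
    refine h2.congr_fderiv ?_
    ext v
    exact hR' v
  obtain ⟨h, hh, hh0, hr, -⟩ := hk.exists_local_inverse hkd
  simp only [hx] at hh hh0 hr
  refine ⟨fun y => x + R' (h y - f x), ?_, ?_, hr⟩
  · exact contDiffAt_const.add (R'.contDiff.contDiffAt.comp _ (hh.sub contDiffAt_const))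
  · simp [hh0]

/-- Dually, f is followed by a linear left inverse of its derivative before inverting. -/
theorem ContDiffAt.exists_local_retraction {f : E → F} {x : E} (hf : ContDiffAt ℝ ∞ f x)
    (hd : Function.Injective (fderiv ℝ f x)) :
    ∃ r : F → E, ContDiffAt ℝ ∞ r (f x) ∧ ∀ᶠ y in 𝓝 x, r (f y) = y := by
  obtain ⟨P, hP⟩ := (fderiv ℝ f x).toLinearMap.exists_leftInverse_of_injective
    (LinearMap.ker_eq_bot.2 hd)
  let P' : F →L[ℝ] E := LinearMap.toContinuousLinearMap P
  have hk : ContDiffAt ℝ ∞ (fun y => P' (f y)) x := P'.contDiff.contDiffAt.comp x hf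
  have hkd : HasFDerivAt (fun y => P' (f y)) (ContinuousLinearMap.id ℝ E) x := by
    refine (P'.hasFDerivAt.comp x (hf.differentiableAt (by simp)).hasFDerivAt).congr_fderiv ?_
    ext v
    exact DFunLike.congr_fun hP v
  obtain ⟨h, hh, -, -, hl⟩ := hk.exists_local_inverse hkd
  exact ⟨fun y => h (P' y), ContDiffAt.comp (g := h) (f x) hh P'.contDiff.contDiffAt, hl⟩

end LocalInverses

/-! ### Locally constant maps, local sections and retractions on manifolds -/

section Manifolds

set_option linter.unusedSectionVars false

variable {E : Type*} [NormedAddCommGroup E] [NormedSpace ℝ E]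
  {N : Type*} [TopologicalSpace N] [ChartedSpace E N] [IsManifold 𝓘(ℝ, E) ∞ N]
  {F : Type*} [NormedAddCommGroup F] [NormedSpace ℝ F]
  {M : Type*} [TopologicalSpace M] [ChartedSpace F M] [IsManifold 𝓘(ℝ, F) ∞ M]

/-- The coordinate expression of a map between manifolds at a point. -/
def coordMap (E F : Type*) [NormedAddCommGroup E] [NormedSpace ℝ E] [NormedAddCommGroup F]
    [NormedSpace ℝ F] {N : Type*} [TopologicalSpace N] [ChartedSpace E N] {M : Type*}
    [TopologicalSpace M] [ChartedSpace F M] (f : N → M) (p : N) (z : E) : F :=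
  extChartAt 𝓘(ℝ, F) (f p) (f ((extChartAt 𝓘(ℝ, E) p).symm z))

theorem coordMap_self (f : N → M) (p : N) :
    coordMap E F f p (extChartAt 𝓘(ℝ, E) p p) = extChartAt 𝓘(ℝ, F) (f p) (f p) := by
  rw [coordMap, extChartAt_to_inv]

theorem contDiffAt_coordMap {f : N → M} {p : N} (hf : ContMDiffAt 𝓘(ℝ, E) 𝓘(ℝ, F) ∞ f p) :
    ContDiffAt ℝ ∞ (coordMap E F f p) (extChartAt 𝓘(ℝ, E) p p) := by
  have h1 : ContMDiffAt 𝓘(ℝ, E) 𝓘(ℝ, F) ∞ f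
      ((extChartAt 𝓘(ℝ, E) p).symm (extChartAt 𝓘(ℝ, E) p p)) := by
    rw [extChartAt_to_inv]; exact hf
  refine contDiffAt_chart_comp (ContMDiffAt.comp (g := f) _ h1
    (contMDiffAt_chart_symm (mem_extChartAt_target p))) ?_
  rw [extChartAt_to_inv]
  exact mem_extChartAt_source _

theorem fderiv_coordMap {f : N → M} {p : N} (hf : MDifferentiableAt 𝓘(ℝ, E) 𝓘(ℝ, F) f p) :
    fderiv ℝ (coordMap E F f p) (extChartAt 𝓘(ℝ, E) p p)
      = (mfderiv 𝓘(ℝ, E) 𝓘(ℝ, F) f p : E →L[ℝ] F) := by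
  have h := hf.mfderiv
  rw [ModelWithCorners.range_eq_univ, fderivWithin_univ] at h
  exact h.symm

theorem isLocallyConstant_of_mfderiv_eq_zero {f : N → M} (hf : MDifferentiable 𝓘(ℝ, E) 𝓘(ℝ, F) f)
    (h : ∀ p, (mfderiv 𝓘(ℝ, E) 𝓘(ℝ, F) f p : E →L[ℝ] F) = 0) : IsLocallyConstant f := by
  rw [IsLocallyConstant.iff_eventually_eq]
  intro p
  set e := extChartAt 𝓘(ℝ, E) p with he
  have hp : p ∈ e.source := mem_extChartAt_source p
  have hl : e.symm (e p) = p := e.left_inv hp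
  have hcont : ContinuousAt (fun z => f (e.symm z)) (e p) := by
    have h1 : ContinuousAt f (e.symm (e p)) := (hf _).continuousAt
    exact ContinuousAt.comp (g := f) h1
      (contMDiffAt_chart_symm (e.map_source hp)).continuousAt
  have hev : ∀ᶠ z in 𝓝 (e p), z ∈ e.target ∧ f (e.symm z) ∈ (extChartAt 𝓘(ℝ, F) (f p)).source :=
    Filter.Eventually.and (extChartAt_target_mem_nhds' (I := 𝓘(ℝ, E)) (e.map_source hp))
      (hcont.preimage_mem_nhds ((isOpen_extChartAt_source (I := 𝓘(ℝ, F)) (f p)).mem_nhds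
        (by rw [hl]; exact mem_extChartAt_source _)))
  obtain ⟨ε, hε, hball⟩ := Metric.eventually_nhds_iff_ball.1 hev
  have hd : ∀ z ∈ Metric.ball (e p) ε, HasFDerivAt (coordMap E F f p) (0 : E →L[ℝ] F) z := by
    intro z hz
    obtain ⟨hz1, hz2⟩ := hball z hz
    have h1 := ((contMDiffAt_chart hz2).mdifferentiableAt (by simp)).hasMFDerivAt.comp z
      ((hf (e.symm z)).hasMFDerivAt.comp z
        ((contMDiffAt_chart_symm hz1).mdifferentiableAt (by simp)).hasMFDerivAt)
    have h2 : HasFDerivAt (coordMap E F f p) _ z := hasMFDerivAt_iff_hasFDerivAt.1 h1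
    refine h2.congr_fderiv ?_
    have h3 := h (e.symm z)
    ext v
    have h4 : ∀ w : E, (mfderiv 𝓘(ℝ, E) 𝓘(ℝ, F) f (e.symm z) w : F) = 0 := fun w =>
      DFunLike.congr_fun h3 w
    change (mfderiv 𝓘(ℝ, F) 𝓘(ℝ, F) (extChartAt 𝓘(ℝ, F) (f p)) (f (e.symm z)) :
      F →L[ℝ] F) (mfderiv 𝓘(ℝ, E) 𝓘(ℝ, F) f (e.symm z)
        (mfderiv 𝓘(ℝ, E) 𝓘(ℝ, E) e.symm z v) : F) = 0
    exact (congrArg _ (h4 _)).trans (map_zero _)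
  have hconst : ∀ z ∈ Metric.ball (e p) ε, coordMap E F f p z = coordMap E F f p (e p) := by
    intro z hz
    exact (convex_ball (e p) ε).is_const_of_fderivWithin_eq_zero (𝕜 := ℝ)
      (fun y hy => (hd y hy).differentiableAt.differentiableWithinAt)
      (fun y hy => by
        rw [fderivWithin_of_isOpen Metric.isOpen_ball hy, (hd y hy).fderiv])
      hz (Metric.mem_ball_self hε)
  have hc : ∀ᶠ q in 𝓝 p, e q ∈ Metric.ball (e p) ε :=
    (contMDiffAt_chart hp).continuousAt.preimage_mem_nhds (Metric.ball_mem_nhds _ hε)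
  filter_upwards [hc, (isOpen_extChartAt_source (I := 𝓘(ℝ, E)) p).mem_nhds hp] with q hq hq2
  have h1 := hconst _ hq
  rw [coordMap, coordMap, ← he, hl, e.left_inv hq2] at h1
  have h2 := (hball _ hq).2
  rw [e.left_inv hq2] at h2
  exact (extChartAt 𝓘(ℝ, F) (f p)).injOn h2 (mem_extChartAt_source _) h1

variable [FiniteDimensional ℝ E] [FiniteDimensional ℝ F]

theorem ContMDiffAt.exists_local_section {f : N → M} {p : N}
    (hf : ContMDiffAt 𝓘(ℝ, E) 𝓘(ℝ, F) ∞ f p)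
    (hd : Function.Surjective (mfderiv 𝓘(ℝ, E) 𝓘(ℝ, F) f p)) :
    ∃ s : M → N, ContMDiffAt 𝓘(ℝ, F) 𝓘(ℝ, E) ∞ s (f p) ∧ s (f p) = p ∧
      ∀ᶠ y in 𝓝 (f p), f (s y) = y := by
  have hd' : Function.Surjective
      (fderiv ℝ (coordMap E F f p) (extChartAt 𝓘(ℝ, E) p p)) := by
    rw [fderiv_coordMap (hf.mdifferentiableAt (by simp))]; exact hd
  obtain ⟨s, hs, hs0, hr⟩ := (contDiffAt_coordMap hf).exists_local_section hd'
  rw [coordMap_self] at hs hs0 hr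
  set e := extChartAt 𝓘(ℝ, E) p with he
  set e' := extChartAt 𝓘(ℝ, F) (f p) with he'
  have hp : p ∈ e.source := mem_extChartAt_source p
  have hp' : f p ∈ e'.source := mem_extChartAt_source (f p)
  have h1 : ContMDiffAt 𝓘(ℝ, F) 𝓘(ℝ, E) ∞ (fun y => s (e' y)) (f p) :=
    ContMDiffAt.comp (g := s) (f p) hs.contMDiffAt (contMDiffAt_chart hp')
  have h2 : ContMDiffAt 𝓘(ℝ, E) 𝓘(ℝ, E) ∞ e.symm (s (e' (f p))) := by
    rw [hs0]; exact contMDiffAt_chart_symm (e.map_source hp)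
  have h3 : ContMDiffAt 𝓘(ℝ, F) 𝓘(ℝ, E) ∞ (fun y => e.symm (s (e' y))) (f p) :=
    ContMDiffAt.comp (g := e.symm) (f p) h2 h1
  have h4 : e.symm (s (e' (f p))) = p := by rw [hs0, e.left_inv hp]
  refine ⟨fun y => e.symm (s (e' y)), h3, h4, ?_⟩
  have h5 : ContinuousAt (fun y => f (e.symm (s (e' y)))) (f p) := by
    have : ContinuousAt f (e.symm (s (e' (f p)))) := by rw [h4]; exact hf.continuousAt
    exact ContinuousAt.comp (g := f) this h3.continuousAt
  have h6 := h5.preimage_mem_nhds ((isOpen_extChartAt_source (I := 𝓘(ℝ, F)) (f p)).mem_nhds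
    (by rw [h4]; exact hp'))
  filter_upwards [(contMDiffAt_chart hp').continuousAt.eventually hr, h6,
    (isOpen_extChartAt_source (I := 𝓘(ℝ, F)) (f p)).mem_nhds hp'] with y hy hy2 hy3
  exact e'.injOn hy2 hy3 hy

theorem ContMDiffAt.exists_local_retraction {f : N → M} {p : N}
    (hf : ContMDiffAt 𝓘(ℝ, E) 𝓘(ℝ, F) ∞ f p)
    (hd : Function.Injective (mfderiv 𝓘(ℝ, E) 𝓘(ℝ, F) f p)) :
    ∃ r : M → N, ContMDiffAt 𝓘(ℝ, F) 𝓘(ℝ, E) ∞ r (f p) ∧ ∀ᶠ y in 𝓝 p, r (f y) = y := by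
  have hd' : Function.Injective
      (fderiv ℝ (coordMap E F f p) (extChartAt 𝓘(ℝ, E) p p)) := by
    rw [fderiv_coordMap (hf.mdifferentiableAt (by simp))]; exact hd
  obtain ⟨r, hr, hl⟩ := (contDiffAt_coordMap hf).exists_local_retraction hd'
  rw [coordMap_self] at hr
  set e := extChartAt 𝓘(ℝ, E) p with he
  set e' := extChartAt 𝓘(ℝ, F) (f p) with he'
  have hp : p ∈ e.source := mem_extChartAt_source p
  have hp' : f p ∈ e'.source := mem_extChartAt_source (f p)
  have h1 : ContMDiffAt 𝓘(ℝ, F) 𝓘(ℝ, E) ∞ (fun y => r (e' y)) (f p) :=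
    ContMDiffAt.comp (g := r) (f p) hr.contMDiffAt (contMDiffAt_chart hp')
  have h0 : r (e' (f p)) = e p := by
    have := hl.self_of_nhds
    rwa [coordMap_self] at this
  have h2 : ContMDiffAt 𝓘(ℝ, E) 𝓘(ℝ, E) ∞ e.symm (r (e' (f p))) := by
    rw [h0]; exact contMDiffAt_chart_symm (e.map_source hp)
  refine ⟨fun y => e.symm (r (e' y)), ContMDiffAt.comp (g := e.symm) (f p) h2 h1, ?_⟩
  filter_upwards [(contMDiffAt_chart hp).continuousAt.eventually hl,
    (isOpen_extChartAt_source (I := 𝓘(ℝ, E)) p).mem_nhds hp] with q hq hq2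
  rw [coordMap, ← he, ← he', e.left_inv hq2] at hq
  rw [hq, e.left_inv hq2]

end Manifolds

open scoped Pointwise in
/-- A connected locally compact group is σ-compact. -/
theorem sigmaCompactSpace_of_connectedSpace (K : Type*) [TopologicalSpace K] [Group K]
    [IsTopologicalGroup K] [WeaklyLocallyCompactSpace K] [ConnectedSpace K] :
    SigmaCompactSpace K := by
  obtain ⟨V, hV, hV1⟩ := exists_compact_mem_nhds (1 : K)
  have hW : IsCompact (V ∪ V⁻¹) := hV.union hV.inv
  -- Products of n elements of a symmetric compact neighbourhood of 1. Their union is closed under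
  -- right multiplication by that neighbourhood, hence open and closed.
  let C : ℕ → Set K := fun n => Nat.rec {1} (fun _ S => S * (V ∪ V⁻¹)) n
  have hC : ∀ n, IsCompact (C n) := by
    intro n
    induction n with
    | zero => exact isCompact_singleton
    | succ n ih => exact ih.mul hW
  have hmul : ∀ (x w : K), w ∈ V ∪ V⁻¹ → x ∈ ⋃ n, C n → x * w ∈ ⋃ n, C n := by
    intro x w hw hx
    obtain ⟨n, hn⟩ := Set.mem_iUnion.1 hx
    exact Set.mem_iUnion.2 ⟨n + 1, Set.mul_mem_mul hn hw⟩
  have hnhds : ∀ x : K, (fun y => x⁻¹ * y) ⁻¹' V ∈ 𝓝 x := fun x =>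
    (continuous_const_mul x⁻¹).continuousAt.preimage_mem_nhds (by simpa using hV1)
  have hopen : IsOpen (⋃ n, C n) := by
    rw [isOpen_iff_mem_nhds]
    intro x hx
    filter_upwards [hnhds x] with y hy
    have := hmul x (x⁻¹ * y) (Or.inl hy) hx
    rwa [mul_inv_cancel_left] at this
  have hclosed : IsClosed (⋃ n, C n) := by
    rw [← isOpen_compl_iff, isOpen_iff_mem_nhds]
    intro x hx
    filter_upwards [hnhds x] with y hy hy2
    refine hx ?_
    have := hmul y (y⁻¹ * x) (Or.inr (by simpa using hy)) hy2
    rwa [mul_inv_cancel_left] at this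
  have huniv : ⋃ n, C n = Set.univ :=
    IsClopen.eq_univ ⟨hclosed, hopen⟩ ⟨1, Set.mem_iUnion.2 ⟨0, rfl⟩⟩
  exact ⟨⟨C, hC, huniv⟩⟩

/-! ### Homogeneous manifolds -/

section Homogeneous

set_option linter.unusedSectionVars false

variable {E : Type*} [NormedAddCommGroup E] [NormedSpace ℝ E] [FiniteDimensional ℝ E]
  {L : Type*} [TopologicalSpace L] [ChartedSpace E L] [Group L] [LieGroup 𝓘(ℝ, E) ∞ L]
  {F : Type*} [NormedAddCommGroup F] [NormedSpace ℝ F] [FiniteDimensional ℝ F]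
  {S : Subgroup L} [ChartedSpace F (L ⧸ S)] [IsManifold 𝓘(ℝ, F) ∞ (L ⧸ S)]

theorem projDiff_eq_actVec (X : E) :
    (projDiff (E := E) (F := F) S X : F) = actVec E L F ((1 : L) : L ⧸ S) X := by
  have h : (fun a : L => (a : L ⧸ S)) = fun a : L => a • ((1 : L) : L ⧸ S) := by
    funext a
    rw [← QuotientGroup.mk_mul_of_mem a (one_mem S)]
    rfl
  have h1 : (mfderiv 𝓘(ℝ, E) 𝓘(ℝ, F) (fun a : L => (a : L ⧸ S)) 1 : E →L[ℝ] F)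
      = mfderiv 𝓘(ℝ, E) 𝓘(ℝ, F) (fun a : L => a • ((1 : L) : L ⧸ S)) 1 := by
    rw [← h]
  exact DFunLike.congr_fun h1 X

theorem exists_smul_one_eq (x : L ⧸ S) : ∃ a : L, a • ((1 : L) : L ⧸ S) = x := by
  obtain ⟨a, rfl⟩ := QuotientGroup.mk_surjective x
  exact ⟨a, by rw [MulAction.Quotient.smul_coe, smul_eq_mul, mul_one]⟩

theorem smul_one_eq_one_iff {a : L} : a • ((1 : L) : L ⧸ S) = ((1 : L) : L ⧸ S) ↔ a ∈ S := by
  rw [MulAction.Quotient.smul_coe, smul_eq_mul, mul_one, eq_comm, QuotientGroup.eq]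
  simp

theorem IsHomogeneousManifold.actVec_one_surjective (hM : IsHomogeneousManifold E F S) :
    Function.Surjective (actVec E L F ((1 : L) : L ⧸ S)) := by
  intro v
  obtain ⟨X, hX⟩ := hM.surjective_mfderiv_mk 1 v
  exact ⟨X, (projDiff_eq_actVec (S := S) (F := F) (E := E) X).symm.trans hX⟩

theorem IsHomogeneousManifold.exists_local_section (hM : IsHomogeneousManifold E F S)
    (x : L ⧸ S) : ∃ s : L ⧸ S → L, ContMDiffAt 𝓘(ℝ, F) 𝓘(ℝ, E) ∞ s x ∧
      ∀ᶠ y in 𝓝 x, (s y : L ⧸ S) = y := by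
  obtain ⟨a, rfl⟩ := QuotientGroup.mk_surjective x
  obtain ⟨s, hs, -, h⟩ := (hM.contMDiff_mk.contMDiffAt (x := a)).exists_local_section
    (hM.surjective_mfderiv_mk a)
  exact ⟨s, hs, h⟩

/-- Near each point f factors through a smooth local section of the projection. -/
theorem IsHomogeneousManifold.contMDiff_of_comp_mk (hM : IsHomogeneousManifold E F S)
    {W : Type*} [NormedAddCommGroup W] [NormedSpace ℝ W] {N : Type*} [TopologicalSpace N]
    [ChartedSpace W N] {f : L ⧸ S → N}
    (hf : ContMDiff 𝓘(ℝ, E) 𝓘(ℝ, W) ∞ fun a : L => f a) : ContMDiff 𝓘(ℝ, F) 𝓘(ℝ, W) ∞ f := by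
  intro x
  obtain ⟨s, hs, h⟩ := hM.exists_local_section x
  refine (ContMDiffAt.comp (g := fun a : L => f a) x hf.contMDiffAt hs).congr_of_eventuallyEq ?_
  filter_upwards [h] with y hy
  rw [Function.comp_apply, hy]

/-- The velocity of the orbit of the initial point is at each time a translate of the initial
velocity, so it vanishes identically and the orbit is constant. -/
theorem mem_of_actVec_eq_zero [ContMDiffSMul 𝓘(ℝ, E) 𝓘(ℝ, F) ∞ L (L ⧸ S)] {φ : ℝ → L}
    (hφ : IsOneParameterSubgroup E φ)
    (h : actVec E L F ((1 : L) : L ⧸ S) (velocity E φ 0) = 0) (t : ℝ) : φ t ∈ S := by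
  have hsm := contMDiff_orbit (F := F) hφ ((1 : L) : L ⧸ S)
  have h1 : IsLocallyConstant fun s => φ s • ((1 : L) : L ⧸ S) := by
    refine isLocallyConstant_of_mfderiv_eq_zero (E := ℝ) (F := F)
      (hsm.mdifferentiable (by simp)) fun s => ?_
    have h2 := velocity_orbit (F := F) hφ ((1 : L) : L ⧸ S) s
    rw [h, map_zero] at h2
    exact ContinuousLinearMap.ext_ring h2
  have h3 := h1.apply_eq_of_preconnectedSpace t 0
  simp only [map_zero_of_add hφ.2, one_smul] at h3
  exact smul_one_eq_one_iff.1 h3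

theorem actVec_eq_zero_of_mem [ContMDiffSMul 𝓘(ℝ, E) 𝓘(ℝ, F) ∞ L (L ⧸ S)] {φ : ℝ → L}
    (hφ : IsOneParameterSubgroup E φ) (h : ∀ t, φ t ∈ S) :
    actVec E L F ((1 : L) : L ⧸ S) (velocity E φ 0) = 0 := by
  rw [← velocity_smul_zero hφ]
  have h1 : (fun s => φ s • ((1 : L) : L ⧸ S)) = fun _ => ((1 : L) : L ⧸ S) := by
    funext s; exact smul_one_eq_one_iff.2 (h s)
  have h2 : (mfderiv 𝓘(ℝ, ℝ) 𝓘(ℝ, F) (fun s => φ s • ((1 : L) : L ⧸ S)) 0 : ℝ →L[ℝ] F) = 0 := by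
    rw [h1]; exact mfderiv_const
  exact DFunLike.congr_fun h2 1

/-- The kernel of the differential of `L → L/S` is the Lie algebra of `S`. -/
theorem mem_subgroupLieAlgebra_iff [T2Space L] [ContMDiffSMul 𝓘(ℝ, E) 𝓘(ℝ, F) ∞ L (L ⧸ S)]
    (X : E) : X ∈ subgroupLieAlgebra (E := E) S ↔ actVec E L F ((1 : L) : L ⧸ S) X = 0 := by
  constructor
  · rintro ⟨φ, hφ, hS, rfl⟩
    exact actVec_eq_zero_of_mem hφ hS
  · intro h
    have : CompleteSpace E := FiniteDimensional.complete ℝ E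
    obtain ⟨φ, hφ, hX⟩ := exists_isOneParameterSubgroup (L := L) X
    have hX' : X = velocity E φ 0 := hX
    exact ⟨φ, hφ, mem_of_actVec_eq_zero (F := F) hφ (hX' ▸ h), hX⟩

end Homogeneous

/-! ### Lie subgroups and their one-parameter subgroups -/

section LieSubgroups

set_option linter.unusedSectionVars false

variable {E : Type*} [NormedAddCommGroup E] [NormedSpace ℝ E] [FiniteDimensional ℝ E]
  {G : Type*} [TopologicalSpace G] [ChartedSpace E G] [Group G] [LieGroup 𝓘(ℝ, E) ∞ G]
  {E' : Type*} [NormedAddCommGroup E'] [NormedSpace ℝ E'] [FiniteDimensional ℝ E']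
  {K : Type*} [TopologicalSpace K] [ChartedSpace E' K] [Group K] [LieGroup 𝓘(ℝ, E') ∞ K]
  {ι : K →* G}

variable (E E') in
/-- The differential at `1` of a homomorphism of Lie groups, on the model spaces. -/
def lieHom (ι : K →* G) : E' →L[ℝ] E := mfderiv 𝓘(ℝ, E') 𝓘(ℝ, E) ι 1

theorem isOneParameterSubgroup_comp (hι : ContMDiff 𝓘(ℝ, E') 𝓘(ℝ, E) ∞ ι) {ψ : ℝ → K}
    (hψ : IsOneParameterSubgroup E' ψ) : IsOneParameterSubgroup E (fun t => ι (ψ t)) :=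
  ⟨hι.comp hψ.1, fun s t => by simp only [hψ.2, map_mul]⟩

theorem velocity_comp_hom (hι : ContMDiff 𝓘(ℝ, E') 𝓘(ℝ, E) ∞ ι) {ψ : ℝ → K}
    (hψ : IsOneParameterSubgroup E' ψ) :
    velocity E (fun t => ι (ψ t)) 0 = lieHom E E' ι (velocity E' ψ 0) := by
  have h1 := HasMFDerivAt.comp (0 : ℝ) (hι.mdifferentiableAt (x := ψ 0) (by simp)).hasMFDerivAt
    (hψ.1.mdifferentiableAt (by simp)).hasMFDerivAt
  have h2 : velocity E (fun t => ι (ψ t)) 0 = _ := DFunLike.congr_fun h1.mfderiv 1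
  have key : ∀ d : K, d = 1 → ∀ v : E',
      (mfderiv 𝓘(ℝ, E') 𝓘(ℝ, E) ι d v : E) = lieHom E E' ι v := by rintro _ rfl v; rfl
  exact h2.trans (key _ (map_zero_of_add hψ.2) _)

theorem lieHom_adjointMap (hι : ContMDiff 𝓘(ℝ, E') 𝓘(ℝ, E) ∞ ι) (k : K) (Y : E') :
    lieHom E E' ι (adjointMap E' k Y) = adjointMap E (ι k) (lieHom E E' ι Y) := by
  have hd : ∀ k, MDifferentiableAt 𝓘(ℝ, E') 𝓘(ℝ, E) ι k := fun k =>
    hι.mdifferentiableAt (by simp)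
  have h1 := ((hd (k * 1 * k⁻¹)).hasMFDerivAt.comp (1 : K)
    ((contMDiff_conj (E := E') k).mdifferentiableAt (by simp)).hasMFDerivAt).mfderiv
  have h2 := (((contMDiff_conj (E := E) (ι k)).mdifferentiableAt (x := ι 1)
    (by simp)).hasMFDerivAt.comp (1 : K) (hd 1).hasMFDerivAt).mfderiv
  have h3 : ι ∘ (fun x => k * x * k⁻¹) = (fun x => ι k * x * (ι k)⁻¹) ∘ ι := by
    funext x; simp
  rw [h3] at h1
  have h4 := DFunLike.congr_fun (h1.symm.trans h2) Y
  have key : ∀ d : K, d = 1 → ∀ v : E',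
      (mfderiv 𝓘(ℝ, E') 𝓘(ℝ, E) ι d v : E) = lieHom E E' ι v := by rintro _ rfl v; rfl
  have key2 : ∀ d : G, d = 1 → ∀ v : E, (mfderiv 𝓘(ℝ, E) 𝓘(ℝ, E) (fun x => ι k * x * (ι k)⁻¹) d v : E)
      = adjointMap E (ι k) v := by rintro _ rfl v; rfl
  exact (key _ (by simp) _).symm.trans (h4.trans (key2 _ (map_one ι) _))

/-- Differentiate dι ∘ Ad(ψ(s)) = Ad(ι(ψ(s))) ∘ dι at s = 0. -/
theorem lieHom_lieBracketModel [T2Space K] (hι : ContMDiff 𝓘(ℝ, E') 𝓘(ℝ, E) ∞ ι) (X Y : E') :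
    lieHom E E' ι (lieBracketModel K X Y)
      = lieBracketModel G (lieHom E E' ι X) (lieHom E E' ι Y) := by
  have : CompleteSpace E := FiniteDimensional.complete ℝ E
  have : CompleteSpace E' := FiniteDimensional.complete ℝ E'
  obtain ⟨ψ, hψ, hX⟩ := exists_isOneParameterSubgroup (L := K) X
  have hX' : X = velocity E' ψ 0 := hX
  have h1 := (lieHom E E' ι).hasFDerivAt.comp_hasDerivAt (0 : ℝ) (hasDerivAt_adjointMap hψ Y 0)
  have h2 := hasDerivAt_adjointMap (isOneParameterSubgroup_comp hι hψ) (lieHom E E' ι Y) 0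
  have h3 : (fun s => adjointMap E (ι (ψ s)) (lieHom E E' ι Y))
      = (lieHom E E' ι) ∘ fun s => adjointMap E' (ψ s) Y := by
    funext s; exact (lieHom_adjointMap hι _ _).symm
  rw [h3] at h2
  have h4 := h1.unique h2
  rwa [map_zero_of_add hψ.2, map_one, adjointMap_one, adjointMap_one, velocity_comp_hom hι hψ,
    ← hX'] at h4

/-- One-parameter subgroups of `G` contained in a connected Lie subgroup `K` are one-parameter
subgroups of `K`. -/
theorem IsLieSubgroup.exists_lift [T2Space G] [ConnectedSpace K]
    (hι : IsLieSubgroup (E := E) (E' := E') ι) {φ : ℝ → G} (hφ : IsOneParameterSubgroup E φ)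
    (h : ∀ t, φ t ∈ ι.range) :
    ∃ ψ : ℝ → K, IsOneParameterSubgroup E' ψ ∧ ∀ t, ι (ψ t) = φ t := by
  choose ψ hψ using h
  have hadd : ∀ s t, ψ (s + t) = ψ s * ψ t := fun s t =>
    hι.injective (by rw [map_mul, hψ, hψ, hψ, hφ.2])
  have : IsTopologicalGroup K := topologicalGroup_of_lieGroup 𝓘(ℝ, E') ∞
  have : LocallyCompactSpace K := Manifold.locallyCompact_of_finiteDimensional 𝓘(ℝ, E')
  have : SigmaCompactSpace K := sigmaCompactSpace_of_connectedSpace K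
  have hιc : Continuous ι := hι.contMDiff.continuous
  -- The immersed topology of K may be finer than the one induced from G, so continuity of the lift
  -- is not automatic. Baire: the line is a countable union of the closed preimages of images of
  -- compact sets of K, so one preimage has an interior point.
  obtain ⟨n, t₀, ht₀⟩ := nonempty_interior_of_iUnion_of_closed
    (f := fun n => φ ⁻¹' (ι '' compactCovering K n))
    (fun n => (((isCompact_compactCovering K n).image hιc).isClosed).preimage hφ.1.continuous) (by
      refine Set.eq_univ_of_forall fun t => ?_
      obtain ⟨n, hn⟩ := exists_mem_compactCovering (ψ t)
      exact Set.mem_iUnion.2 ⟨n, ψ t, hn, hψ t⟩)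
  have hcont : ContinuousAt ψ t₀ := by
    set A := φ ⁻¹' (ι '' compactCovering K n) with hA
    have hmem : ∀ t : A, ψ t ∈ compactCovering K n := by
      rintro ⟨t, k, hk, hk2⟩
      rwa [hι.injective (hk2.trans (hψ t).symm)] at hk
    have : CompactSpace (compactCovering K n) :=
      isCompact_iff_compactSpace.1 (isCompact_compactCovering K n)
    -- On a compact piece the injective continuous map ι is an embedding, so the lift is continuous
    -- there.
    have hemb : Topology.IsClosedEmbedding (fun k : compactCovering K n => ι k) :=
      Continuous.isClosedEmbedding (hιc.comp continuous_subtype_val)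
        fun a b hab => Subtype.ext (hι.injective hab)
    have h1 : Continuous fun t : A => (⟨ψ t, hmem t⟩ : compactCovering K n) := by
      rw [hemb.isInducing.continuous_iff]
      have h2 : (fun k : compactCovering K n => ι k) ∘ (fun t : A =>
          (⟨ψ t, hmem t⟩ : compactCovering K n)) = fun t : A => φ t := by
        funext t; exact hψ t
      rw [h2]
      exact hφ.1.continuous.comp continuous_subtype_val
    have h3 : ContinuousOn ψ A :=
      continuousOn_iff_continuous_domRestrict.2 (continuous_subtype_val.comp h1)
    exact h3.continuousAt (mem_interior_iff_mem_nhds.1 ht₀)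
  -- Translation moves the point of continuity from t₀ to 0.
  have hcont0 : ContinuousAt ψ 0 := by
    have h1 : ψ = fun t => ψ (-t₀) * ψ (t + t₀) := by
      funext t; rw [← hadd]; congr 1; ring
    rw [h1]
    refine continuousAt_const.mul (ContinuousAt.comp (g := ψ) (by simpa using hcont) ?_)
    fun_prop
  have hψ0 := map_zero_of_add hadd
  -- A smooth local retraction of the immersion expresses the continuous lift near 0 as r ∘ φ, which
  -- is smooth.
  obtain ⟨r, hr, hrl⟩ := (hι.contMDiff.contMDiffAt (x := (1 : K))).exists_local_retraction
    (hι.injective_mfderiv 1)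
  refine ⟨ψ, isOneParameterSubgroup_of_mdifferentiableAt hadd ?_, hψ⟩
  have h5 : ContMDiffAt 𝓘(ℝ, ℝ) 𝓘(ℝ, E') ∞ (fun t => r (φ t)) 0 := by
    refine ContMDiffAt.comp_of_eq (g := r) hr hφ.1.contMDiffAt ?_
    rw [map_zero_of_add hφ.2, map_one]
  refine (h5.congr_of_eventuallyEq ?_).mdifferentiableAt (by simp)
  have h6 : ∀ᶠ t in 𝓝 (0 : ℝ), r (ι (ψ t)) = ψ t := hcont0.eventually (by rwa [hψ0])
  filter_upwards [h6] with t ht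
  rw [← ht, hψ]

/-- The inclusion of 𝔥 in 𝔨, obtained from inclusion of the groups as sets. It is what puts geodesic
vectors over vectors of 𝔨 into 𝔨. -/
theorem IsLieSubgroup.subgroupLieAlgebra_subset [T2Space G] [ConnectedSpace K]
    (hι : IsLieSubgroup (E := E) (E' := E') ι) {H : Subgroup G} (hH : H ≤ ι.range) {X : E}
    (hX : X ∈ subgroupLieAlgebra (E := E) H) : ∃ Y : E', lieHom E E' ι Y = X := by
  obtain ⟨φ, hφ, hφH, rfl⟩ := hX
  obtain ⟨ψ, hψ, h⟩ := hι.exists_lift hφ fun t => hH (hφH t)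
  refine ⟨velocity E' ψ 0, ?_⟩
  rw [← velocity_comp_hom hι.contMDiff hψ]
  exact velocity_congr (Filter.Eventually.of_forall h)

end LieSubgroups

/-! ### The orbit map K/(K ∩ H) → G/H -/

section Orbit

set_option linter.unusedSectionVars false

variable {E : Type*} [NormedAddCommGroup E] [NormedSpace ℝ E] [FiniteDimensional ℝ E]
  {G : Type*} [TopologicalSpace G] [ChartedSpace E G] [Group G] [LieGroup 𝓘(ℝ, E) ∞ G]
  {H : Subgroup G} {F : Type*} [NormedAddCommGroup F] [NormedSpace ℝ F] [FiniteDimensional ℝ F]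
  [ChartedSpace F (G ⧸ H)] [IsManifold 𝓘(ℝ, F) ∞ (G ⧸ H)]
  {E' : Type*} [NormedAddCommGroup E'] [NormedSpace ℝ E'] [FiniteDimensional ℝ E']
  {K : Type*} [TopologicalSpace K] [ChartedSpace E' K] [Group K] [LieGroup 𝓘(ℝ, E') ∞ K]
  {ι : K →* G}
  {F' : Type*} [NormedAddCommGroup F'] [NormedSpace ℝ F'] [FiniteDimensional ℝ F']
  [ChartedSpace F' (K ⧸ H.comap ι)] [IsManifold 𝓘(ℝ, F') ∞ (K ⧸ H.comap ι)]

theorem orbitMap_mk (k : K) : orbitMap H ι (k : K ⧸ H.comap ι) = (ι k : G ⧸ H) := rfl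

theorem orbitMap_smul (k : K) (x : K ⧸ H.comap ι) :
    orbitMap H ι (k • x) = ι k • orbitMap H ι x := by
  obtain ⟨c, rfl⟩ := QuotientGroup.mk_surjective x
  rw [MulAction.Quotient.smul_coe, orbitMap_mk, orbitMap_mk, MulAction.Quotient.smul_coe,
    smul_eq_mul, smul_eq_mul, map_mul]

theorem orbitMap_injective : Function.Injective (orbitMap H ι) := by
  intro x y h
  obtain ⟨a, rfl⟩ := QuotientGroup.mk_surjective x
  obtain ⟨c, rfl⟩ := QuotientGroup.mk_surjective y
  rw [orbitMap_mk, orbitMap_mk, QuotientGroup.eq] at h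
  rw [QuotientGroup.eq, Subgroup.mem_comap, map_mul, map_inv]
  exact h

theorem orbitMap_one : orbitMap H ι ((1 : K) : K ⧸ H.comap ι) = ((1 : G) : G ⧸ H) := by
  rw [orbitMap_mk, map_one]

theorem contMDiff_orbitMap (hM : IsHomogeneousManifold E F H)
    (hι : ContMDiff 𝓘(ℝ, E') 𝓘(ℝ, E) ∞ ι) (hP : IsHomogeneousManifold E' F' (H.comap ι)) :
    ContMDiff 𝓘(ℝ, F') 𝓘(ℝ, F) ∞ (orbitMap H ι) :=
  hP.contMDiff_of_comp_mk (hM.contMDiff_mk.comp hι)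

variable (F F') in
/-- The differential of the orbit map, on the model spaces. -/
def orbitDiff (H : Subgroup G) [ChartedSpace F (G ⧸ H)] (ι : K →* G)
    [ChartedSpace F' (K ⧸ H.comap ι)] (x : K ⧸ H.comap ι) : F' →L[ℝ] F :=
  mfderiv 𝓘(ℝ, F') 𝓘(ℝ, F) (orbitMap H ι) x

theorem orbitDiff_actDiff (hM : IsHomogeneousManifold E F H)
    (hι : ContMDiff 𝓘(ℝ, E') 𝓘(ℝ, E) ∞ ι) (hP : IsHomogeneousManifold E' F' (H.comap ι))
    (k : K) (x : K ⧸ H.comap ι) (v : F') :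
    orbitDiff F F' H ι (k • x) (actDiff F' k x v)
      = actDiff F (ι k) (orbitMap H ι x) (orbitDiff F F' H ι x v) := by
  have := hM.smooth_smul
  have := hP.smooth_smul
  have hd : ∀ x, MDifferentiableAt 𝓘(ℝ, F') 𝓘(ℝ, F) (orbitMap H ι) x := fun x =>
    (contMDiff_orbitMap hM hι hP).mdifferentiableAt (by simp)
  have h1 := actDiff_comp E (hd x) (ι k) v
  have h2 : MDifferentiableAt 𝓘(ℝ, F') 𝓘(ℝ, F') (fun y : K ⧸ H.comap ι => k • y) x :=
    (contMDiff_const_smul' E' k).mdifferentiableAt (by simp)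
  have h3 := ((hd (k • x)).hasMFDerivAt.comp x h2.hasMFDerivAt).mfderiv
  have h4 : (orbitMap H ι) ∘ (fun y => k • y) = fun y => ι k • orbitMap H ι y := by
    funext y; exact orbitMap_smul k y
  rw [h4] at h3
  exact (DFunLike.congr_fun h3 v).symm.trans h1

theorem orbitDiff_actVec (hM : IsHomogeneousManifold E F H)
    (hι : ContMDiff 𝓘(ℝ, E') 𝓘(ℝ, E) ∞ ι) (hP : IsHomogeneousManifold E' F' (H.comap ι))
    (X : E') : orbitDiff F F' H ι ((1 : K) : K ⧸ H.comap ι)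
        (actVec E' K F' ((1 : K) : K ⧸ H.comap ι) X)
      = actVec E G F ((1 : G) : G ⧸ H) (lieHom E E' ι X) := by
  have hd : MDifferentiableAt 𝓘(ℝ, F') 𝓘(ℝ, F) (orbitMap H ι) ((1 : K) : K ⧸ H.comap ι) :=
    (contMDiff_orbitMap hM hι hP).mdifferentiableAt (by simp)
  have h1 := (hd.hasMFDerivAt.comp (1 : K)
    (hP.contMDiff_mk.mdifferentiableAt (by simp)).hasMFDerivAt).mfderiv
  have h2 := ((hM.contMDiff_mk.mdifferentiableAt (x := ι 1) (by simp)).hasMFDerivAt.comp (1 : K)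
    (hι.mdifferentiableAt (by simp)).hasMFDerivAt).mfderiv
  have h3 := DFunLike.congr_fun (h1.symm.trans h2) X
  have key : ∀ d : G, d = 1 → ∀ v : E,
      (mfderiv 𝓘(ℝ, E) 𝓘(ℝ, F) (fun a : G => (a : G ⧸ H)) d v : F)
        = actVec E G F ((1 : G) : G ⧸ H) v := by
    rintro _ rfl v; exact projDiff_eq_actVec v
  have h4 : (mfderiv 𝓘(ℝ, E') 𝓘(ℝ, F') (fun a : K => (a : K ⧸ H.comap ι)) 1 X : F')
      = actVec E' K F' ((1 : K) : K ⧸ H.comap ι) X := projDiff_eq_actVec X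
  refine (congrArg (orbitDiff F F' H ι ((1 : K) : K ⧸ H.comap ι)) h4).symm.trans ?_
  exact h3.trans (key _ (map_one ι) _)

/-- At the initial point a kernel vector comes from X in Lie(K) whose one-parameter subgroup has
image in H, hence lies in the isotropy group of K/(K ∩ H), so X acts trivially there. Equivariance
reaches the other points. -/
theorem orbitDiff_injective [T2Space K] (hM : IsHomogeneousManifold E F H)
    (hι : ContMDiff 𝓘(ℝ, E') 𝓘(ℝ, E) ∞ ι) (hP : IsHomogeneousManifold E' F' (H.comap ι))
    (x : K ⧸ H.comap ι) : Function.Injective (orbitDiff F F' H ι x) := by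
  have := hM.smooth_smul
  have := hP.smooth_smul
  have : CompleteSpace E' := FiniteDimensional.complete ℝ E'
  have h1 : ∀ v, orbitDiff F F' H ι ((1 : K) : K ⧸ H.comap ι) v = 0 → v = 0 := by
    intro v hv
    obtain ⟨X, rfl⟩ := hP.actVec_one_surjective v
    rw [orbitDiff_actVec hM hι hP] at hv
    obtain ⟨ψ, hψ, hX⟩ := exists_isOneParameterSubgroup (L := K) X
    have hX' : X = velocity E' ψ 0 := hX
    rw [hX', ← velocity_comp_hom hι hψ] at hv
    have h2 := mem_of_actVec_eq_zero (isOneParameterSubgroup_comp hι hψ) hv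
    rw [hX']
    exact actVec_eq_zero_of_mem hψ h2
  obtain ⟨k, rfl⟩ := exists_smul_one_eq x
  refine (injective_iff_map_eq_zero _).2 fun v hv => ?_
  rw [← actDiff_apply_inv E' k ((1 : K) : K ⧸ H.comap ι) v, orbitDiff_actDiff hM hι hP] at hv
  have h3 := congrArg (actDiff F (ι k)⁻¹ (ι k • orbitMap H ι ((1 : K) : K ⧸ H.comap ι))) hv
  rw [actDiff_inv_apply E, map_zero] at h3
  have h4 := h1 _ h3
  rw [← actDiff_apply_inv E' k ((1 : K) : K ⧸ H.comap ι) v, h4, map_zero]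

end Orbit

/-! ### Invariant metrics on homogeneous manifolds -/

section InvariantMetrics

set_option linter.unusedSectionVars false

variable {E : Type*} [NormedAddCommGroup E] [NormedSpace ℝ E] [FiniteDimensional ℝ E]
  {L : Type*} [TopologicalSpace L] [ChartedSpace E L] [Group L] [LieGroup 𝓘(ℝ, E) ∞ L]
  {F : Type*} [NormedAddCommGroup F] [NormedSpace ℝ F] [FiniteDimensional ℝ F]
  {S : Subgroup L} [ChartedSpace F (L ⧸ S)] [IsManifold 𝓘(ℝ, F) ∞ (L ⧸ S)]

/-- The translates of a bilinear form at the initial point of a coset space. -/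
def translatedForm (q : F →L[ℝ] F →L[ℝ] ℝ) (x : L ⧸ S) : F →L[ℝ] F →L[ℝ] ℝ :=
  q.bilinearComp (actDiff F x.out⁻¹ x) (actDiff F x.out⁻¹ x)

/-- Two representatives of a coset differ by an element of S, which preserves q. The arbitrary
choice in the definition may thus be replaced by a smooth one. -/
theorem translatedForm_eq (hM : IsHomogeneousManifold E F S) {q : F →L[ℝ] F →L[ℝ] ℝ}
    (hq : ∀ s ∈ S, ∀ v w, q (actDiff F s ((1 : L) : L ⧸ S) v) (actDiff F s ((1 : L) : L ⧸ S) w)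
      = q v w) {x : L ⧸ S} {a : L} (ha : (a : L ⧸ S) = x) (v w : F) :
    translatedForm q x v w = q (actDiff F a⁻¹ x v) (actDiff F a⁻¹ x w) := by
  have := hM.smooth_smul
  have h1 : (x.out : L ⧸ S) = x := Quotient.out_eq' x
  have hs : a⁻¹ * x.out ∈ S := by rw [← QuotientGroup.eq, ha, h1]
  have h2 : x.out⁻¹ • x = ((1 : L) : L ⧸ S) := by
    rw [inv_smul_eq_iff, MulAction.Quotient.smul_coe, smul_eq_mul, mul_one, h1]
  have h3 : ∀ v, actDiff F a⁻¹ x v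
      = actDiff F (a⁻¹ * x.out) ((1 : L) : L ⧸ S) (actDiff F x.out⁻¹ x v) := by
    intro v
    rw [← h2, ← actDiff_mul E, mul_inv_cancel_right]
  rw [h3, h3, hq _ hs]
  rfl

theorem contDiffAt_chartForm_translatedForm (hM : IsHomogeneousManifold E F S)
    {q : F →L[ℝ] F →L[ℝ] ℝ}
    (hq : ∀ s ∈ S, ∀ v w, q (actDiff F s ((1 : L) : L ⧸ S) v) (actDiff F s ((1 : L) : L ⧸ S) w)
      = q v w) (x₀ : L ⧸ S) (v w : F) :
    ContDiffAt ℝ ∞ (fun y => chartForm (fun x : L ⧸ S => translatedForm (F := F) q x) x₀ y v w)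
      (extChartAt 𝓘(ℝ, F) x₀ x₀) := by
  have := hM.smooth_smul
  obtain ⟨σ, hσ, hσr⟩ := hM.exists_local_section x₀
  set e := extChartAt 𝓘(ℝ, F) x₀ with he
  set o : L ⧸ S := ((1 : L) : L ⧸ S) with ho
  have hx₀ : x₀ ∈ e.source := mem_extChartAt_source x₀
  have hl : e.symm (e x₀) = x₀ := e.left_inv hx₀
  have ht := e.map_source hx₀
  have hσo : ∀ y, (σ y : L ⧸ S) = y → (σ y)⁻¹ • y = o := by
    intro y hy
    rw [inv_smul_eq_iff, ho, MulAction.Quotient.smul_coe, smul_eq_mul, mul_one, hy]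
  -- The second-variable derivative of C on the diagonal is the differential of σ(y)⁻¹ at y, for the
  -- smooth local section σ. It depends smoothly on y, and q applied to it is the translated form.
  let C : F × F → F := fun z =>
    extChartAt 𝓘(ℝ, F) o ((σ (e.symm z.1))⁻¹ • e.symm z.2)
  have hC : ContDiffAt ℝ ∞ C (e x₀, e x₀) := by
    have h1 : ContMDiffAt 𝓘(ℝ, F × F) 𝓘(ℝ, F) ∞ (fun z : F × F => e.symm z.1) (e x₀, e x₀) :=
      ContMDiffAt.comp (g := e.symm) (e x₀, e x₀) (contMDiffAt_chart_symm ht)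
        contDiff_fst.contMDiff.contMDiffAt
    have h2 : ContMDiffAt 𝓘(ℝ, F × F) 𝓘(ℝ, F) ∞ (fun z : F × F => e.symm z.2) (e x₀, e x₀) :=
      ContMDiffAt.comp (g := e.symm) (e x₀, e x₀) (contMDiffAt_chart_symm ht)
        contDiff_snd.contMDiff.contMDiffAt
    have h3 : ContMDiffAt 𝓘(ℝ, F × F) 𝓘(ℝ, E) ∞ (fun z : F × F => σ (e.symm z.1)) (e x₀, e x₀) :=
      ContMDiffAt.comp_of_eq (g := σ) hσ h1 hl
    refine contDiffAt_chart_comp (h3.inv.smul (I := 𝓘(ℝ, E)) h2) ?_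
    change (σ (e.symm (e x₀)))⁻¹ • e.symm (e x₀) ∈ _
    rw [hl, hσo x₀ hσr.self_of_nhds]
    exact mem_extChartAt_source o
  have hdiag : ContDiffAt ℝ ∞ (fun y : F => (y, y)) (e x₀) := contDiffAt_id.prodMk contDiffAt_id
  have hD : ∀ v, ContDiffAt ℝ ∞ (fun y => fderiv ℝ C (y, y) (0, v)) (e x₀) := fun v =>
    (ContDiffAt.comp (g := fderiv ℝ C) (f := fun y => (y, y)) (e x₀) (hC.fderiv_right (m := ∞) (by simp))
      hdiag).clm_apply contDiffAt_const
  have hsm : ContDiffAt ℝ ∞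
      (fun y => q (fderiv ℝ C (y, y) (0, v)) (fderiv ℝ C (y, y) (0, w))) (e x₀) :=
    (q.contDiff.contDiffAt.comp (e x₀) (hD v)).clm_apply (hD w)
  refine hsm.congr_of_eventuallyEq ?_
  have hev1 : ∀ᶠ y in 𝓝 (e x₀), ContDiffAt ℝ 1 C (y, y) :=
    (hdiag.continuousAt.eventually (hC.of_le (m := 1) ENat.LEInfty.out |>.eventually (by simp)))
  have hcs : ContinuousAt e.symm (e x₀) := (contMDiffAt_chart_symm ht).continuousAt
  have hev2 : ∀ᶠ y in 𝓝 (e x₀), (σ (e.symm y) : L ⧸ S) = e.symm y :=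
    hcs.eventually (by rwa [hl])
  filter_upwards [hev1, hev2, extChartAt_target_mem_nhds' (I := 𝓘(ℝ, F)) ht] with y hy1 hy2 hy3
  have hfy : (σ (e.symm y))⁻¹ • e.symm y = o := hσo _ hy2
  have key : ∀ v, fderiv ℝ C (y, y) (0, v)
      = actDiff F (σ (e.symm y))⁻¹ (e.symm y) (chartFrame x₀ y v) := by
    intro v
    rw [← fderiv_snd_apply (hy1.differentiableAt (by simp))]
    have hd : MDifferentiableAt 𝓘(ℝ, F) 𝓘(ℝ, F) e.symm y :=
      (contMDiffAt_chart_symm hy3).mdifferentiableAt (by simp)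
    have h1 := actDiff_comp E hd (σ (e.symm y))⁻¹ v
    have hd2 : MDifferentiableAt 𝓘(ℝ, F) 𝓘(ℝ, F) (fun z => (σ (e.symm y))⁻¹ • e.symm z) y := by
      have h4 : MDifferentiableAt 𝓘(ℝ, F) 𝓘(ℝ, F) (fun x : L ⧸ S => (σ (e.symm y))⁻¹ • x)
        (e.symm y) := (contMDiff_const_smul' E _).mdifferentiableAt (by simp)
      exact MDifferentiableAt.comp y h4 hd
    have h2 := mfderiv_eq_chartFrame (x₀ := o) hd2 (by rw [hfy]; exact mem_extChartAt_source o) v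
    rw [hfy, chartFrame_self] at h2
    exact h2.symm.trans h1
  rw [key, key, ← translatedForm_eq hM hq hy2]
  rfl

theorem exists_invariantMetric (hM : IsHomogeneousManifold E F S) (q : F →L[ℝ] F →L[ℝ] ℝ)
    (symm : ∀ v w, q v w = q w v) (pos : ∀ v, v ≠ 0 → 0 < q v v)
    (hq : ∀ s ∈ S, ∀ v w, q (actDiff F s ((1 : L) : L ⧸ S) v) (actDiff F s ((1 : L) : L ⧸ S) w)
      = q v w) :
    ∃ g : SmoothMetric F (L ⧸ S), IsInvariantMetric L g ∧
      ∀ v w, innerAt g ((1 : L) : L ⧸ S) v w = q v w := by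
  have := hM.smooth_smul
  have hpos : ∀ (x : L ⧸ S) (v : F), v ≠ 0 → 0 < translatedForm q x v v := by
    intro x v hv
    refine pos _ fun h0 => hv ?_
    have h1 := actDiff_apply_inv (F := F) E x.out (x.out⁻¹ • x) v
    rw [smul_inv_smul] at h1
    exact h1.symm.trans ((congrArg _ h0).trans (map_zero _))
  let g : SmoothMetric F (L ⧸ S) := SmoothMetric.ofChartForm
    (fun x : L ⧸ S => translatedForm (F := F) q x) (fun x v w => symm _ _) hpos
    (contDiffAt_chartForm_translatedForm hM hq)
  have hgq : ∀ (x : L ⧸ S) (v w : F), innerAt g x v w = translatedForm q x v w :=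
    fun _ _ _ => rfl
  refine ⟨g, isInvariantMetric_iff.2 fun a x v w => ?_, fun v w => ?_⟩
  · obtain ⟨c, rfl⟩ := QuotientGroup.mk_surjective x
    have h1 : ((a * c : L) : L ⧸ S) = a • (c : L ⧸ S) := rfl
    rw [hgq, hgq, translatedForm_eq hM hq h1, translatedForm_eq hM hq (a := c) rfl, mul_inv_rev,
      actDiff_mul E, actDiff_mul E, actDiff_inv_apply E, actDiff_inv_apply E, inv_smul_smul]
  · rw [hgq, translatedForm_eq hM hq (a := 1) rfl, inv_one, actDiff_one, actDiff_one]

theorem SmoothMetric.ext_innerAt {F : Type*} [NormedAddCommGroup F] [NormedSpace ℝ F]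
    {M : Type*} [TopologicalSpace M] [ChartedSpace F M] [IsManifold 𝓘(ℝ, F) ∞ M]
    {g g' : SmoothMetric F M} (h : ∀ x v w, innerAt g x v w = innerAt g' x v w) : g = g' := by
  have h1 : g.inner = g'.inner := by
    funext x
    ext v w
    exact h x v w
  cases g
  cases g'
  simp only at h1
  subst h1
  rfl

theorem eq_of_isInvariantMetric (hM : IsHomogeneousManifold E F S) {g g' : SmoothMetric F (L ⧸ S)}
    (hg : IsInvariantMetric L g) (hg' : IsInvariantMetric L g')
    (h : ∀ v w, innerAt g ((1 : L) : L ⧸ S) v w = innerAt g' ((1 : L) : L ⧸ S) v w) : g = g' := by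
  have := hM.smooth_smul
  refine SmoothMetric.ext_innerAt fun x v w => ?_
  obtain ⟨a, rfl⟩ := exists_smul_one_eq x
  rw [← actDiff_apply_inv (F := F) E a ((1 : L) : L ⧸ S) v,
    ← actDiff_apply_inv (F := F) E a ((1 : L) : L ⧸ S) w,
    isInvariantMetric_iff.1 hg, isInvariantMetric_iff.1 hg', h]

end InvariantMetrics

/-! ### Orbits of subgroups in GO-spaces -/

section TotallyGeodesicOrbits

set_option linter.unusedSectionVars false

theorem IsGeodesicOn.congr {F : Type*} [NormedAddCommGroup F] [NormedSpace ℝ F]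
    {M : Type*} [TopologicalSpace M] [ChartedSpace F M] [IsManifold 𝓘(ℝ, F) ∞ M]
    {g : SmoothMetric F M} {γ₁ γ₂ : ℝ → M} {J : Set ℝ} (h : IsGeodesicOn g γ₁ J) (hJ : IsOpen J)
    (heq : Set.EqOn γ₂ γ₁ J) : IsGeodesicOn g γ₂ J := by
  refine ⟨h.1.congr heq, fun x₀ t ht hx w => ?_⟩
  have h1 : (fun s => extChartAt 𝓘(ℝ, F) x₀ (γ₂ s)) =ᶠ[𝓝 t]
      fun s => extChartAt 𝓘(ℝ, F) x₀ (γ₁ s) := by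
    filter_upwards [hJ.mem_nhds ht] with s hs
    rw [heq hs]
  have h2 := h.2 x₀ t ht (by rwa [← heq ht]) w
  rwa [h1.deriv.deriv_eq, h1.deriv_eq, heq ht]

variable {E : Type*} [NormedAddCommGroup E] [NormedSpace ℝ E] [FiniteDimensional ℝ E]
  {G : Type*} [TopologicalSpace G] [ChartedSpace E G] [Group G] [LieGroup 𝓘(ℝ, E) ∞ G] [T2Space G]
  {H : Subgroup G} {F : Type*} [NormedAddCommGroup F] [NormedSpace ℝ F] [FiniteDimensional ℝ F]
  [ChartedSpace F (G ⧸ H)] [IsManifold 𝓘(ℝ, F) ∞ (G ⧸ H)]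
  {E' : Type*} [NormedAddCommGroup E'] [NormedSpace ℝ E'] [FiniteDimensional ℝ E']
  {K : Type*} [TopologicalSpace K] [ChartedSpace E' K] [Group K] [LieGroup 𝓘(ℝ, E') ∞ K]
  {ι : K →* G}
  {F' : Type*} [NormedAddCommGroup F'] [NormedSpace ℝ F'] [FiniteDimensional ℝ F']
  [ChartedSpace F' (K ⧸ H.comap ι)] [IsManifold 𝓘(ℝ, F') ∞ (K ⧸ H.comap ι)]
  {g : SmoothMetric F (G ⧸ H)}

/-- The metric induced by an invariant metric on an orbit is invariant. -/
theorem exists_inducedMetric [T2Space K] (hM : IsHomogeneousManifold E F H)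
    (hι : ContMDiff 𝓘(ℝ, E') 𝓘(ℝ, E) ∞ ι) (hP : IsHomogeneousManifold E' F' (H.comap ι))
    (hg : IsInvariantMetric G g) :
    ∃ gP : SmoothMetric F' (K ⧸ H.comap ι), IsInvariantMetric K gP ∧
      ∀ x v w, innerAt gP x v w = innerAt g (orbitMap H ι x)
        (orbitDiff F F' H ι x v) (orbitDiff F F' H ι x w) := by
  have := hM.smooth_smul
  have := hP.smooth_smul
  set o' : K ⧸ H.comap ι := ((1 : K) : K ⧸ H.comap ι) with ho'
  -- The pullback is formed at the initial point only and then spread by K; equivariance of the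
  -- orbit map identifies the result with the pullback everywhere.
  let q : F' →L[ℝ] F' →L[ℝ] ℝ := (innerAt g (orbitMap H ι o')).bilinearComp
    (orbitDiff F F' H ι o') (orbitDiff F F' H ι o')
  have hq : ∀ v w, q v w = innerAt g (orbitMap H ι o')
    (orbitDiff F F' H ι o' v) (orbitDiff F F' H ι o' w) := fun _ _ => rfl
  obtain ⟨gP, hgP, hgq⟩ := exists_invariantMetric hP q (fun v w => innerAt_symm g _ _ _)
    (fun v hv => innerAt_pos g _ fun h0 =>
      hv (orbitDiff_injective hM hι hP o' (h0.trans (map_zero _).symm)))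
    (fun s hs v w => by
      have hs' : s • o' = o' := smul_one_eq_one_iff.2 hs
      have h1 := orbitDiff_actDiff (E' := E') hM hι hP s o'
      rw [hs'] at h1
      have h2 := isInvariantMetric_iff.1 hg (ι s) (orbitMap H ι o')
      rw [← orbitMap_smul, hs'] at h2
      rw [hq, hq, h1, h1, h2])
  refine ⟨gP, hgP, fun x v w => ?_⟩
  obtain ⟨k, rfl⟩ := exists_smul_one_eq x
  rw [← actDiff_apply_inv (F := F') E' k o' v, ← actDiff_apply_inv (F := F') E' k o' w,
    isInvariantMetric_iff.1 hgP, hgq, hq, orbitDiff_actDiff hM hι hP, orbitDiff_actDiff hM hι hP,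
    orbitMap_smul, isInvariantMetric_iff.1 hg]

variable {gP : SmoothMetric F' (K ⧸ H.comap ι)}

/-- The condition for K tests only brackets with elements of 𝔨, and the differential of ι preserves
brackets. -/
theorem isGeodesicVector_of_lieHom [T2Space K] (hM : IsHomogeneousManifold E F H)
    (hι : ContMDiff 𝓘(ℝ, E') 𝓘(ℝ, E) ∞ ι) (hP : IsHomogeneousManifold E' F' (H.comap ι))
    (hgP : ∀ x v w, innerAt gP x v w = innerAt g (orbitMap H ι x)
        (orbitDiff F F' H ι x v) (orbitDiff F F' H ι x w)) {X : E'}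
    (hX : IsGeodesicVector G g ((1 : G) : G ⧸ H) (lieHom E E' ι X)) :
    IsGeodesicVector K gP ((1 : K) : K ⧸ H.comap ι) X := by
  intro Y
  rw [hgP, orbitDiff_actVec hM hι hP, orbitDiff_actVec hM hι hP, lieHom_lieBracketModel hι,
    orbitMap_one]
  exact hX _

/-- A geodesic vector of G over a vector tangent to the orbit differs from an element of 𝔨 by an
element of 𝔥 ⊆ 𝔨, so it lies in 𝔨. -/
theorem exists_isGeodesicVector_lieHom [T2Space K] [ConnectedSpace K]
    (hM : IsHomogeneousManifold E F H) (hι : IsLieSubgroup (E := E) (E' := E') ι)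
    (hHK : H ≤ ι.range) (hP : IsHomogeneousManifold E' F' (H.comap ι)) (hg : IsGOMetric E G g)
    (v : F') : ∃ X : E', IsGeodesicVector G g ((1 : G) : G ⧸ H) (lieHom E E' ι X) ∧
      actVec E' K F' ((1 : K) : K ⧸ H.comap ι) X = v := by
  have := hM.smooth_smul
  have : CompleteSpace E := FiniteDimensional.complete ℝ E
  obtain ⟨Z, rfl⟩ := hP.actVec_one_surjective v
  obtain ⟨V, hV, hVZ⟩ := hg.exists_isGeodesicVector
    (actVec_surjective_of_transitive exists_smul_one_eq hM.actVec_one_surjective)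
    ((1 : G) : G ⧸ H) (actVec E G F ((1 : G) : G ⧸ H) (lieHom E E' ι Z))
  obtain ⟨W, hW⟩ := hι.subgroupLieAlgebra_subset hHK
    ((mem_subgroupLieAlgebra_iff (F := F) (V - lieHom E E' ι Z)).2 (by
      rw [map_sub, hVZ, sub_self]))
  have hVX : lieHom E E' ι (Z + W) = V := by rw [map_add, hW]; abel
  refine ⟨Z + W, by rwa [hVX], ?_⟩
  refine orbitDiff_injective hM hι.contMDiff hP ((1 : K) : K ⧸ H.comap ι) ?_
  rw [orbitDiff_actVec hM hι.contMDiff hP, orbitDiff_actVec hM hι.contMDiff hP, hVX, hVZ]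

theorem isGOMetric_inducedMetric [T2Space K] [ConnectedSpace K] [T2Space (K ⧸ H.comap ι)]
    (hM : IsHomogeneousManifold E F H) (hι : IsLieSubgroup (E := E) (E' := E') ι)
    (hHK : H ≤ ι.range) (hP : IsHomogeneousManifold E' F' (H.comap ι)) (hg : IsGOMetric E G g)
    (hgPi : IsInvariantMetric K gP)
    (hgP : ∀ x v w, innerAt gP x v w = innerAt g (orbitMap H ι x)
        (orbitDiff F F' H ι x v) (orbitDiff F F' H ι x w)) : IsGOMetric E' K gP := by
  have := hP.smooth_smul
  have : CompleteSpace E' := FiniteDimensional.complete ℝ E'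
  refine isGOMetric_of_isGeodesicVector hgPi
    (actVec_surjective_of_transitive exists_smul_one_eq hP.actVec_one_surjective)
    (o := ((1 : K) : K ⧸ H.comap ι)) exists_smul_one_eq fun v => ?_
  obtain ⟨X, hX, hXv⟩ := exists_isGeodesicVector_lieHom hM hι hHK hP hg v
  exact ⟨X, isGeodesicVector_of_lieHom hM hι.contMDiff hP hgP hX, hXv⟩

/-- The translates of the orbit of a connected Lie subgroup containing the isotropy group are
totally geodesic. -/
theorem isTotallyGeodesic_smul_orbitMap [T2Space K] [ConnectedSpace K] [T2Space (K ⧸ H.comap ι)]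
    [T2Space (G ⧸ H)]
    (hM : IsHomogeneousManifold E F H) (hι : IsLieSubgroup (E := E) (E' := E') ι)
    (hHK : H ≤ ι.range) (hP : IsHomogeneousManifold E' F' (H.comap ι)) (hg : IsGOMetric E G g)
    (hgPi : IsInvariantMetric K gP)
    (hgP : ∀ x v w, innerAt gP x v w = innerAt g (orbitMap H ι x)
        (orbitDiff F F' H ι x v) (orbitDiff F F' H ι x w)) (a : G) :
    IsTotallyGeodesic gP g (fun x => a • orbitMap H ι x) := by
  have := hM.smooth_smul
  have := hP.smooth_smul
  have : CompleteSpace E := FiniteDimensional.complete ℝ E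
  have : CompleteSpace E' := FiniteDimensional.complete ℝ E'
  have hsm := contMDiff_orbitMap hM hι.contMDiff hP
  have hsurj : ∀ x : G ⧸ H, Function.Surjective (actVec E G F x) :=
    actVec_surjective_of_transitive exists_smul_one_eq hM.actVec_one_surjective
  have hd : ∀ (x : K ⧸ H.comap ι) (v : F'),
      (mfderiv 𝓘(ℝ, F') 𝓘(ℝ, F) (fun x => a • orbitMap H ι x) x v : F)
        = actDiff F a (orbitMap H ι x) (orbitDiff F F' H ι x v) := fun x v =>
    actDiff_comp E (hsm.mdifferentiableAt (by simp)) a v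
  refine ⟨⟨(contMDiff_const_smul' E a).comp hsm, fun x => ?_, fun x v w => ?_⟩,
    fun γ J hJ hJc hγ => ?_⟩
  · intro v w hvw
    have h1 := (hd x v).symm.trans (hvw.trans (hd x w))
    have h2 := congrArg (actDiff F a⁻¹ (a • orbitMap H ι x)) h1
    rw [actDiff_inv_apply E, actDiff_inv_apply E] at h2
    exact orbitDiff_injective hM hι.contMDiff hP x h2
  · have key : ∀ A B A' B' : F, A = A' → B = B' → innerAt g (a • orbitMap H ι x) A B
        = innerAt g (a • orbitMap H ι x) A' B' := by rintro _ _ _ _ rfl rfl; rfl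
    refine (hgP x v w).trans ?_
    rw [← isInvariantMetric_iff.1 hg.1 a]
    exact key _ _ _ _ (hd x v).symm (hd x w).symm
  · rcases J.eq_empty_or_nonempty with rfl | ⟨t₀, ht₀⟩
    · exact ⟨fun t ht => ht.elim, fun x₀ t ht => ht.elim⟩
    -- The geodesic of the orbit is written with a generator that is a geodesic vector for G, so its
    -- image is a translate of a geodesic of G/H.
    obtain ⟨k, φ, hφ, hX, h⟩ := exists_orbit_of_isGeodesicOn hgPi
      (actVec_surjective_of_transitive exists_smul_one_eq hP.actVec_one_surjective)
      (o := ((1 : K) : K ⧸ H.comap ι)) exists_smul_one_eq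
      (S := {X : E' | IsGeodesicVector G g ((1 : G) : G ⧸ H) (lieHom E E' ι X)})
      (fun X hX => isGeodesicVector_of_lieHom hM hι.contMDiff hP hgP hX)
      (fun v => exists_isGeodesicVector_lieHom hM hι hHK hP hg v) hJ hJc hγ ht₀
    have hφ' := isOneParameterSubgroup_comp hι.contMDiff hφ
    have h1 : IsGeodesicVector G g ((1 : G) : G ⧸ H) (velocity E (fun t => ι (φ t)) 0) := by
      rw [velocity_comp_hom hι.contMDiff hφ]; exact hX
    have h2 := ((IsGeodesicVector.isGeodesicOn hg.1 hsurj hφ' h1).comp_add hg.1 hsurj isOpen_univ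
      (-t₀)).smul hg.1 hsurj isOpen_univ (a * ι k)
    refine (h2.mono (Set.subset_univ J)).congr hJ fun t ht => ?_
    simp only
    rw [h t ht, orbitMap_smul, orbitMap_smul, orbitMap_one, mul_smul, sub_eq_add_neg]

end TotallyGeodesicOrbits

/-! ### Normal spaces of orbits -/

section LieBracketModel

set_option linter.unusedSectionVars false

variable {E : Type*} [NormedAddCommGroup E] [NormedSpace ℝ E] [FiniteDimensional ℝ E]
  {L : Type*} [TopologicalSpace L] [ChartedSpace E L] [Group L] [LieGroup 𝓘(ℝ, E) ∞ L]

theorem lieBracketModel_add_left (X X' Y : E) :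
    lieBracketModel L (X + X') Y = lieBracketModel L X Y + lieBracketModel L X' Y := by
  have : CompleteSpace E := FiniteDimensional.complete ℝ E
  rw [← mfderiv_adjointMap, ← mfderiv_adjointMap, ← mfderiv_adjointMap]
  exact map_add (mfderiv 𝓘(ℝ, E) 𝓘(ℝ, E) (fun a : L => (adjointMap E a Y : E)) 1) X X'

theorem lieBracketModel_self (X : E) : lieBracketModel L X X = 0 := by
  have : CompleteSpace E := FiniteDimensional.complete ℝ E
  exact lie_self (L := GroupLieAlgebra 𝓘(ℝ, E) L) X

theorem lieBracketModel_add_right (X Y Y' : E) :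
    lieBracketModel L X (Y + Y') = lieBracketModel L X Y + lieBracketModel L X Y' := by
  have : CompleteSpace E := FiniteDimensional.complete ℝ E
  exact lie_add (L := GroupLieAlgebra 𝓘(ℝ, E) L) (M := GroupLieAlgebra 𝓘(ℝ, E) L) X Y Y'

end LieBracketModel

theorem LinearMap.BilinForm.exists_orthogonal_decomposition {V : Type*} [AddCommGroup V]
    [Module ℝ V] [FiniteDimensional ℝ V] {b : LinearMap.BilinForm ℝ V}
    (symm : ∀ X Y, b X Y = b Y X) (pos : ∀ X, X ≠ 0 → 0 < b X X) (W : Submodule ℝ V) (X : V) :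
    ∃ Y ∈ W, ∀ Z ∈ W, b Z (X - Y) = 0 := by
  have key : ∀ x : W, b x x = 0 → x = 0 := fun x hx => by
    by_contra h
    exact (pos x (fun h0 => h (Subtype.ext h0))).ne' hx
  have hc := LinearMap.BilinForm.isCompl_orthogonal_of_restrict_nondegenerate (B := b) (W := W)
    (fun x y h => (symm y x).trans h) ⟨fun x hx => key x (hx x), fun x hx => key x (hx x)⟩
  obtain ⟨Y, hY, Z, hZ, rfl⟩ := Submodule.mem_sup.1 (hc.sup_eq_top.ge (Submodule.mem_top (x := X)))
  refine ⟨Y, hY, fun W' hW' => ?_⟩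
  rw [add_sub_cancel_left]
  exact hZ W' hW'

/-! ### The normal space as a complement of 𝔨 -/

section NormalPart

set_option linter.unusedSectionVars false

variable {E : Type*} [NormedAddCommGroup E] [NormedSpace ℝ E] [FiniteDimensional ℝ E]
  {G : Type*} [TopologicalSpace G] [ChartedSpace E G] [Group G] [LieGroup 𝓘(ℝ, E) ∞ G] [T2Space G]
  {H : Subgroup G} {F : Type*} [NormedAddCommGroup F] [NormedSpace ℝ F] [FiniteDimensional ℝ F]
  [ChartedSpace F (G ⧸ H)] [IsManifold 𝓘(ℝ, F) ∞ (G ⧸ H)]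
  {E' : Type*} [NormedAddCommGroup E'] [NormedSpace ℝ E'] [FiniteDimensional ℝ E']
  {K : Type*} [TopologicalSpace K] [ChartedSpace E' K] [Group K] [LieGroup 𝓘(ℝ, E') ∞ K]
  [ConnectedSpace K] {ι : K →* G} {g : SmoothMetric F (G ⧸ H)}
  {b : LinearMap.BilinForm ℝ (GroupLieAlgebra 𝓘(ℝ, E) G)}

/-- The form `g_o(X_o, Y_o)` on the model space of `G`. -/
def modelForm (g : SmoothMetric F (G ⧸ H)) : E →L[ℝ] E →L[ℝ] ℝ :=
  (innerAt g ((1 : G) : G ⧸ H)).bilinearComp (actVec E G F ((1 : G) : G ⧸ H))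
    (actVec E G F ((1 : G) : G ⧸ H))

theorem modelForm_apply (X Y : E) : modelForm g X Y =
    innerAt g ((1 : G) : G ⧸ H) (actVec E G F ((1 : G) : G ⧸ H) X)
      (actVec E G F ((1 : G) : G ⧸ H) Y) := rfl

theorem modelForm_symm (X Y : E) : modelForm g X Y = modelForm g Y X := innerAt_symm _ _ _ _

theorem actVec_eq_zero_of_modelForm {X : E} (h : modelForm g X X = 0) :
    actVec E G F ((1 : G) : G ⧸ H) X = 0 := by
  by_contra h0
  exact (innerAt_pos g _ h0).ne' h

theorem originForm_eq_modelForm (X Y : E) : originForm (E := E) H g X Y = modelForm g X Y := by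
  have key : ∀ A B A' B' : F, A = A' → B = B' → innerAt g ((1 : G) : G ⧸ H) A B
        = innerAt g ((1 : G) : G ⧸ H) A' B' := by rintro _ _ _ _ rfl rfl; rfl
  exact key _ _ _ _ (projDiff_eq_actVec X) (projDiff_eq_actVec Y)

theorem mem_reductiveComplement_iff [ContMDiffSMul 𝓘(ℝ, E) 𝓘(ℝ, F) ∞ G (G ⧸ H)] {Y : E} :
    Y ∈ reductiveComplement b H ↔
      ∀ X : E, actVec E G F ((1 : G) : G ⧸ H) X = 0 → b X Y = 0 :=
  ⟨fun h X hX => h X ((mem_subgroupLieAlgebra_iff (E := E) (F := F) X).2 hX),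
    fun h X hX => h X ((mem_subgroupLieAlgebra_iff (E := E) (F := F) X).1 hX)⟩

theorem exists_reductive_decomposition [ContMDiffSMul 𝓘(ℝ, E) 𝓘(ℝ, F) ∞ G (G ⧸ H)]
    (hb : IsInvariantEuclidean b) (X : E) : ∃ X₁ X₂ : E, X = X₁ + X₂ ∧
      actVec E G F ((1 : G) : G ⧸ H) X₁ = 0 ∧ X₂ ∈ reductiveComplement b H := by
  have : FiniteDimensional ℝ (GroupLieAlgebra 𝓘(ℝ, E) G) :=
    inferInstanceAs (FiniteDimensional ℝ E)
  obtain ⟨Y, hY, h⟩ := LinearMap.BilinForm.exists_orthogonal_decomposition hb.symm hb.pos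
    (LinearMap.ker (actVec E G F ((1 : G) : G ⧸ H)).toLinearMap :
      Submodule ℝ E) X
  let Y' : E := Y
  exact ⟨Y', X - Y', (add_sub_cancel Y' X).symm, hY,
    (mem_reductiveComplement_iff (E := E) (F := F)).2 fun Z hZ => h Z hZ⟩

theorem metricEndomorphism_apply (hb : IsInvariantEuclidean b) (X Y : reductiveComplement b H) :
    b (metricEndomorphism hb H g X : GroupLieAlgebra 𝓘(ℝ, E) G) Y
      = originForm H g (X : GroupLieAlgebra 𝓘(ℝ, E) G) Y := by
  have : FiniteDimensional ℝ (GroupLieAlgebra 𝓘(ℝ, E) G) :=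
    inferInstanceAs (FiniteDimensional ℝ E)
  exact LinearMap.BilinForm.symmCompOfNondegenerate_left_apply
    ((originForm H g).restrict (reductiveComplement b H))
    (hb.restrict_nondegenerate (reductiveComplement b H)) Y X

/-- AX = 0 makes X null for the form on 𝔤, so X lies in 𝔥; being also in 𝔪, it is orthogonal to
itself. -/
theorem metricEndomorphism_injective [ContMDiffSMul 𝓘(ℝ, E) 𝓘(ℝ, F) ∞ G (G ⧸ H)]
    (hb : IsInvariantEuclidean b) : Function.Injective (metricEndomorphism hb H g) := by
  rw [injective_iff_map_eq_zero]
  intro X hX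
  have h1 := metricEndomorphism_apply (g := g) hb X X
  rw [hX] at h1
  let X' : E := (X : GroupLieAlgebra 𝓘(ℝ, E) G)
  have h2 : modelForm g X' X' = 0 :=
    (originForm_eq_modelForm X' X').symm.trans (h1.symm.trans (DFunLike.congr_fun (map_zero b) _))
  by_contra h
  exact (hb.pos X (fun h0 => h (Subtype.ext h0))).ne'
    ((mem_reductiveComplement_iff (E := E) (F := F)).1 X.2 X' (actVec_eq_zero_of_modelForm h2))

/-- If `𝔭` is invariant under the metric endomorphism, then `𝔭^⊥` is the orthogonal complement of
`𝔨` with respect to the invariant Euclidean metric. -/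
theorem mem_normalPart_iff (hM : IsHomogeneousManifold E F H)
    (hι : IsLieSubgroup (E := E) (E' := E') ι) (hHK : H ≤ ι.range) (hb : IsInvariantEuclidean b)
    (hA : ∀ X : reductiveComplement b H,
      (X : GroupLieAlgebra 𝓘(ℝ, E) G) ∈ tangentPart E' b H ι →
        (metricEndomorphism hb H g X : GroupLieAlgebra 𝓘(ℝ, E) G) ∈ tangentPart E' b H ι) (Y : E) :
    Y ∈ normalPart E' b H g ι ↔ ∀ X : E', b (lieHom E E' ι X) Y = 0 := by
  have := hM.smooth_smul
  constructor
  · rintro ⟨hY, hYp⟩ X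
    obtain ⟨X₁, X₂, hX, hX₁, hX₂⟩ := exists_reductive_decomposition (F := F) (H := H) hb (lieHom E E' ι X)
    obtain ⟨Z, hZ⟩ := hι.subgroupLieAlgebra_subset hHK ((mem_subgroupLieAlgebra_iff (F := F) X₁).2 hX₁)
    -- The 𝔪-component of an element of 𝔨 stays in 𝔨 because 𝔥 ⊆ 𝔨, so 𝔨 = 𝔥 + 𝔭.
    have hX₂k : X₂ ∈ lieSubgroupAlgebra (E := E) E' ι :=
      ⟨X - Z, (map_sub (lieHom E E' ι) X Z).trans (by rw [hX, hZ]; abel)⟩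
    let p : Submodule ℝ (reductiveComplement b H) :=
      (tangentPart E' b H ι).comap (reductiveComplement b H).subtype
    have : FiniteDimensional ℝ (GroupLieAlgebra 𝓘(ℝ, E) G) :=
      inferInstanceAs (FiniteDimensional ℝ E)
    -- An injective endomorphism of the finite-dimensional 𝔭 is onto, so X₂ = AU with U in 𝔭, and
    -- b(X₂, Y) = g(U, Y) = 0.
    have hinj : Function.Injective ((metricEndomorphism hb H g).restrict (p := p) (q := p) hA) :=
      fun x y h => Subtype.ext (metricEndomorphism_injective (g := g) hb (congrArg Subtype.val h))
    obtain ⟨⟨U, hU⟩, hUX⟩ := LinearMap.injective_iff_surjective.1 hinj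
      ⟨⟨X₂, hX₂⟩, ⟨hX₂k, hX₂⟩⟩
    have hUX' : (metricEndomorphism hb H g U : GroupLieAlgebra 𝓘(ℝ, E) G) = X₂ :=
      congrArg (fun z : p => ((z : reductiveComplement b H) : GroupLieAlgebra 𝓘(ℝ, E) G)) hUX
    have h2 : b X₂ Y = 0 := by
      have h3 := metricEndomorphism_apply (g := g) hb U ⟨Y, hY⟩
      rw [hUX'] at h3
      exact h3.trans (hYp U hU)
    have h4 : b X₁ Y = 0 := (mem_reductiveComplement_iff (E := E) (F := F)).1 hY X₁ hX₁
    rw [hX]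
    refine (DFunLike.congr_fun (map_add b X₁ X₂) Y).trans ?_
    exact (congrArg₂ (· + ·) h4 h2).trans (add_zero 0)
  · intro h
    have hk : ∀ X ∈ lieSubgroupAlgebra (E := E) E' ι, b X Y = 0 := by
      rintro _ ⟨X, rfl⟩
      exact h X
    have hY : Y ∈ reductiveComplement b H := by
      intro X hX
      obtain ⟨Z, hZ⟩ := hι.subgroupLieAlgebra_subset hHK hX
      exact hk X ⟨Z, hZ⟩
    refine ⟨hY, fun X hX => ?_⟩
    exact (metricEndomorphism_apply (g := g) hb ⟨X, hX.2⟩ ⟨Y, hY⟩).symm.trans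
      (hk _ (hA ⟨X, hX.2⟩ hX).1)

/-- By 𝔨 = 𝔥 + 𝔭: elements of 𝔥 vanish at o, and 𝔭 is orthogonal to 𝔭^⊥ by definition. -/
theorem modelForm_lieHom_of_mem_normalPart (hM : IsHomogeneousManifold E F H)
    (hι : IsLieSubgroup (E := E) (E' := E') ι) (hHK : H ≤ ι.range) (hb : IsInvariantEuclidean b)
    {Y : E} (hY : Y ∈ normalPart E' b H g ι) (X : E') : modelForm g (lieHom E E' ι X) Y = 0 := by
  have := hM.smooth_smul
  obtain ⟨X₁, X₂, hX, hX₁, hX₂⟩ := exists_reductive_decomposition (F := F) (H := H) hb (lieHom E E' ι X)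
  obtain ⟨Z, hZ⟩ := hι.subgroupLieAlgebra_subset hHK ((mem_subgroupLieAlgebra_iff (F := F) X₁).2 hX₁)
  have hX₂k : X₂ ∈ lieSubgroupAlgebra (E := E) E' ι :=
    ⟨X - Z, (map_sub (lieHom E E' ι) X Z).trans (by rw [hX, hZ]; abel)⟩
  have h1 : modelForm (E := E) g X₂ Y = 0 := by
    rw [← originForm_eq_modelForm]; exact hY.2 X₂ ⟨hX₂k, hX₂⟩
  rw [hX, map_add, add_apply, h1, add_zero, modelForm_apply, hX₁, map_zero, zero_apply]

end NormalPart

/-! ### Invariance of normal spaces -/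

section NormalInvariance

set_option linter.unusedSectionVars false

variable {E : Type*} [NormedAddCommGroup E] [NormedSpace ℝ E] [FiniteDimensional ℝ E]
  {G : Type*} [TopologicalSpace G] [ChartedSpace E G] [Group G] [LieGroup 𝓘(ℝ, E) ∞ G] [T2Space G]
  {H : Subgroup G} {F : Type*} [NormedAddCommGroup F] [NormedSpace ℝ F] [FiniteDimensional ℝ F]
  [ChartedSpace F (G ⧸ H)] [IsManifold 𝓘(ℝ, F) ∞ (G ⧸ H)]
  {E' : Type*} [NormedAddCommGroup E'] [NormedSpace ℝ E'] [FiniteDimensional ℝ E']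
  {K : Type*} [TopologicalSpace K] [ChartedSpace E' K] [Group K] [LieGroup 𝓘(ℝ, E') ∞ K]
  {ι : K →* G} {g : SmoothMetric F (G ⧸ H)}
  {β : LinearMap.BilinForm ℝ E} {N : Submodule ℝ E}

/-- Both β and the image of Lie(K) are invariant under Ad(ι(k)), hence so is the β-complement. -/
theorem adjointMap_mem_of_orthogonal (hι : ContMDiff 𝓘(ℝ, E') 𝓘(ℝ, E) ∞ ι)
    (hβ : ∀ (a : G) X Y, β (adjointMap E a X) (adjointMap E a Y) = β X Y)
    (hN : ∀ Y, Y ∈ N ↔ ∀ X : E', β (lieHom E E' ι X) Y = 0) (k : K) {Y : E} (hY : Y ∈ N) :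
    adjointMap E (ι k) Y ∈ N := by
  rw [hN] at hY ⊢
  intro X
  have h1 : lieHom E E' ι X = adjointMap E (ι k) (lieHom E E' ι (adjointMap E' k⁻¹ X)) := by
    rw [lieHom_adjointMap hι, map_inv, adjointMap_apply_inv]
  rw [h1, hβ, hY]

/-- The infinitesimal version: differentiate β(Z, Ad(ι(ψ(s)))Y) = 0 at s = 0. -/
theorem lieBracketModel_mem_of_orthogonal [T2Space K] (hι : ContMDiff 𝓘(ℝ, E') 𝓘(ℝ, E) ∞ ι)
    (hβ : ∀ (a : G) X Y, β (adjointMap E a X) (adjointMap E a Y) = β X Y)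
    (hN : ∀ Y, Y ∈ N ↔ ∀ X : E', β (lieHom E E' ι X) Y = 0) (X : E') {Y : E} (hY : Y ∈ N) :
    lieBracketModel G (lieHom E E' ι X) Y ∈ N := by
  have : CompleteSpace E := FiniteDimensional.complete ℝ E
  have : CompleteSpace E' := FiniteDimensional.complete ℝ E'
  obtain ⟨ψ, hψ, hX⟩ := exists_isOneParameterSubgroup (L := K) X
  have hX' : X = velocity E' ψ 0 := hX
  rw [hN]
  intro Z
  have h1 := (LinearMap.toContinuousLinearMap (β (lieHom E E' ι Z))).hasFDerivAt.comp_hasDerivAt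
    (0 : ℝ) (hasDerivAt_adjointMap (isOneParameterSubgroup_comp hι hψ) Y 0)
  have h2 : (LinearMap.toContinuousLinearMap (β (lieHom E E' ι Z))) ∘
      (fun s => adjointMap E (ι (ψ s)) Y) = fun _ => (0 : ℝ) := by
    funext s
    exact (hN _).1 (adjointMap_mem_of_orthogonal hι hβ hN (ψ s) hY) Z
  rw [h2] at h1
  have h3 := h1.unique (hasDerivAt_const (0 : ℝ) (0 : ℝ))
  rwa [map_zero_of_add hψ.2, map_one, adjointMap_one, velocity_comp_hom hι hψ, ← hX'] at h3

theorem modelForm_adjointMap_of_mem [ContMDiffSMul 𝓘(ℝ, E) 𝓘(ℝ, F) ∞ G (G ⧸ H)]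
    (hg : IsInvariantMetric G g) {a : G} (ha : a ∈ H) (X Y : E) :
    modelForm g (adjointMap E a X) (adjointMap E a Y) = modelForm g X Y := by
  have h1 : a • ((1 : G) : G ⧸ H) = ((1 : G) : G ⧸ H) := smul_one_eq_one_iff.2 ha
  have h2 := isInvariantMetric_iff.1 hg a ((1 : G) : G ⧸ H)
    (actVec E G F ((1 : G) : G ⧸ H) X) (actVec E G F ((1 : G) : G ⧸ H) Y)
  rw [actDiff_actVec, actDiff_actVec, h1] at h2
  exact h2

theorem hasDerivAt_modelForm_adjointMap {φ : ℝ → G} (hφ : IsOneParameterSubgroup E φ) (X Y : E) :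
    HasDerivAt (fun s => modelForm g (adjointMap E (φ s) X) (adjointMap E (φ s) Y))
      (modelForm g (lieBracketModel G (velocity E φ 0) X) Y
        + modelForm g X (lieBracketModel G (velocity E φ 0) Y)) 0 := by
  have : CompleteSpace E := FiniteDimensional.complete ℝ E
  have hX := hasDerivAt_adjointMap hφ X 0
  have hY := hasDerivAt_adjointMap hφ Y 0
  have h1 := ((modelForm g).hasFDerivAt.comp_hasDerivAt (0 : ℝ) hX).clm_apply hY
  refine h1.congr_deriv ?_
  simp only [Function.comp_apply, map_zero_of_add hφ.2, adjointMap_one]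

/-- Such W generates a one-parameter subgroup of H, which acts on the form by isometries;
differentiate. -/
theorem modelForm_lieBracketModel_of_actVec_eq_zero
    [ContMDiffSMul 𝓘(ℝ, E) 𝓘(ℝ, F) ∞ G (G ⧸ H)] (hg : IsInvariantMetric G g) {W : E}
    (hW : actVec E G F ((1 : G) : G ⧸ H) W = 0) (Y : E) :
    modelForm g Y (lieBracketModel G W Y) = 0 := by
  obtain ⟨φ, hφ, hφH, hWφ⟩ := (mem_subgroupLieAlgebra_iff (F := F) W).2 hW
  have hW' : W = velocity E φ 0 := hWφ
  have h1 := hasDerivAt_modelForm_adjointMap (g := g) hφ Y Y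
  have h2 : (fun s => modelForm g (adjointMap E (φ s) Y) (adjointMap E (φ s) Y))
      = fun _ => modelForm g Y Y := by
    funext s
    exact modelForm_adjointMap_of_mem hg (hφH s) Y Y
  rw [h2, ← hW'] at h1
  have h3 := h1.unique (hasDerivAt_const (0 : ℝ) _)
  rw [modelForm_symm] at h3
  linarith

/-- `𝔨` acts on the normal space by skew-symmetric endomorphisms. -/
theorem modelForm_lieBracketModel_self [T2Space K] [ConnectedSpace K]
    (hM : IsHomogeneousManifold E F H) (hι : IsLieSubgroup (E := E) (E' := E') ι)
    (hHK : H ≤ ι.range) (hg : IsGOMetric E G g)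
    (hβ : ∀ (a : G) X Y, β (adjointMap E a X) (adjointMap E a Y) = β X Y)
    (hN : ∀ Y, Y ∈ N ↔ ∀ X : E', β (lieHom E E' ι X) Y = 0)
    (hQN : ∀ (X : E'), ∀ Y ∈ N, modelForm g (lieHom E E' ι X) Y = 0) (X : E') {Y : E}
    (hY : Y ∈ N) : modelForm g Y (lieBracketModel G (lieHom E E' ι X) Y) = 0 := by
  have := hM.smooth_smul
  have : CompleteSpace E := FiniteDimensional.complete ℝ E
  -- A geodesic vector over X + Y, not over Y alone: its component X in 𝔨 is what survives in the
  -- bracket with Y.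
  obtain ⟨V, hV, hVX⟩ := hg.exists_isGeodesicVector
    (actVec_surjective_of_transitive exists_smul_one_eq hM.actVec_one_surjective)
    ((1 : G) : G ⧸ H) (actVec E G F ((1 : G) : G ⧸ H) (lieHom E E' ι X + Y))
  have hW : actVec E G F ((1 : G) : G ⧸ H) (V - (lieHom E E' ι X + Y)) = 0 := by
    rw [map_sub, hVX, sub_self]
  obtain ⟨Z, hZ⟩ := hι.subgroupLieAlgebra_subset hHK ((mem_subgroupLieAlgebra_iff (F := F) _).2 hW)
  have hVdec : V = lieHom E E' ι (X + Z) + Y := by rw [map_add, hZ]; abel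
  have h1 : lieBracketModel G V Y = lieBracketModel G (lieHom E E' ι (X + Z)) Y := by
    rw [hVdec, lieBracketModel_add_left, lieBracketModel_self, add_zero]
  have h2 := hV Y
  -- The geodesic condition tested on Y loses the pairing of X with [X + Z, Y], which lies in N, and
  -- the contribution of dι(Z), which lies in 𝔥.
  rw [hVX, h1, ← modelForm_apply, map_add (modelForm g), add_apply,
    hQN X _ (lieBracketModel_mem_of_orthogonal hι.contMDiff hβ hN _ hY), zero_add, map_add,
    lieBracketModel_add_left, map_add, hZ,
    modelForm_lieBracketModel_of_actVec_eq_zero hg.1 hW, add_zero] at h2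
  exact h2

/-- Polarization of `modelForm_lieBracketModel_self`. -/
theorem modelForm_lieBracketModel_skew [T2Space K] [ConnectedSpace K]
    (hM : IsHomogeneousManifold E F H) (hι : IsLieSubgroup (E := E) (E' := E') ι)
    (hHK : H ≤ ι.range) (hg : IsGOMetric E G g)
    (hβ : ∀ (a : G) X Y, β (adjointMap E a X) (adjointMap E a Y) = β X Y)
    (hN : ∀ Y, Y ∈ N ↔ ∀ X : E', β (lieHom E E' ι X) Y = 0)
    (hQN : ∀ (X : E'), ∀ Y ∈ N, modelForm g (lieHom E E' ι X) Y = 0) (X : E') {Y Z : E}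
    (hY : Y ∈ N) (hZ : Z ∈ N) :
    modelForm g (lieBracketModel G (lieHom E E' ι X) Y) Z
      + modelForm g Y (lieBracketModel G (lieHom E E' ι X) Z) = 0 := by
  have h1 := modelForm_lieBracketModel_self hM hι hHK hg hβ hN hQN X hY
  have h2 := modelForm_lieBracketModel_self hM hι hHK hg hβ hN hQN X hZ
  have h3 := modelForm_lieBracketModel_self hM hι hHK hg hβ hN hQN X (N.add_mem hY hZ)
  rw [lieBracketModel_add_right] at h3
  simp only [map_add, add_apply] at h3
  rw [modelForm_symm (lieBracketModel G (lieHom E E' ι X) Y)]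
  linarith

/-- The metric on the normal space is `Ad K`-invariant. -/
theorem modelForm_adjointMap [T2Space K] [ConnectedSpace K]
    (hM : IsHomogeneousManifold E F H) (hι : IsLieSubgroup (E := E) (E' := E') ι)
    (hHK : H ≤ ι.range) (hg : IsGOMetric E G g)
    (hβ : ∀ (a : G) X Y, β (adjointMap E a X) (adjointMap E a Y) = β X Y)
    (hN : ∀ Y, Y ∈ N ↔ ∀ X : E', β (lieHom E E' ι X) Y = 0)
    (hQN : ∀ (X : E'), ∀ Y ∈ N, modelForm g (lieHom E E' ι X) Y = 0) (k : K) {Y Z : E}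
    (hY : Y ∈ N) (hZ : Z ∈ N) :
    modelForm g (adjointMap E (ι k) Y) (adjointMap E (ι k) Z) = modelForm g Y Z := by
  have : CompleteSpace E := FiniteDimensional.complete ℝ E
  have : CompleteSpace E' := FiniteDimensional.complete ℝ E'
  let f : E → E → K → ℝ := fun Y Z c =>
    modelForm g (adjointMap E (ι c) Y) (adjointMap E (ι c) Z)
  have hf1 : ∀ Y ∈ N, ∀ Z ∈ N,
      HasMFDerivAt 𝓘(ℝ, E') 𝓘(ℝ, ℝ) (f Y Z) 1 (0 : E' →L[ℝ] ℝ) := by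
    intro Y hY Z hZ
    have hadj : ∀ Y : E, MDifferentiableAt 𝓘(ℝ, E') 𝓘(ℝ, E)
        (fun c : K => (adjointMap E (ι c) Y : E)) 1 := fun Y => by
      have h1 := (mdifferentiableAt_adjointMap (L := G) Y).1
      rw [← map_one ι] at h1
      exact MDifferentiableAt.comp (1 : K) h1 (hι.contMDiff.mdifferentiableAt (by simp))
    have hQ : MDifferentiableAt 𝓘(ℝ, E') 𝓘(ℝ, E →L[ℝ] ℝ)
        (fun c : K => modelForm g (adjointMap E (ι c) Y)) 1 :=
      MDifferentiableAt.comp (1 : K)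
        ((modelForm g).differentiable.mdifferentiable _) (hadj Y)
    have hfd : MDifferentiableAt 𝓘(ℝ, E') 𝓘(ℝ, ℝ) (f Y Z) 1 := hQ.clm_apply (hadj Z)
    have h0 : (mfderiv 𝓘(ℝ, E') 𝓘(ℝ, ℝ) (f Y Z) 1 : E' →L[ℝ] ℝ) = 0 := by
      ext X
      obtain ⟨ψ, hψ, hX⟩ := exists_isOneParameterSubgroup (L := K) X
      have hX' : X = velocity E' ψ 0 := hX
      have h1 := hfd
      rw [← map_zero_of_add hψ.2] at h1
      have h2 := HasMFDerivAt.comp (0 : ℝ) h1.hasMFDerivAt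
        (hψ.1.mdifferentiableAt (by simp)).hasMFDerivAt
      have h3 := (show HasFDerivAt (𝕜 := ℝ) (E := ℝ) (F := ℝ)
        (fun s => f Y Z (ψ s)) _ 0 from hasMFDerivAt_iff_hasFDerivAt.1 h2).hasDerivAt
      have h4 := hasDerivAt_modelForm_adjointMap (g := g)
        (isOneParameterSubgroup_comp hι.contMDiff hψ) Y Z
      rw [velocity_comp_hom hι.contMDiff hψ, ← hX',
        modelForm_lieBracketModel_skew hM hι hHK hg hβ hN hQN X hY hZ] at h4
      have key : ∀ d : K, d = 1 → ∀ v : E', (mfderiv 𝓘(ℝ, E') 𝓘(ℝ, ℝ) (f Y Z) d v : ℝ)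
        = mfderiv 𝓘(ℝ, E') 𝓘(ℝ, ℝ) (f Y Z) 1 v := by rintro _ rfl v; rfl
      rw [hX']
      exact (key _ (map_zero_of_add hψ.2) _).symm.trans (h3.unique h4)
    have h5 := hfd.hasMFDerivAt
    rwa [h0] at h5
  -- Right translation by c⁻¹ reduces to the derivative at 1, for the vectors Ad(c)Y and Ad(c)Z,
  -- which are again in N.
  have hf : ∀ c : K, HasMFDerivAt 𝓘(ℝ, E') 𝓘(ℝ, ℝ) (f Y Z) c (0 : E' →L[ℝ] ℝ) := by
    intro c
    have h1 := hf1 _ (adjointMap_mem_of_orthogonal hι.contMDiff hβ hN c hY) _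
      (adjointMap_mem_of_orthogonal hι.contMDiff hβ hN c hZ)
    rw [← mul_inv_cancel c] at h1
    have h2 : MDifferentiableAt 𝓘(ℝ, E') 𝓘(ℝ, E') (fun x : K => x * c⁻¹) c :=
      (contMDiff_mul_right (I := 𝓘(ℝ, E')) (n := ∞)).mdifferentiableAt (by simp)
    have h3 := HasMFDerivAt.comp c h1 h2.hasMFDerivAt
    have h4 : f (adjointMap E (ι c) Y) (adjointMap E (ι c) Z) ∘ (fun x : K => x * c⁻¹)
        = f Y Z := by
      funext x
      simp only [f, Function.comp_apply, map_mul, map_inv, ← adjointMap_mul, inv_mul_cancel_right]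
    rw [h4] at h3
    exact h3.congr_mfderiv (ContinuousLinearMap.zero_comp _)
  have h1 : IsLocallyConstant (f Y Z) :=
    isLocallyConstant_of_mfderiv_eq_zero (E := E') (F := ℝ)
      (fun c => (hf c).mdifferentiableAt) fun c => (hf c).mfderiv
  have h2 := h1.apply_eq_of_preconnectedSpace k 1
  simpa only [f, map_one, adjointMap_one] using h2

end NormalInvariance

/-! ### Fibrations of GO-spaces -/

theorem exists_inverse_on_submodule {E : Type*} [NormedAddCommGroup E] [NormedSpace ℝ E]
    {F : Type*} [NormedAddCommGroup F] [NormedSpace ℝ F] [FiniteDimensional ℝ F]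
    {A : E →L[ℝ] F} {N : Submodule ℝ E} (hinj : ∀ X ∈ N, A X = 0 → X = 0)
    (hsurj : ∀ v, ∃ X ∈ N, A X = v) :
    ∃ r : F →L[ℝ] E, (∀ v, r v ∈ N) ∧ (∀ v, A (r v) = v) ∧ ∀ X ∈ N, r (A X) = X := by
  have hT : Function.Bijective (A.toLinearMap.domRestrict N) := by
    constructor
    · rw [injective_iff_map_eq_zero]
      exact fun X h => Subtype.ext (hinj X X.2 h)
    · intro v
      obtain ⟨X, hX, h⟩ := hsurj v
      exact ⟨⟨X, hX⟩, h⟩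
  let e : N ≃ₗ[ℝ] F := LinearEquiv.ofBijective _ hT
  exact ⟨LinearMap.toContinuousLinearMap (N.subtype ∘ₗ e.symm.toLinearMap),
    fun v => (e.symm v).2, fun v => e.apply_symm_apply v,
    fun X hX => congrArg Subtype.val (e.symm_apply_apply ⟨X, hX⟩)⟩

section Fibration

set_option linter.unusedSectionVars false

variable {E : Type*} [NormedAddCommGroup E] [NormedSpace ℝ E] [FiniteDimensional ℝ E]
  {G : Type*} [TopologicalSpace G] [ChartedSpace E G] [Group G] [LieGroup 𝓘(ℝ, E) ∞ G]

/-! ### Equivariance of the projection between coset spaces -/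

section Projection

variable {H S : Subgroup G} {F : Type*} [NormedAddCommGroup F] [NormedSpace ℝ F]
  [FiniteDimensional ℝ F] [ChartedSpace F (G ⧸ H)] [IsManifold 𝓘(ℝ, F) ∞ (G ⧸ H)]
  {F₂ : Type*} [NormedAddCommGroup F₂] [NormedSpace ℝ F₂] [FiniteDimensional ℝ F₂]
  [ChartedSpace F₂ (G ⧸ S)] [IsManifold 𝓘(ℝ, F₂) ∞ (G ⧸ S)]

theorem quotientMapOfLE_smul (h : H ≤ S) (a : G) (x : G ⧸ H) :
    Subgroup.quotientMapOfLE h (a • x) = a • Subgroup.quotientMapOfLE h x := by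
  obtain ⟨c, rfl⟩ := QuotientGroup.mk_surjective x
  rfl

theorem contMDiff_quotientMapOfLE (hM : IsHomogeneousManifold E F H)
    (hN : IsHomogeneousManifold E F₂ S) (h : H ≤ S) :
    ContMDiff 𝓘(ℝ, F) 𝓘(ℝ, F₂) ∞ (Subgroup.quotientMapOfLE h) :=
  hM.contMDiff_of_comp_mk hN.contMDiff_mk

variable (F F₂) in
/-- The differential of `G/H → G/S`, on the model spaces. -/
def quotientDiff (h : H ≤ S) (x : G ⧸ H) : F →L[ℝ] F₂ :=
  mfderiv 𝓘(ℝ, F) 𝓘(ℝ, F₂) (Subgroup.quotientMapOfLE h) x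

theorem quotientDiff_actDiff (hM : IsHomogeneousManifold E F H)
    (hN : IsHomogeneousManifold E F₂ S) (h : H ≤ S) (a : G) (x : G ⧸ H) (v : F) :
    quotientDiff F F₂ h (a • x) (actDiff F a x v)
      = actDiff F₂ a (Subgroup.quotientMapOfLE h x) (quotientDiff F F₂ h x v) := by
  have := hM.smooth_smul
  have := hN.smooth_smul
  have hd : ∀ x, MDifferentiableAt 𝓘(ℝ, F) 𝓘(ℝ, F₂) (Subgroup.quotientMapOfLE h) x := fun x =>
    (contMDiff_quotientMapOfLE hM hN h).mdifferentiableAt (by simp)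
  have h1 := actDiff_comp E (hd x) a v
  have h2 : MDifferentiableAt 𝓘(ℝ, F) 𝓘(ℝ, F) (fun y : G ⧸ H => a • y) x :=
    (contMDiff_const_smul' E a).mdifferentiableAt (by simp)
  have h3 := ((hd (a • x)).hasMFDerivAt.comp x h2.hasMFDerivAt).mfderiv
  have h4 : (Subgroup.quotientMapOfLE h) ∘ (fun y => a • y)
      = fun y => a • Subgroup.quotientMapOfLE h y := by
    funext y; exact quotientMapOfLE_smul h a y
  rw [h4] at h3
  exact (DFunLike.congr_fun h3 v).symm.trans h1

theorem quotientDiff_actVec (hM : IsHomogeneousManifold E F H)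
    (hN : IsHomogeneousManifold E F₂ S) (h : H ≤ S) (X : E) :
    quotientDiff F F₂ h ((1 : G) : G ⧸ H) (actVec E G F ((1 : G) : G ⧸ H) X)
      = actVec E G F₂ ((1 : G) : G ⧸ S) X := by
  have hd : MDifferentiableAt 𝓘(ℝ, F) 𝓘(ℝ, F₂) (Subgroup.quotientMapOfLE h) ((1 : G) : G ⧸ H) :=
    (contMDiff_quotientMapOfLE hM hN h).mdifferentiableAt (by simp)
  have h1 := (hd.hasMFDerivAt.comp (1 : G)
    (hM.contMDiff_mk.mdifferentiableAt (by simp)).hasMFDerivAt).mfderiv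
  have h2 : (mfderiv 𝓘(ℝ, E) 𝓘(ℝ, F) (fun a : G => (a : G ⧸ H)) 1 X : F)
      = actVec E G F ((1 : G) : G ⧸ H) X := projDiff_eq_actVec X
  refine (congrArg (quotientDiff F F₂ h ((1 : G) : G ⧸ H)) h2).symm.trans ?_
  exact (DFunLike.congr_fun h1 X).symm.trans (projDiff_eq_actVec X)

end Projection

variable [T2Space G]
  {H : Subgroup G} {F : Type*} [NormedAddCommGroup F] [NormedSpace ℝ F] [FiniteDimensional ℝ F]
  [ChartedSpace F (G ⧸ H)] [IsManifold 𝓘(ℝ, F) ∞ (G ⧸ H)]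
  {E' : Type*} [NormedAddCommGroup E'] [NormedSpace ℝ E'] [FiniteDimensional ℝ E']
  {K : Type*} [TopologicalSpace K] [ChartedSpace E' K] [Group K] [LieGroup 𝓘(ℝ, E') ∞ K]
  {ι : K →* G} {g : SmoothMetric F (G ⧸ H)} {N : Submodule ℝ E}
  {F₂ : Type*} [NormedAddCommGroup F₂] [NormedSpace ℝ F₂] [FiniteDimensional ℝ F₂]
  [ChartedSpace F₂ (G ⧸ ι.range)] [IsManifold 𝓘(ℝ, F₂) ∞ (G ⧸ ι.range)]

/-- The kernel of the differential of `G → G/K` is `𝔨`. -/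
theorem actVec_range_eq_zero_iff [T2Space K] [ConnectedSpace K]
    (hN : IsHomogeneousManifold E F₂ ι.range)
    (hι : IsLieSubgroup (E := E) (E' := E') ι) {X : E} :
    actVec E G F₂ ((1 : G) : G ⧸ ι.range) X = 0 ↔ ∃ Y : E', lieHom E E' ι Y = X := by
  have := hN.smooth_smul
  constructor
  · intro h
    exact hι.subgroupLieAlgebra_subset le_rfl ((mem_subgroupLieAlgebra_iff (F := F₂) X).2 h)
  · rintro ⟨Y, rfl⟩
    have : CompleteSpace E' := FiniteDimensional.complete ℝ E'
    obtain ⟨ψ, hψ, hY⟩ := exists_isOneParameterSubgroup (L := K) Y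
    have hY' : Y = velocity E' ψ 0 := hY
    rw [hY', ← velocity_comp_hom hι.contMDiff hψ]
    exact actVec_eq_zero_of_mem (isOneParameterSubgroup_comp hι.contMDiff hψ)
      fun t => ⟨ψ t, rfl⟩

/-- The metric on `G/K` for which `𝔭^⊥ → T(G/K)` is isometric. -/
theorem exists_quotientMetric [T2Space K] [ConnectedSpace K] (hM : IsHomogeneousManifold E F H)
    (hι : IsLieSubgroup (E := E) (E' := E') ι) (hHK : H ≤ ι.range)
    (hN : IsHomogeneousManifold E F₂ ι.range)
    (hdec : ∀ X : E, ∃ Y : E', ∃ Z ∈ N, X = lieHom E E' ι Y + Z)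
    (hdisj : ∀ X : E', lieHom E E' ι X ∈ N → lieHom E E' ι X = 0)
    (hAd : ∀ k : K, ∀ X ∈ N, adjointMap E (ι k) X ∈ N)
    (hQ : ∀ k : K, ∀ X ∈ N, ∀ Y ∈ N,
      modelForm g (adjointMap E (ι k) X) (adjointMap E (ι k) Y) = modelForm g X Y) :
    ∃ gN : SmoothMetric F₂ (G ⧸ ι.range), IsInvariantMetric G gN ∧
      ∀ X ∈ N, ∀ Y ∈ N, modelForm gN X Y = modelForm g X Y := by
  have := hM.smooth_smul
  have := hN.smooth_smul
  set o : G ⧸ ι.range := ((1 : G) : G ⧸ ι.range) with ho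
  -- Since 𝔤 = 𝔨 ⊕ N and 𝔨 is the kernel, N maps isomorphically to the tangent space of G/K; r is
  -- the inverse and carries the isotropy action to Ad.
  obtain ⟨r, hrN, hTr, hrT⟩ := exists_inverse_on_submodule (A := actVec E G F₂ o) (N := N)
    (fun X hX h => by
      obtain ⟨Y, rfl⟩ := (actVec_range_eq_zero_iff hN hι).1 h
      exact hdisj Y hX)
    (fun v => by
      obtain ⟨X, rfl⟩ := hN.actVec_one_surjective v
      obtain ⟨Y, Z, hZ, rfl⟩ := hdec X
      exact ⟨Z, hZ, by rw [map_add, (actVec_range_eq_zero_iff hN hι).2 ⟨Y, rfl⟩, zero_add]⟩)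
  let q : F₂ →L[ℝ] F₂ →L[ℝ] ℝ := (modelForm g).bilinearComp r r
  have hq : ∀ v w, q v w = modelForm g (r v) (r w) := fun _ _ => rfl
  have hpos : ∀ v, v ≠ 0 → 0 < q v v := by
    intro v hv
    rw [hq, modelForm_apply]
    refine innerAt_pos g _ fun h0 => hv ?_
    obtain ⟨Y, hY⟩ := hι.subgroupLieAlgebra_subset hHK
      ((mem_subgroupLieAlgebra_iff (F := F) (r v)).2 h0)
    have h1 := hdisj Y (hY ▸ hrN v)
    rw [← hTr v, ← hY, h1, map_zero]
  have hinv : ∀ s ∈ ι.range, ∀ v w, q (actDiff F₂ s o v) (actDiff F₂ s o w) = q v w := by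
    rintro _ ⟨k, rfl⟩ v w
    have hko : ι k • o = o := smul_one_eq_one_iff.2 ⟨k, rfl⟩
    have h1 : ∀ v, r (actDiff F₂ (ι k) o v) = adjointMap E (ι k) (r v) := by
      intro v
      have h2 := actDiff_actVec (F := F₂) (ι k) o (r v)
      rw [hTr, hko] at h2
      rw [h2, hrT _ (hAd k _ (hrN v))]
    rw [hq, hq, h1, h1, hQ k _ (hrN v) _ (hrN w)]
  have hsymm : ∀ v w, q v w = q w v := fun v w => by rw [hq, hq, modelForm_symm]
  obtain ⟨gN, hgN, hgq⟩ := exists_invariantMetric hN q hsymm hpos hinv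
  refine ⟨gN, hgN, fun X hX Y hY => ?_⟩
  rw [modelForm_apply, hgq, hq, hrT X hX, hrT Y hY]

theorem eq_of_modelForm_eq [T2Space K] [ConnectedSpace K]
    (hι : IsLieSubgroup (E := E) (E' := E') ι) (hN : IsHomogeneousManifold E F₂ ι.range)
    (hdec : ∀ X : E, ∃ Y : E', ∃ Z ∈ N, X = lieHom E E' ι Y + Z)
    {g₁ g₂ : SmoothMetric F₂ (G ⧸ ι.range)} (h₁ : IsInvariantMetric G g₁)
    (h₂ : IsInvariantMetric G g₂) (h : ∀ X ∈ N, ∀ Y ∈ N, modelForm g₁ X Y = modelForm g₂ X Y) :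
    g₁ = g₂ := by
  refine eq_of_isInvariantMetric hN h₁ h₂ fun v w => ?_
  have hs : ∀ v : F₂, ∃ X ∈ N, actVec E G F₂ ((1 : G) : G ⧸ ι.range) X = v := by
    intro v
    obtain ⟨X, rfl⟩ := hN.actVec_one_surjective v
    obtain ⟨Y, Z, hZ, rfl⟩ := hdec X
    exact ⟨Z, hZ, by rw [map_add, (actVec_range_eq_zero_iff hN hι).2 ⟨Y, rfl⟩, zero_add]⟩
  obtain ⟨X, hX, rfl⟩ := hs v
  obtain ⟨Y, hY, rfl⟩ := hs w
  exact h X hX Y hY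

variable {gN : SmoothMetric F₂ (G ⧸ ι.range)}

/-- Against X in N, the 𝔨-component of Y contributes nothing on either side: it projects to 0 in
G/K, and it is orthogonal to N in G/H. -/
theorem modelForm_quotient_eq [T2Space K] [ConnectedSpace K]
    (hι : IsLieSubgroup (E := E) (E' := E') ι) (hN : IsHomogeneousManifold E F₂ ι.range)
    (hdec : ∀ X : E, ∃ Y : E', ∃ Z ∈ N, X = lieHom E E' ι Y + Z)
    (hQN : ∀ (X : E'), ∀ Y ∈ N, modelForm g (lieHom E E' ι X) Y = 0)
    (hgN : ∀ X ∈ N, ∀ Y ∈ N, modelForm gN X Y = modelForm g X Y) {X : E} (hX : X ∈ N) (Y : E) :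
    modelForm gN X Y = modelForm g X Y := by
  obtain ⟨Y, Z, hZ, rfl⟩ := hdec Y
  have h1 : modelForm gN X (lieHom E E' ι Y) = 0 := by
    rw [modelForm_apply, (actVec_range_eq_zero_iff hN hι).2 ⟨Y, rfl⟩, map_zero]
  rw [map_add, map_add, h1, hgN X hX Z hZ, modelForm_symm X (lieHom E E' ι Y), hQN Y X hX]

/-- For Z in N, a geodesic vector V over Z_o in G/H equals Z up to 𝔥 ⊆ 𝔨, so it also lies over the
image of Z in G/K. By `modelForm_quotient_eq` its defining condition is the same in both spaces. -/
theorem isGOMetric_quotient [T2Space K] [ConnectedSpace K] [T2Space (G ⧸ ι.range)]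
    (hM : IsHomogeneousManifold E F H) (hι : IsLieSubgroup (E := E) (E' := E') ι)
    (hHK : H ≤ ι.range) (hN : IsHomogeneousManifold E F₂ ι.range) (hg : IsGOMetric E G g)
    (hdec : ∀ X : E, ∃ Y : E', ∃ Z ∈ N, X = lieHom E E' ι Y + Z)
    (hQN : ∀ (X : E'), ∀ Y ∈ N, modelForm g (lieHom E E' ι X) Y = 0)
    (hgNi : IsInvariantMetric G gN)
    (hgN : ∀ X ∈ N, ∀ Y ∈ N, modelForm gN X Y = modelForm g X Y) : IsGOMetric E G gN := by
  have := hM.smooth_smul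
  have := hN.smooth_smul
  have : CompleteSpace E := FiniteDimensional.complete ℝ E
  refine isGOMetric_of_isGeodesicVector hgNi
    (actVec_surjective_of_transitive exists_smul_one_eq hN.actVec_one_surjective)
    (o := ((1 : G) : G ⧸ ι.range)) exists_smul_one_eq fun v => ?_
  obtain ⟨X, rfl⟩ := hN.actVec_one_surjective v
  obtain ⟨Y, Z, hZ, rfl⟩ := hdec X
  obtain ⟨V, hV, hVZ⟩ := hg.exists_isGeodesicVector
    (actVec_surjective_of_transitive exists_smul_one_eq hM.actVec_one_surjective)
    ((1 : G) : G ⧸ H) (actVec E G F ((1 : G) : G ⧸ H) Z)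
  have hW : actVec E G F ((1 : G) : G ⧸ H) (V - Z) = 0 := by rw [map_sub, hVZ, sub_self]
  have hVN : actVec E G F₂ ((1 : G) : G ⧸ ι.range) V = actVec E G F₂ ((1 : G) : G ⧸ ι.range) Z := by
    rw [← sub_eq_zero, ← map_sub, actVec_range_eq_zero_iff hN hι]
    exact hι.subgroupLieAlgebra_subset hHK ((mem_subgroupLieAlgebra_iff (F := F) _).2 hW)
  refine ⟨V, fun U => ?_, ?_⟩
  · rw [hVN, ← modelForm_apply, modelForm_quotient_eq hι hN hdec hQN hgN hZ, modelForm_apply,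
      ← hVZ]
    exact hV U
  · rw [hVN, map_add, (actVec_range_eq_zero_iff hN hι).2 ⟨Y, rfl⟩, zero_add]

theorem isRiemannianSubmersion_quotientMapOfLE [T2Space K] [ConnectedSpace K]
    (hM : IsHomogeneousManifold E F H) (hι : IsLieSubgroup (E := E) (E' := E') ι)
    (hHK : H ≤ ι.range) (hN : IsHomogeneousManifold E F₂ ι.range) (hg : IsInvariantMetric G g)
    (hdec : ∀ X : E, ∃ Y : E', ∃ Z ∈ N, X = lieHom E E' ι Y + Z)
    (hQN : ∀ (X : E'), ∀ Y ∈ N, modelForm g (lieHom E E' ι X) Y = 0)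
    (hgNi : IsInvariantMetric G gN)
    (hgN : ∀ X ∈ N, ∀ Y ∈ N, modelForm gN X Y = modelForm g X Y) :
    IsRiemannianSubmersion g gN (Subgroup.quotientMapOfLE hHK) := by
  have := hM.smooth_smul
  have := hN.smooth_smul
  set o : G ⧸ H := ((1 : G) : G ⧸ H) with ho
  have hact : ∀ (a : G) (v : F), ∃ v₀ : F, actDiff F a o v₀ = v := fun a v =>
    ⟨_, actDiff_apply_inv E a o v⟩
  -- The horizontal space at o comes from N: a horizontal vector is orthogonal to the image of its
  -- own 𝔨-component, which therefore has length zero.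
  have hhor : ∀ v : F, (∀ u : F, quotientDiff F F₂ hHK o u = 0 → innerAt g o v u = 0) →
      ∃ X ∈ N, actVec E G F o X = v := by
    intro v hv
    obtain ⟨X, rfl⟩ := hM.actVec_one_surjective v
    obtain ⟨Y, Z, hZ, rfl⟩ := hdec X
    have h1 : modelForm g (lieHom E E' ι Y + Z) (lieHom E E' ι Y) = 0 :=
      hv (actVec E G F o (lieHom E E' ι Y)) (by
        rw [quotientDiff_actVec hM hN, (actVec_range_eq_zero_iff hN hι).2 ⟨Y, rfl⟩])
    rw [map_add, add_apply, modelForm_symm Z, hQN Y Z hZ, add_zero] at h1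
    exact ⟨Z, hZ, by rw [map_add, actVec_eq_zero_of_modelForm h1, zero_add]⟩
  refine ⟨contMDiff_quotientMapOfLE hM hN hHK, ?_, ?_, ?_⟩
  · intro y
    obtain ⟨a, rfl⟩ := QuotientGroup.mk_surjective y
    exact ⟨(a : G ⧸ H), rfl⟩
  · intro x
    obtain ⟨a, rfl⟩ := exists_smul_one_eq x
    intro w
    obtain ⟨X, hX⟩ := actVec_surjective_of_transitive (E := E) (F := F₂) exists_smul_one_eq
      hN.actVec_one_surjective (Subgroup.quotientMapOfLE hHK (a • o)) w
    refine ⟨actDiff F a o (actVec E G F o (adjointMap E a⁻¹ X)), ?_⟩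
    refine (quotientDiff_actDiff hM hN hHK a o _).trans ?_
    have h1 : actDiff F₂ a (Subgroup.quotientMapOfLE hHK o)
        (actVec E G F₂ ((1 : G) : G ⧸ ι.range) (adjointMap E a⁻¹ X)) = w := by
      refine (actDiff_actVec a ((1 : G) : G ⧸ ι.range) (adjointMap E a⁻¹ X)).trans ?_
      rw [adjointMap_apply_inv, ← hX]
      rfl
    rw [quotientDiff_actVec hM hN]
    exact h1
  · have key : ∀ (x : G ⧸ H) (v w : F),
        (∀ u : F, quotientDiff F F₂ hHK x u = 0 → innerAt g x v u = 0) →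
        (∀ u : F, quotientDiff F F₂ hHK x u = 0 → innerAt g x w u = 0) →
        innerAt gN (Subgroup.quotientMapOfLE hHK x) (quotientDiff F F₂ hHK x v)
          (quotientDiff F F₂ hHK x w) = innerAt g x v w := by
      intro x v w hv hw
      obtain ⟨a, rfl⟩ := exists_smul_one_eq x
      have htr : ∀ v : F, (∀ u : F, quotientDiff F F₂ hHK (a • o) u = 0 →
          innerAt g (a • o) (actDiff F a o v) u = 0) →
          ∃ X ∈ N, actVec E G F o X = v := fun v h => hhor v fun u hu => by
        rw [← isInvariantMetric_iff.1 hg a]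
        exact h _ (by rw [quotientDiff_actDiff hM hN, hu, map_zero])
      obtain ⟨v, rfl⟩ := hact a v
      obtain ⟨w, rfl⟩ := hact a w
      obtain ⟨X, hX, rfl⟩ := htr v hv
      obtain ⟨Y, hY, rfl⟩ := htr w hw
      rw [quotientDiff_actDiff hM hN, quotientDiff_actDiff hM hN, quotientMapOfLE_smul,
        isInvariantMetric_iff.1 hgNi, isInvariantMetric_iff.1 hg, quotientDiff_actVec hM hN,
        quotientDiff_actVec hM hN]
      exact hgN X hX Y hY
    exact key

/-- The fibres of `G/H → G/K` are the translates of the orbit of `K`. -/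
theorem range_smul_orbitMap (hHK : H ≤ ι.range) (a : G) :
    Set.range (fun x => a • orbitMap H ι x) =
      Subgroup.quotientMapOfLE hHK ⁻¹' {(a : G ⧸ ι.range)} := by
  ext x
  obtain ⟨c, rfl⟩ := QuotientGroup.mk_surjective x
  rw [Set.mem_preimage, Subgroup.quotientMapOfLE_apply_mk, Set.mem_singleton_iff, eq_comm,
    QuotientGroup.eq]
  constructor
  · rintro ⟨y, hy⟩
    obtain ⟨k, rfl⟩ := QuotientGroup.mk_surjective y
    simp only [orbitMap_mk, MulAction.Quotient.smul_coe, smul_eq_mul, QuotientGroup.eq] at hy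
    have h1 := ι.range.mul_mem (show ι k ∈ ι.range from ⟨k, rfl⟩) (hHK hy)
    have h2 : ι k * ((a * ι k)⁻¹ * c) = a⁻¹ * c := by group
    rwa [h2] at h1
  · rintro ⟨k, hk⟩
    refine ⟨(k : K ⧸ H.comap ι), ?_⟩
    simp only [orbitMap_mk, MulAction.Quotient.smul_coe, smul_eq_mul, hk, mul_inv_cancel_left]

/-- A connected Lie group is σ-compact, so by the open mapping theorem K is homeomorphic to its
closed, hence compact, image. Compactness then makes the fibres embedded. -/
theorem IsLieSubgroup.compactSpace [CompactSpace G] [ConnectedSpace K]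
    (hι : IsLieSubgroup (E := E) (E' := E') ι) (hc : IsClosed (Set.range ι)) : CompactSpace K := by
  have : IsTopologicalGroup K := topologicalGroup_of_lieGroup 𝓘(ℝ, E') ∞
  have : IsTopologicalGroup G := topologicalGroup_of_lieGroup 𝓘(ℝ, E) ∞
  have : LocallyCompactSpace K := Manifold.locallyCompact_of_finiteDimensional 𝓘(ℝ, E')
  have : SigmaCompactSpace K := sigmaCompactSpace_of_connectedSpace K
  have hcr : CompactSpace ι.range := isCompact_iff_compactSpace.1 hc.isCompact
  have hcont : Continuous ι.rangeRestrict := hι.contMDiff.continuous.subtype_mk _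
  have hopen := MonoidHom.isOpenMap_of_sigmaCompact ι.rangeRestrict
    ι.rangeRestrict_surjective hcont
  have hbij : Function.Bijective ι.rangeRestrict :=
    ⟨fun x y h => hι.injective (congrArg Subtype.val h), ι.rangeRestrict_surjective⟩
  exact ((Equiv.ofBijective _ hbij).toHomeomorphOfContinuousOpen hcont hopen).symm.compactSpace

theorem isEmbedding_smul_orbitMap [CompactSpace K] [T2Space (G ⧸ H)]
    (hM : IsHomogeneousManifold E F H) (hι : IsLieSubgroup (E := E) (E' := E') ι)
    {F' : Type*} [NormedAddCommGroup F'] [NormedSpace ℝ F'] [FiniteDimensional ℝ F']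
    [ChartedSpace F' (K ⧸ H.comap ι)] [IsManifold 𝓘(ℝ, F') ∞ (K ⧸ H.comap ι)]
    (hP : IsHomogeneousManifold E' F' (H.comap ι)) (a : G) :
    Topology.IsEmbedding (fun x => a • orbitMap H ι x) := by
  have := hM.smooth_smul
  have h1 : Continuous (fun x : K ⧸ H.comap ι => a • orbitMap H ι x) :=
    ((contMDiff_const_smul' (F := F) E a).comp
      (contMDiff_orbitMap hM hι.contMDiff hP)).continuous
  exact (h1.isClosedEmbedding fun x y h =>
    orbitMap_injective (MulAction.injective a h)).isEmbedding

end Fibration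
end

/-! ### Assembly of the theorem -/

theorem proposition3p2
    {E : Type*} [NormedAddCommGroup E] [NormedSpace ℝ E] [FiniteDimensional ℝ E]
    {G : Type*} [TopologicalSpace G] [ChartedSpace E G] [Group G] [LieGroup 𝓘(ℝ, E) ∞ G]
    [T2Space G] [CompactSpace G] [ConnectedSpace G]
    -- a fixed `Ad_G`-invariant Euclidean metric on the Lie algebra of `G`
    (b : LinearMap.BilinForm ℝ (GroupLieAlgebra 𝓘(ℝ, E) G)) (hb : IsInvariantEuclidean b)
    -- the GO-space `M = G/H`
    (H : Subgroup G) (hH : IsClosed (H : Set G))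
    {F : Type*} [NormedAddCommGroup F] [NormedSpace ℝ F] [FiniteDimensional ℝ F]
    [ChartedSpace F (G ⧸ H)] [IsManifold 𝓘(ℝ, F) ∞ (G ⧸ H)]
    (hM : IsHomogeneousManifold E F H)
    (g : SmoothMetric F (G ⧸ H)) (hg : IsGOMetric E G g)
    -- a connected Lie subgroup `K` of `G` containing `H`, and the manifold `K/H`
    {E' : Type*} [NormedAddCommGroup E'] [NormedSpace ℝ E'] [FiniteDimensional ℝ E']
    {K : Type*} [TopologicalSpace K] [ChartedSpace E' K] [Group K] [LieGroup 𝓘(ℝ, E') ∞ K]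
    [ConnectedSpace K]
    (ι : K →* G) (hι : IsLieSubgroup (E := E) (E' := E') ι) (hHK : H ≤ ι.range)
    {F' : Type*} [NormedAddCommGroup F'] [NormedSpace ℝ F'] [FiniteDimensional ℝ F']
    [ChartedSpace F' (K ⧸ H.comap ι)] [IsManifold 𝓘(ℝ, F') ∞ (K ⧸ H.comap ι)]
    (hP : IsHomogeneousManifold E' F' (H.comap ι)) :
    -- the orbit `P = Ko = K/H` with the induced metric is totally geodesic and a GO-space
    (Function.Injective (orbitMap H ι) ∧
      ∃ gP : SmoothMetric F' (K ⧸ H.comap ι),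
        IsTotallyGeodesic gP g (orbitMap H ι) ∧ IsGOMetric E' K gP) ∧
    -- if `𝔭 = 𝔨 ∩ 𝔪` is invariant under the metric endomorphism, then ...
    ((∀ X : reductiveComplement b H, (X : GroupLieAlgebra 𝓘(ℝ, E) G) ∈ tangentPart E' b H ι →
        (metricEndomorphism hb H g X : GroupLieAlgebra 𝓘(ℝ, E) G) ∈ tangentPart E' b H ι) →
      -- `[𝔨, 𝔭^⊥] ⊆ 𝔭^⊥`
      (∀ X Y : GroupLieAlgebra 𝓘(ℝ, E) G, X ∈ lieSubgroupAlgebra E' ι →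
        Y ∈ normalPart E' b H g ι → ⁅X, Y⁆ ∈ normalPart E' b H g ι) ∧
      -- the restriction of the metric to `𝔭^⊥` is `Ad_K`-invariant
      (∀ k : K, ∀ X ∈ normalPart E' b H g ι,
        adjointRep (ι k) X ∈ normalPart E' b H g ι ∧
        ∀ Y ∈ normalPart E' b H g ι,
          originForm H g (adjointRep (ι k) X) (adjointRep (ι k) Y) = originForm H g X Y) ∧
      -- for `K` closed, with `N = G/K`:
      (IsClosed (Set.range ι) →
        ∀ {F'' : Type*} [NormedAddCommGroup F''] [NormedSpace ℝ F''] [FiniteDimensional ℝ F'']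
          [ChartedSpace F'' (G ⧸ ι.range)] [IsManifold 𝓘(ℝ, F'') ∞ (G ⧸ ι.range)],
        IsHomogeneousManifold E F'' ι.range →
        ∃ gN : SmoothMetric F'' (G ⧸ ι.range),
          -- it defines an invariant metric on `N`, which is a GO-metric
          (∀ g' : SmoothMetric F'' (G ⧸ ι.range),
            (IsInvariantMetric G g' ∧
              ∀ X ∈ normalPart E' b H g ι, ∀ Y ∈ normalPart E' b H g ι,
                originForm ι.range g' X Y = originForm H g X Y) ↔ g' = gN) ∧
          IsGOMetric E G gN ∧
          -- `G/H → G/K` is a Riemannian submersion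
          IsRiemannianSubmersion g gN (Subgroup.quotientMapOfLE hHK) ∧
          -- its fibres `aP` are totally geodesic GO-spaces
          ∀ a : G,
            Set.range (fun x => a • orbitMap H ι x) =
              Subgroup.quotientMapOfLE hHK ⁻¹' {(a : G ⧸ ι.range)} ∧
            Topology.IsEmbedding (fun x => a • orbitMap H ι x) ∧
            ∃ gF : SmoothMetric F' (K ⧸ H.comap ι),
              IsTotallyGeodesic gF g (fun x => a • orbitMap H ι x) ∧
              IsGOMetric E' K gF)) := by
  have : T2Space K := T2Space.of_injective_continuous hι.injective hι.contMDiff.continuous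
  have : IsTopologicalGroup G := topologicalGroup_of_lieGroup 𝓘(ℝ, E) ∞
  have : IsTopologicalGroup K := topologicalGroup_of_lieGroup 𝓘(ℝ, E') ∞
  have : IsClosed ((H.comap ι : Subgroup K) : Set K) := hH.preimage hι.contMDiff.continuous
  have : T2Space (G ⧸ H) := inferInstance
  have : T2Space (K ⧸ H.comap ι) := inferInstance
  obtain ⟨gP, hgPi, hgP⟩ := exists_inducedMetric hM hι.contMDiff hP hg.1
  have hgPGO := isGOMetric_inducedMetric hM hι hHK hP hg hgPi hgP
  have hgPtg := isTotallyGeodesic_smul_orbitMap hM hι hHK hP hg hgPi hgP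
  refine ⟨⟨orbitMap_injective, gP, ?_, hgPGO⟩, fun hA => ?_⟩
  -- The orbit itself is the translate by a = 1.
  · simpa only [one_smul] using hgPtg 1
  let N : Submodule ℝ E := normalPart E' b H g ι
  let β : LinearMap.BilinForm ℝ E := b
  have hβ : ∀ (a : G) X Y, β (adjointMap E a X) (adjointMap E a Y) = β X Y := hb.invariant
  have hN : ∀ Y, Y ∈ N ↔ ∀ X : E', β (lieHom E E' ι X) Y = 0 := mem_normalPart_iff hM hι hHK hb hA
  have hQN : ∀ (X : E'), ∀ Y ∈ N, modelForm g (lieHom E E' ι X) Y = 0 := fun X Y hY =>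
    modelForm_lieHom_of_mem_normalPart hM hι hHK hb hY X
  have hAd : ∀ k : K, ∀ X ∈ N, adjointMap E (ι k) X ∈ N := fun k X hX =>
    adjointMap_mem_of_orthogonal hι.contMDiff hβ hN k hX
  have hQ : ∀ k : K, ∀ X ∈ N, ∀ Y ∈ N,
      modelForm g (adjointMap E (ι k) X) (adjointMap E (ι k) Y) = modelForm g X Y :=
    fun k X hX Y hY => modelForm_adjointMap hM hι hHK hg hβ hN hQN k hX hY
  refine ⟨?_, fun k X hX => ⟨hAd k X hX, fun Y hY => ?_⟩, fun hcl => ?_⟩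
  · rintro _ Y ⟨X, rfl⟩ hY
    exact lieBracketModel_mem_of_orthogonal hι.contMDiff hβ hN X hY
  · exact (originForm_eq_modelForm (E := E) _ _).trans
      ((hQ k X hX Y hY).trans (originForm_eq_modelForm (E := E) _ _).symm)
  intro F₂ _ _ _ _ _ hNm
  have hcl' : IsClosed ((ι.range : Subgroup G) : Set G) := by rwa [MonoidHom.coe_range]
  have : T2Space (G ⧸ ι.range) := inferInstance
  have : CompactSpace K := hι.compactSpace hcl
  -- N is the complement of 𝔨 for the positive definite form b, so it splits 𝔤. Here the assumption
  -- on A enters, through `hN`.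
  have hdec : ∀ X : E, ∃ Y : E', ∃ Z ∈ N, X = lieHom E E' ι Y + Z := by
    intro X
    obtain ⟨_, ⟨Y, rfl⟩, h⟩ := LinearMap.BilinForm.exists_orthogonal_decomposition (b := β)
      hb.symm hb.pos (LinearMap.range (lieHom E E' ι).toLinearMap) X
    exact ⟨Y, X - lieHom E E' ι Y, (hN _).2 fun Z => h _ ⟨Z, rfl⟩,
      (add_sub_cancel (lieHom E E' ι Y) X).symm⟩
  have hdisj : ∀ X : E', lieHom E E' ι X ∈ N → lieHom E E' ι X = 0 := by
    intro X hX
    by_contra h0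
    exact (hb.pos (lieHom E E' ι X) h0).ne' ((hN _).1 hX X)
  obtain ⟨gN, hgNi, hgN⟩ := exists_quotientMetric hM hι hHK hNm hdec hdisj hAd hQ
  have hform : ∀ (g' : SmoothMetric F₂ (G ⧸ ι.range)) (X Y : E),
      originForm (E := E) ι.range g' X Y = originForm (E := E) H g X Y ↔
        modelForm g' X Y = modelForm g X Y := fun g' X Y =>
    ⟨fun h => (originForm_eq_modelForm X Y).symm.trans (h.trans (originForm_eq_modelForm X Y)),
      fun h => (originForm_eq_modelForm X Y).trans (h.trans (originForm_eq_modelForm X Y).symm)⟩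
  refine ⟨gN, fun g' => ⟨fun h => ?_, ?_⟩,
    isGOMetric_quotient hM hι hHK hNm hg hdec hQN hgNi hgN,
    isRiemannianSubmersion_quotientMapOfLE hM hι hHK hNm hg.1 hdec hQN hgNi hgN,
    -- One metric on K/(K ∩ H) serves all fibres, because a acts on G/H by isometries.
    fun a => ⟨range_smul_orbitMap hHK a, isEmbedding_smul_orbitMap hM hι hP a, gP, hgPtg a,
      hgPGO⟩⟩
  · exact eq_of_modelForm_eq hι hNm hdec h.1 hgNi fun X hX Y hY =>
      ((hform g' X Y).1 (h.2 X hX Y hY)).trans (hgN X hX Y hY).symm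
  · rintro rfl
    exact ⟨hgNi, fun X hX Y hY => (hform g' X Y).2 (hgN X hX Y hY)⟩
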